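/- Corollary (no globally hyperbolic AdS spacetime of genus zero). Let $(M,g)$ be a three-dimensional Anti-de Sitter spacetime, that is, a connected (Hausdorff, second countable) smooth $3$-manifold $M$ with a smooth Lorentzian metric $g$ of signature $(2,1)$ which is time-orientable and has constant sectional curvature $-1$, i.e. $$g(R(u,v)v,u)=-\bigl(g(u,u)g(v,v)-g(u,v)^2\bigr)$$ for all tangent vectors $u,v$ at every point, where $R(u,v)w=\nabla_u\nabla_v w-\nabla_v\nabla_u w-\nabla_{[u,v]}w$ is the curvature of the Levi-Civita connection. Recall that a subset $X\subset M$ is a Cauchy surface if it is achronal (no two points of $X$, distinct or not, are joined by a timelike $C^1$ curve) and every inextensible causal $C^1$ curve of $M$ meets $X$, and that $M$ is globally hyperbolic if it has a Cauchy surface. Then no Cauchy surface of $M$ is homeomorphic to the sphere $S^2$. In other words, there exists no globally hyperbolic Anti-de Sitter spacetime of dimension three whose Cauchy surfaces are spheres. -/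

import Mathlib

open Set Filter Topology Manifold ContDiff Bundle

noncomputable section

/-- The model space `ℝ³` of three-dimensional manifolds. -/
abbrev E3 : Type := EuclideanSpace ℝ (Fin 3)

/-! ### Curvature of a pseudo-Riemannian metric on an open subset of `ℝ³`

The metric is a field `G` of bilinear forms; `G x u v` is its value at `x` on the vectors `u`, `v`.
Vectors of `ℝ³` are also regarded as constant (coordinate) vector fields. -/

namespace MetricOnE3

/-- The Christoffel symbols of the first kind: `w ↦ (∂_u G(v,w) + ∂_v G(u,w) - ∂_w G(u,v)) / 2`. -/
def christoffelFirst (G : E3 → E3 →L[ℝ] E3 →L[ℝ] ℝ) (x u v : E3) : E3 →L[ℝ] ℝ :=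
  (1 / 2 : ℝ) • (fderiv ℝ G x u v + fderiv ℝ G x v u - ((fderiv ℝ G x).flip u).flip v)

/-- The Christoffel symbols of the second kind: `christoffel G x u v` is the value at `x` of the
Levi-Civita derivative `∇_u v`, that is, the vector `z` with
`G x z w = christoffelFirst G x u v w` for all `w` (`G x` being non-degenerate). -/
def christoffel (G : E3 → E3 →L[ℝ] E3 →L[ℝ] ℝ) (x u v : E3) : E3 :=
  (G x).inverse (christoffelFirst G x u v)

/-- The Riemann tensor `R(u,v)w = ∇_u ∇_v w - ∇_v ∇_u w - ∇_[u,v] w` at `x`; the bracket of the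
constant fields `u` and `v` vanishes. -/
def riemann (G : E3 → E3 →L[ℝ] E3 →L[ℝ] ℝ) (x u v w : E3) : E3 :=
  (fderiv ℝ (fun y => christoffel G y v w) x u + christoffel G x u (christoffel G x v w))
    - (fderiv ℝ (fun y => christoffel G y u w) x v + christoffel G x v (christoffel G x u w))

end MetricOnE3

variable {M : Type*} [TopologicalSpace M] [ChartedSpace E3 M]

/-- A smooth Lorentzian metric on a three-dimensional smooth manifold `M`: a smooth field of
symmetric bilinear forms of signature `(2,1)` on the tangent spaces. -/
structure LorentzianMetric (M : Type*) [TopologicalSpace M] [ChartedSpace E3 M]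
    [IsManifold (𝓡 3) ∞ M] where
  /-- The bilinear form on the tangent space at `x`. -/
  val : ∀ x : M, TangentSpace (𝓡 3) x →L[ℝ] TangentSpace (𝓡 3) x →L[ℝ] ℝ
  symm : ∀ (x : M) (v w : TangentSpace (𝓡 3) x), val x v w = val x w v
  /-- Every tangent space has an orthonormal basis, with two spacelike vectors and a timelike one. -/
  signature : ∀ x : M, ∃ b : Module.Basis (Fin 3) ℝ (TangentSpace (𝓡 3) x),
    ∀ i j, val x (b i) (b j) = Matrix.diagonal ![1, 1, -1] i j
  contMDiff : ContMDiff (𝓡 3) ((𝓡 3).prod 𝓘(ℝ, E3 →L[ℝ] E3 →L[ℝ] ℝ)) ∞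
    (fun x : M => TotalSpace.mk' (E3 →L[ℝ] E3 →L[ℝ] ℝ)
      (E := fun x : M => TangentSpace (𝓡 3) x →L[ℝ] TangentSpace (𝓡 3) x →L[ℝ] ℝ) x (val x))

namespace LorentzianMetric

variable [IsManifold (𝓡 3) ∞ M] (g : LorentzianMetric M)

/-! ### Constant sectional curvature -/

/-- The expression of the metric in the chart `e`: its pull-back by `e⁻¹`, a field of bilinear
forms on the open set `e.target` of `ℝ³`. -/
def inChart (e : OpenPartialHomeomorph M E3) (y : E3) : E3 →L[ℝ] E3 →L[ℝ] ℝ :=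
  let B : E3 →L[ℝ] E3 →L[ℝ] ℝ := g.val (e.symm y)
  let A : E3 →L[ℝ] E3 := mfderiv (𝓡 3) (𝓡 3) e.symm y
  B.bilinearComp A A

/-- `g` has constant sectional curvature `K`:
`g(R(u,v)v,u) = K (g(u,u) g(v,v) - g(u,v)²)` at every point and for all tangent vectors `u`, `v`,
computed in the charts of the atlas. -/
def HasConstantSectionalCurvature (K : ℝ) : Prop :=
  ∀ e ∈ atlas E3 M, ∀ x ∈ e.target, ∀ u v : E3,
    g.inChart e x (MetricOnE3.riemann (g.inChart e) x u v v) u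
      = K * (g.inChart e x u u * g.inChart e x v v - g.inChart e x u v ^ 2)

/-! ### Causality -/

/-- The tangent vector `v` is timelike. -/
def IsTimelike {x : M} (v : TangentSpace (𝓡 3) x) : Prop := g.val x v v < 0

/-- The tangent vector `v` is causal, that is, timelike or lightlike. -/
def IsCausal {x : M} (v : TangentSpace (𝓡 3) x) : Prop := v ≠ 0 ∧ g.val x v v ≤ 0

/-- `M` is time-orientable: it carries a continuous timelike vector field. -/
def IsTimeOrientable : Prop :=
  ∃ T : ∀ x : M, TangentSpace (𝓡 3) x,
    Continuous (fun x => (⟨x, T x⟩ : TangentBundle (𝓡 3) M)) ∧ ∀ x, g.IsTimelike (T x)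

end LorentzianMetric

/-- The velocity of the curve `γ` at time `t`. -/
def curveVelocity (γ : ℝ → M) (t : ℝ) : TangentSpace (𝓡 3) (γ t) :=
  mfderiv 𝓘(ℝ, ℝ) (𝓡 3) γ t (1 : ℝ)

/-- `γ` restricts to a `C¹` curve on the non-empty open interval (possibly unbounded) `J`. -/
structure IsC1CurveOn (γ : ℝ → M) (J : Set ℝ) : Prop where
  nonempty : J.Nonempty
  isOpen : IsOpen J
  ordConnected : J.OrdConnected
  contMDiffOn : ContMDiffOn 𝓘(ℝ, ℝ) (𝓡 3) 1 γ J

namespace LorentzianMetric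

variable [IsManifold (𝓡 3) ∞ M] (g : LorentzianMetric M)

/-- `γ` is a timelike curve on the open interval `J`. -/
def IsTimelikeCurveOn (γ : ℝ → M) (J : Set ℝ) : Prop :=
  IsC1CurveOn γ J ∧ ∀ t ∈ J, g.IsTimelike (curveVelocity γ t)

/-- `γ` is a causal curve on the open interval `J`. -/
def IsCausalCurveOn (γ : ℝ → M) (J : Set ℝ) : Prop :=
  IsC1CurveOn γ J ∧ ∀ t ∈ J, g.IsCausal (curveVelocity γ t)

/-- `γ` is an inextensible causal curve on the open interval `J`: it converges to no point of `M`
at either end of `J`. -/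
def IsInextensibleCausalCurveOn (γ : ℝ → M) (J : Set ℝ) : Prop :=
  g.IsCausalCurveOn γ J ∧
    (¬ ∃ p : M, Tendsto (fun t : J => γ t) atTop (𝓝 p)) ∧
    (¬ ∃ p : M, Tendsto (fun t : J => γ t) atBot (𝓝 p))

/-- `X` is achronal: no two points of `X`, distinct or not, are joined by a timelike curve. -/
def IsAchronal (X : Set M) : Prop :=
  ¬ ∃ (γ : ℝ → M) (J : Set ℝ), g.IsTimelikeCurveOn γ J ∧
    ∃ s ∈ J, ∃ t ∈ J, s < t ∧ γ s ∈ X ∧ γ t ∈ X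

/-- The domain of dependence of `X`: the points `p` such that every inextensible causal curve
through `p` meets `X`. -/
def domainOfDependence (X : Set M) : Set M :=
  {p | ∀ (γ : ℝ → M) (J : Set ℝ), g.IsInextensibleCausalCurveOn γ J →
    (∃ t ∈ J, γ t = p) → ∃ t ∈ J, γ t ∈ X}

/-- `X` is a Cauchy surface of `M`: an achronal subset whose domain of dependence is `M`. -/
def IsCauchySurface (X : Set M) : Prop :=
  g.IsAchronal X ∧ g.domainOfDependence X = univ

/-- `M` is an Anti-de Sitter spacetime: it is time-orientable and of constant sectional
curvature `-1`. -/
def IsAntiDeSitter : Prop :=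
  g.IsTimeOrientable ∧ g.HasConstantSectionalCurvature (-1)

end LorentzianMetric

end

/-! Anti-de Sitter space is a quadric in `ℝ^{2,2}`. A spacelike unit linear form restricts to it as
a function `f` with `Hess f = f g` and `|grad f|² = 1 + f²`, so the gradient of `f` is everywhere
spacelike. On `M` such functions exist only locally. They are the first components of the parallel
sections `(f, Z)`, normalised by `g(Z,Z) - f² = 1`, of a connection on `ℝ ⊕ TM` whose flatness is
equivalent to curvature `-1` (`IsMetricOn.tractorForm_flat`). By Frobenius
(`flat_system_exists_unique`) their germs form a locally constant sheaf
(`isLocalSystem_isLinearAt`).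

The sphere is simply connected, so the pull-back of this sheaf to a spherical Cauchy surface `X` has
a global section (`IsLocalSystem.exists_section_sphere`). Evaluating the section gives a continuous
function on `X`. It has a maximum by compactness, and near that point it is the restriction to `X`
of a single `f` with spacelike gradient.

This contradicts `IsCauchySurface.not_isLocalMaxOn`. Take a timelike field `T` orthogonal to the
gradient at the maximum `p`, and follow its integral curve through a point `q` slightly displaced
from `p` along the gradient. The curve is inextensible, so it meets `X`. If it does so near `q`,
then `f` exceeds `f p` there, because moving along `T` does not change `f` to first order. If it
does so farther away, the curve can be bent near `q` to pass through `p` while staying timelike; it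
then meets `X` twice, against achronality. -/

set_option maxSynthPendingDepth 3

/-! ### Flat linear systems of partial differential equations -/

section FlatSystem

variable {E V : Type*} [NormedAddCommGroup E] [NormedSpace ℝ E]
  [NormedAddCommGroup V] [NormedSpace ℝ V]

/-- A linear ordinary differential equation with small coefficients has a solution on `[0,1]`. -/
theorem exists_linear_ode_solution [CompleteSpace V] {B : ℝ → V →L[ℝ] V}
    (hB : ContinuousOn B (Icc 0 1)) (hb : ∀ t ∈ Icc (0 : ℝ) 1, ‖B t‖ ≤ 1 / 2) (v : V) :
    ∃ α : ℝ → V, α 0 = v ∧ ∀ t ∈ Icc (0 : ℝ) 1, HasDerivWithinAt α (B t (α t)) (Icc 0 1) t := by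
  have h0 : (0 : ℝ) ∈ Icc (0 : ℝ) 1 := by simp
  -- On the ball of radius `‖v‖` about `v` the field is at most `(1/2)(2‖v‖) = ‖v‖`, so a solution
  -- cannot leave the ball before time 1.
  have hpl : IsPicardLindelof (fun t x => B t x) (⟨0, h0⟩ : Icc (0 : ℝ) 1) v ‖v‖₊ 0 ‖v‖₊
      (1 / 2) := by
    constructor
    · intro t ht
      refine ((B t).lipschitz.weaken ?_).lipschitzOnWith
      rw [← NNReal.coe_le_coe]
      simpa using hb t ht
    · intro x _
      exact hB.clm_apply continuousOn_const
    · intro t ht x hx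
      have hx' : ‖x‖ ≤ 2 * ‖v‖ := by
        have := norm_le_norm_add_norm_sub' x v
        rw [mem_closedBall_iff_norm] at hx
        simp only [coe_nnnorm] at hx
        linarith
      calc ‖B t x‖ ≤ ‖B t‖ * ‖x‖ := (B t).le_opNorm x
        _ ≤ 1 / 2 * (2 * ‖v‖) := by gcongr; exact hb t ht
        _ = _ := by simp
    · simp
  exact hpl.exists_eq_forall_mem_Icc_hasDerivWithinAt₀

theorem HasDerivWithinAt.Ici_of_Icc {α : ℝ → V} {w : V} {t : ℝ}
    (h : HasDerivWithinAt α w (Icc 0 1) t) (ht : t ∈ Ico (0 : ℝ) 1) :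
    HasDerivWithinAt α w (Ici t) t := by
  refine h.mono_of_mem_nhdsWithin ?_
  exact mem_of_superset (Icc_mem_nhdsGE ht.2) (Icc_subset_Icc_left ht.1)

/-- With rate `1/2` over unit time the Grönwall factor is `e^{1/2} ≤ 2`, whence the constants 2. -/
theorem gronwall_unit {f f' : ℝ → V} {δ ε : ℝ}
    (hf : ∀ t ∈ Icc (0 : ℝ) 1, HasDerivWithinAt f (f' t) (Icc 0 1) t)
    (ha : ‖f 0‖ ≤ δ) (hδ : 0 ≤ δ) (hε : 0 ≤ ε)
    (bound : ∀ t ∈ Icc (0 : ℝ) 1, ‖f' t‖ ≤ 1 / 2 * ‖f t‖ + ε) :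
    ∀ t ∈ Icc (0 : ℝ) 1, ‖f t‖ ≤ 2 * δ + 2 * ε := by
  intro t ht
  have h := norm_le_gronwallBound_of_norm_deriv_right_le (K := 1 / 2) (ε := ε) (δ := δ)
    (fun t ht => (hf t ht).continuousWithinAt)
    (fun t ht => (hf t (Ico_subset_Icc_self ht)).Ici_of_Icc ht) ha
    (fun t ht => bound t (Ico_subset_Icc_self ht)) t ht
  rw [gronwallBound_of_K_ne_0 (by norm_num)] at h
  have he : Real.exp (1 / 2 * (t - 0)) ≤ 2 := by
    have h1 : Real.exp (1 / 2 * (t - 0)) ≤ Real.exp (1 / 2) := by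
      apply Real.exp_le_exp.2; linarith [ht.2]
    have h2 : Real.exp (1 / 2) * Real.exp (1 / 2) ≤ 4 := by
      rw [← Real.exp_add]; norm_num; linarith [Real.exp_one_lt_d9]
    nlinarith [Real.exp_pos (1 / 2)]
  have h3 : δ * Real.exp (1 / 2 * (t - 0)) ≤ δ * 2 := by gcongr
  have h4 : ε / (1 / 2) * (Real.exp (1 / 2 * (t - 0)) - 1) ≤ ε / (1 / 2) * 1 := by
    gcongr; linarith
  linarith

/-- Solutions of a linear system `dF = A F` on a ball are determined by a value. -/
theorem linear_system_unique {A : E → E →L[ℝ] V →L[ℝ] V} {c : E} {r a : ℝ}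
    (ha : ∀ x ∈ Metric.ball c r, ‖A x‖ ≤ a) (har : a * (2 * r) ≤ 1 / 2) {F F' : E → V}
    (hF : ∀ x ∈ Metric.ball c r, HasFDerivAt F ((A x).flip (F x)) x)
    (hF' : ∀ x ∈ Metric.ball c r, HasFDerivAt F' ((A x).flip (F' x)) x)
    {x₁ : E} (hx₁ : x₁ ∈ Metric.ball c r) (heq : F x₁ = F' x₁) :
    ∀ x ∈ Metric.ball c r, F x = F' x := by
  intro x hx
  have hseg : ∀ t ∈ Icc (0 : ℝ) 1, x₁ + t • (x - x₁) ∈ Metric.ball c r := fun t ht =>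
    (convex_ball c r).add_smul_sub_mem hx₁ hx ht
  have hdist : ‖x - x₁‖ ≤ 2 * r := by
    rw [← dist_eq_norm]
    have := dist_triangle_right x x₁ c
    rw [Metric.mem_ball] at hx hx₁
    linarith
  have hderiv : ∀ (t : ℝ), HasDerivAt (fun t : ℝ => x₁ + t • (x - x₁)) (x - x₁) t := by
    intro t
    simpa using ((hasDerivAt_id t).smul_const (x - x₁)).const_add x₁
  -- Along the segment from `x₁` to `x` the difference solves a linear equation with coefficient at
  -- most `a * (2 * r) ≤ 1/2` and zero initial value.
  have h := gronwall_unit (δ := 0) (ε := 0)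
    (f := fun t => F (x₁ + t • (x - x₁)) - F' (x₁ + t • (x - x₁)))
    (f' := fun t => A (x₁ + t • (x - x₁)) (x - x₁)
      (F (x₁ + t • (x - x₁)) - F' (x₁ + t • (x - x₁))))
    (by
      intro t ht
      have h1 := (hF _ (hseg t ht)).comp_hasDerivAt t (hderiv t)
      have h2 := (hF' _ (hseg t ht)).comp_hasDerivAt t (hderiv t)
      refine ((h1.sub h2).congr_deriv ?_).hasDerivWithinAt
      simp only [ContinuousLinearMap.flip_apply]
      rw [← map_sub]) (by simp [heq]) le_rfl le_rfl
    (by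
      intro t ht
      rw [add_zero]
      refine (ContinuousLinearMap.le_opNorm _ _).trans ?_
      gcongr
      refine (ContinuousLinearMap.le_opNorm _ _).trans ?_
      refine le_trans ?_ har
      have h0 : 0 ≤ a := (norm_nonneg _).trans (ha x hx)
      exact mul_le_mul (ha _ (hseg t ht)) hdist (norm_nonneg _) h0) 1 (by simp)
  simpa [sub_eq_zero] using h

theorem taylor_one_bound {W : Type*} [NormedAddCommGroup W] [NormedSpace ℝ W]
    {A : E → W} {A' : E → E →L[ℝ] W} {D : Set E} (hD : Convex ℝ D) {L : ℝ} (hL0 : 0 ≤ L)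
    (hA : ∀ x ∈ D, HasFDerivAt A (A' x) x)
    (hL : ∀ x ∈ D, ∀ y ∈ D, ‖A' y - A' x‖ ≤ L * ‖y - x‖) {x y : E} (hx : x ∈ D) (hy : y ∈ D) :
    ‖A y - A x - A' x (y - x)‖ ≤ L * ‖y - x‖ * ‖y - x‖ := by
  refine (convex_segment x y).norm_image_sub_le_of_norm_hasFDerivWithin_le' (f := A) (f' := A')
    (φ := A' x) (fun z hz => (hA z (hD.segment_subset hx hy hz)).hasFDerivWithinAt) ?_
    (left_mem_segment ℝ x y) (right_mem_segment ℝ x y)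
  intro z hz
  refine (hL x hx z (hD.segment_subset hx hy hz)).trans ?_
  gcongr
  obtain ⟨t, ht, rfl⟩ := (segment_eq_image' ℝ x y ▸ hz)
  simp only [add_sub_cancel_left, norm_smul, Real.norm_eq_abs, abs_of_nonneg ht.1]
  exact mul_le_of_le_one_left (norm_nonneg _) ht.2

/-- A flat linear system `dF = A F` has, on a small ball, a solution with any prescribed value
at any point. -/
theorem flat_system_exists_of_bounds [CompleteSpace V] {A : E → E →L[ℝ] V →L[ℝ] V}
    {A' : E → E →L[ℝ] E →L[ℝ] V →L[ℝ] V} {c : E} {r a b L : ℝ}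
    (ha : ∀ x ∈ Metric.ball c r, ‖A x‖ ≤ a) (har : a * (2 * r) ≤ 1 / 2)
    (hA : ∀ x ∈ Metric.ball c r, HasFDerivAt A (A' x) x)
    (hb : ∀ x ∈ Metric.ball c r, ‖A' x‖ ≤ b)
    (hL : ∀ x ∈ Metric.ball c r, ∀ y ∈ Metric.ball c r, ‖A' y - A' x‖ ≤ L * ‖y - x‖)
    (hflat : ∀ x ∈ Metric.ball c r, ∀ u h v,
      A' x h u v + A x u (A x h v) = A' x u h v + A x h (A x u v))
    (hL0 : 0 ≤ L) {x₁ : E} (hx₁ : x₁ ∈ Metric.ball c r) (v : V) :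
    ∃ F : E → V, F x₁ = v ∧ ∀ x ∈ Metric.ball c r, HasFDerivAt F ((A x).flip (F x)) x := by
  set D := Metric.ball c r with hDdef
  have hD : Convex ℝ D := convex_ball c r
  have ha0 : 0 ≤ a := (norm_nonneg _).trans (ha x₁ hx₁)
  have hb0 : 0 ≤ b := (norm_nonneg _).trans (hb x₁ hx₁)
  have hr0 : 0 < r := Metric.pos_of_mem_ball hx₁
  have hseg : ∀ x ∈ D, ∀ t ∈ Icc (0 : ℝ) 1, x₁ + t • (x - x₁) ∈ D := fun x hx t ht =>
    hD.add_smul_sub_mem hx₁ hx ht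
  have hdist : ∀ x ∈ D, ‖x - x₁‖ ≤ 2 * r := by
    intro x hx
    rw [← dist_eq_norm]
    have := dist_triangle_right x x₁ c
    rw [hDdef, Metric.mem_ball] at hx hx₁
    linarith
  have hline : ∀ (x : E) (t : ℝ), HasDerivAt (fun t : ℝ => x₁ + t • (x - x₁)) (x - x₁) t := by
    intro x t
    simpa using ((hasDerivAt_id t).smul_const (x - x₁)).const_add x₁
  have hsmall : ∀ x ∈ D, ∀ y ∈ D, ‖A y (x - x₁)‖ ≤ 1 / 2 := fun x hx y hy =>
    ((A y).le_opNorm _).trans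
      ((mul_le_mul (ha y hy) (hdist x hx) (norm_nonneg _) ha0).trans har)
  -- Parallel transport of `v` along the segment from `x₁` to `x`; the solution sought is its value
  -- at time 1.
  have hex : ∀ x ∈ D, ∃ α : ℝ → V, α 0 = v ∧ ∀ t ∈ Icc (0 : ℝ) 1,
      HasDerivWithinAt α (A (x₁ + t • (x - x₁)) (x - x₁) (α t)) (Icc 0 1) t := by
    intro x hx
    refine exists_linear_ode_solution (B := fun t => A (x₁ + t • (x - x₁)) (x - x₁)) ?_
      (fun t ht => hsmall x hx _ (hseg x hx t ht)) v
    intro t ht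
    have h1 := ((hA _ (hseg x hx t ht)).comp_hasDerivAt t (hline x t)).continuousAt
    exact (h1.clm_apply continuousAt_const).continuousWithinAt
  choose! φ hφ0 hφ using hex
  have hφb : ∀ x ∈ D, ∀ t ∈ Icc (0 : ℝ) 1, ‖φ x t‖ ≤ 2 * ‖v‖ := by
    intro x hx t ht
    have := gronwall_unit (δ := ‖v‖) (ε := 0) (hφ x hx) (by rw [hφ0 x hx]) (norm_nonneg _) le_rfl
      (by
        intro t ht
        rw [add_zero]
        refine (ContinuousLinearMap.le_opNorm _ _).trans ?_
        gcongr
        exact hsmall x hx _ (hseg x hx t ht)) t ht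
    linarith
  refine ⟨fun x => φ x 1, ?_, ?_⟩
  · have h1 : ∀ t ∈ Icc (0 : ℝ) 1, HasDerivWithinAt (fun t => φ x₁ t - v) 0 (Icc 0 1) t := by
      intro t ht
      simpa using (hφ x₁ hx₁ t ht).sub_const v
    have := gronwall_unit (δ := 0) (ε := 0) h1 (by simp [hφ0 x₁ hx₁]) le_rfl le_rfl
      (by intro t _; simp) 1 (by simp)
    simpa [sub_eq_zero] using this
  intro x hx
  set K : ℝ := (L * (2 * r) + b + (b * (2 * r) + a) * a) * (2 * ‖v‖) with hK
  -- A remainder quadratic in `y - x` shows that the radial transport satisfies the system in every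
  -- direction, not only the radial one.
  have key : ∀ y ∈ D, ‖φ y 1 - φ x 1 - A x (y - x) (φ x 1)‖ ≤ 2 * K * ‖y - x‖ ^ 2 := by
    intro y hy
    set h := y - x with hh
    have hyx : ∀ t : ℝ, x₁ + t • (y - x₁) - (x₁ + t • (x - x₁)) = t • h := by
      intro t; rw [hh]; module
    -- At time `t` the two segments are `t • h` apart, which explains the predicted increment `t • A
    -- X h (φ x t)`. The remainder vanishes at time 0.
    have hR := gronwall_unit (δ := 0) (ε := K * ‖h‖ ^ 2)
      (f := fun t => φ y t - φ x t - t • A (x₁ + t • (x - x₁)) h (φ x t))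
      (f' := fun t => A (x₁ + t • (y - x₁)) (y - x₁) (φ y t)
        - A (x₁ + t • (x - x₁)) (x - x₁) (φ x t)
        - (t • (A' (x₁ + t • (x - x₁)) (x - x₁) h (φ x t)
            + A (x₁ + t • (x - x₁)) h (A (x₁ + t • (x - x₁)) (x - x₁) (φ x t)))
          + (1 : ℝ) • A (x₁ + t • (x - x₁)) h (φ x t)))
      (by
        intro t ht
        refine ((hφ y hy t ht).sub (hφ x hx t ht)).sub ?_
        have h1 : HasDerivWithinAt (fun t => A (x₁ + t • (x - x₁)) h)
            (A' (x₁ + t • (x - x₁)) (x - x₁) h) (Icc 0 1) t := by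
          have h2 := ((hA _ (hseg x hx t ht)).comp_hasDerivAt t (hline x t)).hasDerivWithinAt
            (s := Icc 0 1)
          simpa using h2.clm_apply (hasDerivWithinAt_const t (Icc 0 1) h)
        exact (hasDerivWithinAt_id t (Icc 0 1)).smul (h1.clm_apply (hφ x hx t ht)))
      (by simp [hφ0 x hx, hφ0 y hy]) le_rfl (by positivity)
      (by
        intro t ht
        set X := x₁ + t • (x - x₁) with hX
        set Y := x₁ + t • (y - x₁) with hY
        have hXD : X ∈ D := hseg x hx t ht
        have hYD : Y ∈ D := hseg y hy t ht
        have hYX : Y - X = t • h := hyx t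
        have ht1 : ‖t‖ ≤ 1 := by rw [Real.norm_eq_abs, abs_of_nonneg ht.1]; exact ht.2
        have hYXn : ‖Y - X‖ ≤ ‖h‖ := by
          rw [hYX, norm_smul]
          exact mul_le_of_le_one_left (norm_nonneg _) ht1
        -- Flatness exchanges the radial direction and `h` in the derivative of the prediction. The
        -- terms of first order in `h` then cancel, leaving the linear equation for the remainder
        -- and terms of order `‖h‖²`.
        have e1 : A Y (y - x₁) (φ y t) - A X (x - x₁) (φ x t)
            - (t • (A' X (x - x₁) h (φ x t) + A X h (A X (x - x₁) (φ x t)))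
              + (1 : ℝ) • A X h (φ x t))
            = A Y (y - x₁) (φ y t - φ x t - t • A X h (φ x t))
              + ((A Y - A X - A' X (Y - X)) (y - x₁) (φ x t) + t • A' X h h (φ x t)
                + t • ((A Y - A X) (y - x₁) + A X h) (A X h (φ x t))) := by
          have hf := hflat X hXD h (x - x₁) (φ x t)
          rw [hf, hYX]
          have e2 : y - x₁ = (x - x₁) + h := by rw [hh]; abel
          rw [e2]
          simp only [map_add, map_sub, map_smul, add_apply,
            sub_apply, smul_apply]
          module
        rw [e1]
        refine (norm_add_le _ _).trans (add_le_add ?_ ?_)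
        · refine (ContinuousLinearMap.le_opNorm _ _).trans ?_
          gcongr
          exact hsmall y hy Y hYD
        · have hp := hφb x hx t ht
          have hT := taylor_one_bound hD hL0 hA hL hXD hYD
          have hAYX : ‖A Y - A X‖ ≤ b * ‖h‖ := by
            refine (hD.norm_image_sub_le_of_norm_hasFDerivWithin_le
              (fun z hz => (hA z hz).hasFDerivWithinAt) hb hXD hYD).trans ?_
            gcongr
          have n1 : ‖(A Y - A X - A' X (Y - X)) (y - x₁) (φ x t)‖
              ≤ L * ‖h‖ * ‖h‖ * (2 * r) * (2 * ‖v‖) := by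
            refine (ContinuousLinearMap.le_opNorm _ _).trans ?_
            refine mul_le_mul ((ContinuousLinearMap.le_opNorm _ _).trans ?_) hp (norm_nonneg _)
              (by positivity)
            refine mul_le_mul (hT.trans ?_) (hdist y hy) (norm_nonneg _) (by positivity)
            gcongr
          have n2 : ‖t • A' X h h (φ x t)‖ ≤ b * ‖h‖ * ‖h‖ * (2 * ‖v‖) := by
            rw [norm_smul]
            refine (mul_le_of_le_one_left (norm_nonneg _) ht1).trans ?_
            refine (ContinuousLinearMap.le_opNorm _ _).trans ?_
            refine mul_le_mul ((ContinuousLinearMap.le_opNorm₂ _ _ _).trans ?_) hp (norm_nonneg _)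
              (by positivity)
            gcongr
            exact hb X hXD
          have n3 : ‖t • ((A Y - A X) (y - x₁) + A X h) (A X h (φ x t))‖
              ≤ (b * ‖h‖ * (2 * r) + a * ‖h‖) * (a * ‖h‖ * (2 * ‖v‖)) := by
            rw [norm_smul]
            refine (mul_le_of_le_one_left (norm_nonneg _) ht1).trans ?_
            refine (ContinuousLinearMap.le_opNorm _ _).trans ?_
            refine mul_le_mul ((norm_add_le _ _).trans (add_le_add ?_ ?_)) ?_ (norm_nonneg _)
              (by positivity)
            · exact (ContinuousLinearMap.le_opNorm _ _).trans
                (mul_le_mul hAYX (hdist y hy) (norm_nonneg _) (by positivity))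
            · exact (ContinuousLinearMap.le_opNorm _ _).trans (by gcongr; exact ha X hXD)
            · refine (ContinuousLinearMap.le_opNorm _ _).trans ?_
              refine mul_le_mul ((ContinuousLinearMap.le_opNorm _ _).trans ?_) hp (norm_nonneg _)
                (by positivity)
              gcongr
              exact ha X hXD
          refine (norm_add_le _ _).trans ?_
          refine (add_le_add (norm_add_le _ _) le_rfl).trans ?_
          refine (add_le_add (add_le_add n1 n2) n3).trans (le_of_eq ?_)
          rw [hK]; ring) 1 (by simp)
    simp only [one_smul, add_sub_cancel] at hR
    linarith
  rw [hasFDerivAt_iff_isLittleO]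
  have hO : (fun y => φ y 1 - φ x 1 - (A x).flip (φ x 1) (y - x)) =O[𝓝 x]
      fun y => ‖y - x‖ ^ 2 := by
    refine Asymptotics.IsBigO.of_bound (2 * K) ?_
    filter_upwards [Metric.isOpen_ball.mem_nhds hx] with y hy
    simpa using key y hy
  refine hO.trans_isLittleO ?_
  have := (Asymptotics.isLittleO_norm_pow_id (E' := E) (n := 2) (by norm_num)).comp_tendsto
    (k := fun y => y - x) (l' := 𝓝 x) (by
      have : Tendsto (fun y => y - x) (𝓝 x) (𝓝 (x - x)) :=
        (continuous_id.sub continuous_const).tendsto x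
      simpa using this)
  simpa [Function.comp_def] using this

/-- **Frobenius theorem for flat linear systems.** Near every point, the flat linear system
`dF = A F` has on small balls a unique solution with any prescribed value at any point. -/
theorem flat_system_exists_unique [CompleteSpace V] {A : E → E →L[ℝ] V →L[ℝ] V}
    {Ω : Set E} (hΩ : IsOpen Ω) (hA : ContDiffOn ℝ 2 A Ω)
    (hflat : ∀ x ∈ Ω, ∀ u h v,
      fderiv ℝ A x h u v + A x u (A x h v) = fderiv ℝ A x u h v + A x h (A x u v))
    {c : E} (hc : c ∈ Ω) :
    ∃ R > 0, Metric.ball c R ⊆ Ω ∧ ∀ r ≤ R,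
      (∀ x₁ ∈ Metric.ball c r, ∀ v : V, ∃ F : E → V, F x₁ = v ∧
        ∀ x ∈ Metric.ball c r, HasFDerivAt F ((A x).flip (F x)) x) ∧
      ∀ F F' : E → V, (∀ x ∈ Metric.ball c r, HasFDerivAt F ((A x).flip (F x)) x) →
        (∀ x ∈ Metric.ball c r, HasFDerivAt F' ((A x).flip (F' x)) x) →
        ∀ x₁ ∈ Metric.ball c r, F x₁ = F' x₁ → ∀ x ∈ Metric.ball c r, F x = F' x := by
  have hAc : ContDiffAt ℝ 2 A c := hA.contDiffAt (hΩ.mem_nhds hc)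
  have hA'c : ContDiffAt ℝ 1 (fderiv ℝ A) c := hAc.fderiv_right (by norm_num)
  obtain ⟨L, t, ht, hL⟩ := hA'c.exists_lipschitzOnWith
  have hba : ∀ᶠ x in 𝓝 c, ‖A x‖ < ‖A c‖ + 1 :=
    hAc.continuousAt.norm.eventually (gt_mem_nhds (lt_add_one _))
  have hbb : ∀ᶠ x in 𝓝 c, ‖fderiv ℝ A x‖ < ‖fderiv ℝ A c‖ + 1 :=
    hA'c.continuousAt.norm.eventually (gt_mem_nhds (lt_add_one _))
  obtain ⟨ρ, hρ, hball⟩ := Metric.eventually_nhds_iff_ball.1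
    ((hba.and hbb).and ((hΩ.eventually_mem hc).and (eventually_mem_set.2 ht)))
  have hA0 := norm_nonneg (A c)
  refine ⟨min ρ (1 / (4 * (‖A c‖ + 1))), by positivity, ?_, ?_⟩
  · exact fun x hx => (hball x (Metric.ball_subset_ball (min_le_left _ _) hx)).2.1
  intro r hr
  have hsub : ∀ x ∈ Metric.ball c r, x ∈ Metric.ball c ρ :=
    fun x hx => Metric.ball_subset_ball (hr.trans (min_le_left _ _)) hx
  have har : (‖A c‖ + 1) * (2 * r) ≤ 1 / 2 := by
    have h1 : r ≤ 1 / (4 * (‖A c‖ + 1)) := hr.trans (min_le_right _ _)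
    rw [le_div_iff₀ (by positivity)] at h1
    linarith
  have ha : ∀ x ∈ Metric.ball c r, ‖A x‖ ≤ ‖A c‖ + 1 := fun x hx => (hball x (hsub x hx)).1.1.le
  refine ⟨fun x₁ hx₁ v => ?_, fun F F' hF hF' x₁ hx₁ heq =>
    linear_system_unique ha har hF hF' hx₁ heq⟩
  refine flat_system_exists_of_bounds (A' := fderiv ℝ A) (b := ‖fderiv ℝ A c‖ + 1) (L := L) ha har
    (fun x hx => ?_) (fun x hx => (hball x (hsub x hx)).1.2.le) (fun x hx y hy => ?_)
    (fun x hx => hflat x (hball x (hsub x hx)).2.1) L.2 hx₁ v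
  · exact ((hA.contDiffAt (hΩ.mem_nhds (hball x (hsub x hx)).2.1)).differentiableAt
      (by norm_num)).hasFDerivAt
  · exact hL.norm_sub_le (hball y (hsub y hy)).2.2 (hball x (hsub x hx)).2.2

end FlatSystem

/-! ### Curvature identities and the flat connection on `ℝ ⊕ TM` -/

noncomputable section

/-- An algebraic curvature tensor with vanishing sectional curvature is zero. -/
theorem algebraic_curvature_eq_zero {E : Type*} [AddCommGroup E] {B : E → E → E → E → ℝ}
    (add₁ : ∀ u u' v w z, B (u + u') v w z = B u v w z + B u' v w z)
    (add₂ : ∀ u v v' w z, B u (v + v') w z = B u v w z + B u v' w z)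
    (add₃ : ∀ u v w w' z, B u v (w + w') z = B u v w z + B u v w' z)
    (add₄ : ∀ u v w z z', B u v w (z + z') = B u v w z + B u v w z')
    (skew : ∀ u v w z, B u v w z = -B v u w z)
    (skew' : ∀ u v w, B u v w w = 0)
    (bianchi : ∀ u v w z, B u v w z + B v w u z + B w u v z = 0)
    (sec : ∀ u v, B u v v u = 0) (u v w z : E) : B u v w z = 0 := by
  have skew₄ : ∀ u v w z, B u v w z = -B u v z w := by
    intro u v w z
    have h := skew' u v (w + z)
    rw [add₃, add₄, add₄, skew', skew'] at h
    linarith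
  -- The usual octahedron argument: combine the four Bianchi identities and cancel by the two skew
  -- symmetries.
  have pair : ∀ u v w z, B u v w z = B w z u v := by
    intro u v w z
    have h1 := bianchi u v w z
    have h2 := bianchi v w z u
    have h3 := bianchi w z u v
    have h4 := bianchi z u v w
    have s := skew₄
    have t := skew
    linarith [s u v w z, s v w u z, s w u v z, s w z u v, s z v w u, t z v w u, s u w z v,
      t u w z v, s v z u w, t v z u w, s z u v w, t z u w v, s v w z u, t w u z v, s z w u v,
      t w z u v, t v z w u, s v z w u, s z v u w, t u z w v, s w u z v]
  have sec' : ∀ u v z, B u v v z = 0 := by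
    intro u v z
    have h := sec (u + z) v
    rw [add₁, add₄, add₄, sec, sec] at h
    have h1 := pair z v v u
    have h2 := skew v u z v
    have h3 := skew₄ u v z v
    linarith
  have alt : ∀ u v w z, B u v w z = -B u w v z := by
    intro u v w z
    have h := sec' u (v + w) z
    rw [add₂, add₃, add₃, sec', sec'] at h
    linarith
  -- `B` is now alternating in its first three arguments, so the three Bianchi terms are equal and
  -- `3 B = 0`.
  have h1 := bianchi u v w z
  linarith [alt u v w z, skew u v w z, skew v w u z, alt v w u z, skew w u v z, alt w u v z,
    alt v u w z]

namespace MetricOnE3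

/-- `G` is a smooth pseudo-Riemannian metric on the open set `Ω`. -/
structure IsMetricOn (G : E3 → E3 →L[ℝ] E3 →L[ℝ] ℝ) (Ω : Set E3) : Prop where
  isOpen : IsOpen Ω
  contDiffOn : ContDiffOn ℝ ∞ G Ω
  symm : ∀ x ∈ Ω, ∀ u v, G x u v = G x v u
  isInvertible : ∀ x ∈ Ω, (G x).IsInvertible

section

variable {G : E3 → E3 →L[ℝ] E3 →L[ℝ] ℝ} {Ω : Set E3} {x : E3}

theorem IsMetricOn.contDiffAt (hG : IsMetricOn G Ω) (hx : x ∈ Ω) : ContDiffAt ℝ ∞ G x :=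
  hG.contDiffOn.contDiffAt (hG.isOpen.mem_nhds hx)

theorem IsMetricOn.hasFDerivAt (hG : IsMetricOn G Ω) (hx : x ∈ Ω) :
    HasFDerivAt G (fderiv ℝ G x) x :=
  ((hG.contDiffAt hx).differentiableAt (by simp)).hasFDerivAt

theorem IsMetricOn.eventually_mem (hG : IsMetricOn G Ω) (hx : x ∈ Ω) : ∀ᶠ y in 𝓝 x, y ∈ Ω :=
  hG.isOpen.mem_nhds hx

theorem IsMetricOn.fderiv_apply (hG : IsMetricOn G Ω) (hx : x ∈ Ω) (u v w : E3) :
    fderiv ℝ (fun y => G y v w) x u = fderiv ℝ G x u v w := by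
  have h := ((hG.hasFDerivAt hx).clm_apply (hasFDerivAt_const v x)).clm_apply
    (hasFDerivAt_const w x)
  rw [h.fderiv]
  simp

theorem IsMetricOn.fderiv_symm (hG : IsMetricOn G Ω) (hx : x ∈ Ω) (u v w : E3) :
    fderiv ℝ G x u v w = fderiv ℝ G x u w v := by
  rw [← hG.fderiv_apply hx, ← hG.fderiv_apply hx]
  congr 1
  refine Filter.EventuallyEq.fderiv_eq ?_
  filter_upwards [hG.eventually_mem hx] with y hy using hG.symm y hy v w

theorem IsMetricOn.nondegenerate (hG : IsMetricOn G Ω) (hx : x ∈ Ω) {u v : E3}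
    (h : ∀ w, G x u w = G x v w) : u = v := by
  obtain ⟨e, he⟩ := hG.isInvertible x hx
  apply e.injective
  ext w
  simpa [← he] using h w

theorem christoffelFirst_apply (G : E3 → E3 →L[ℝ] E3 →L[ℝ] ℝ) (x u v w : E3) :
    christoffelFirst G x u v w
      = (fderiv ℝ G x u v w + fderiv ℝ G x v u w - fderiv ℝ G x w u v) / 2 := by
  simp [christoffelFirst]
  ring

theorem IsMetricOn.christoffel_apply (hG : IsMetricOn G Ω) (hx : x ∈ Ω) (u v w : E3) :
    G x (christoffel G x u v) w = christoffelFirst G x u v w := by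
  have h := (hG.isInvertible x hx).inverse_apply_eq.1
    (rfl : (G x).inverse (christoffelFirst G x u v) = christoffel G x u v)
  exact congrArg (fun φ : E3 →L[ℝ] ℝ => φ w) h.symm

theorem IsMetricOn.christoffel_symm (hG : IsMetricOn G Ω) (hx : x ∈ Ω) (u v : E3) :
    christoffel G x u v = christoffel G x v u := by
  refine hG.nondegenerate hx fun w => ?_
  rw [hG.christoffel_apply hx, hG.christoffel_apply hx, christoffelFirst_apply,
    christoffelFirst_apply, hG.fderiv_symm hx w u v]
  ring

/-- The Levi-Civita connection is compatible with the metric. -/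
theorem IsMetricOn.compat (hG : IsMetricOn G Ω) (hx : x ∈ Ω) (u v w : E3) :
    fderiv ℝ G x u v w = G x (christoffel G x u v) w + G x v (christoffel G x u w) := by
  rw [hG.symm x hx v, hG.christoffel_apply hx, hG.christoffel_apply hx, christoffelFirst_apply,
    christoffelFirst_apply, hG.fderiv_symm hx u w v, hG.fderiv_symm hx v u w,
    hG.fderiv_symm hx w u v]
  ring

theorem christoffel_add_left (x u u' v : E3) :
    christoffel G x (u + u') v = christoffel G x u v + christoffel G x u' v := by
  simp only [christoffel, ← map_add]
  congr 1
  ext w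
  simp only [christoffelFirst_apply, map_add, add_apply]
  ring

theorem christoffel_add_right (x u v v' : E3) :
    christoffel G x u (v + v') = christoffel G x u v + christoffel G x u v' := by
  simp only [christoffel, ← map_add]
  congr 1
  ext w
  simp only [christoffelFirst_apply, map_add, add_apply]
  ring

theorem christoffel_smul_left (x : E3) (c : ℝ) (u v : E3) :
    christoffel G x (c • u) v = c • christoffel G x u v := by
  simp only [christoffel, ← map_smul]
  congr 1
  ext w
  simp only [christoffelFirst_apply, map_smul, smul_apply, smul_eq_mul]
  ring

theorem christoffel_smul_right (x : E3) (c : ℝ) (u v : E3) :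
    christoffel G x u (c • v) = c • christoffel G x u v := by
  simp only [christoffel, ← map_smul]
  congr 1
  ext w
  simp only [christoffelFirst_apply, map_smul, smul_apply, smul_eq_mul]
  ring

theorem IsMetricOn.contDiffOn_christoffel (hG : IsMetricOn G Ω) (u v : E3) :
    ContDiffOn ℝ ∞ (fun y => christoffel G y u v) Ω := by
  have hD : ContDiffOn ℝ ∞ (fderiv ℝ G) Ω :=
    hG.contDiffOn.fderiv_of_isOpen hG.isOpen (by simp)
  have hinv : ContDiffOn ℝ ∞ (fun y => (G y).inverse) Ω := by
    intro x hx
    obtain ⟨e, he⟩ := hG.isInvertible x hx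
    have h := contDiffAt_map_inverse (n := ∞) e
    rw [he] at h
    exact (h.comp x (hG.contDiffAt hx)).contDiffWithinAt
  refine hinv.clm_apply (contDiffOn_clm_apply.2 fun w => ?_)
  simp only [christoffelFirst_apply]
  have hD' : ∀ a b c : E3, ContDiffOn ℝ ∞ (fun y => fderiv ℝ G y a b c) Ω := fun a b c =>
    ((hD.clm_apply contDiffOn_const).clm_apply contDiffOn_const).clm_apply contDiffOn_const
  exact (((hD' _ _ _).add (hD' _ _ _)).sub (hD' _ _ _)).div_const 2

theorem IsMetricOn.hasFDerivAt_christoffel (hG : IsMetricOn G Ω) (hx : x ∈ Ω) (u v : E3) :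
    HasFDerivAt (fun y => christoffel G y u v) (fderiv ℝ (fun y => christoffel G y u v) x) x :=
  (((hG.contDiffOn_christoffel u v).contDiffAt (hG.isOpen.mem_nhds hx)).differentiableAt
    (by simp)).hasFDerivAt

theorem IsMetricOn.fderiv_christoffel_symm (hG : IsMetricOn G Ω) (hx : x ∈ Ω) (u v : E3) :
    fderiv ℝ (fun y => christoffel G y u v) x = fderiv ℝ (fun y => christoffel G y v u) x := by
  refine Filter.EventuallyEq.fderiv_eq ?_
  filter_upwards [hG.eventually_mem hx] with y hy using hG.christoffel_symm hy u v

theorem IsMetricOn.fderiv_christoffel_add (hG : IsMetricOn G Ω) (hx : x ∈ Ω) (u v v' : E3) :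
    fderiv ℝ (fun y => christoffel G y u (v + v')) x
      = fderiv ℝ (fun y => christoffel G y u v) x + fderiv ℝ (fun y => christoffel G y u v') x := by
  simp only [christoffel_add_right]
  exact ((hG.hasFDerivAt_christoffel hx u v).add (hG.hasFDerivAt_christoffel hx u v')).fderiv

theorem IsMetricOn.riemann_add₃ (hG : IsMetricOn G Ω) (hx : x ∈ Ω) (u v w w' : E3) :
    riemann G x u v (w + w') = riemann G x u v w + riemann G x u v w' := by
  simp only [riemann]
  rw [hG.fderiv_christoffel_add hx, hG.fderiv_christoffel_add hx]
  simp only [christoffel_add_right, add_apply]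
  abel

theorem IsMetricOn.riemann_add₁ (hG : IsMetricOn G Ω) (hx : x ∈ Ω) (u u' v w : E3) :
    riemann G x (u + u') v w = riemann G x u v w + riemann G x u' v w := by
  have h : fderiv ℝ (fun y => christoffel G y (u + u') w) x
      = fderiv ℝ (fun y => christoffel G y u w) x + fderiv ℝ (fun y => christoffel G y u' w) x := by
    rw [hG.fderiv_christoffel_symm hx, hG.fderiv_christoffel_add hx,
      hG.fderiv_christoffel_symm hx w u, hG.fderiv_christoffel_symm hx w u']
  simp only [riemann]
  rw [h]
  simp only [christoffel_add_left, christoffel_add_right, add_apply, map_add]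
  abel

theorem riemann_skew (x u v w : E3) : riemann G x u v w = -riemann G x v u w := by
  simp only [riemann]
  abel

theorem IsMetricOn.riemann_bianchi (hG : IsMetricOn G Ω) (hx : x ∈ Ω) (u v w : E3) :
    riemann G x u v w + riemann G x v w u + riemann G x w u v = 0 := by
  simp only [riemann]
  rw [hG.fderiv_christoffel_symm hx v w, hG.fderiv_christoffel_symm hx w u,
    hG.fderiv_christoffel_symm hx v u, hG.christoffel_symm hx v w, hG.christoffel_symm hx w u,
    hG.christoffel_symm hx v u]
  abel

/-- The second derivatives of the function `G z w w` in the directions `u` and `v` commute. By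
metric compatibility, their difference in the two orders is `2 G(R(u,v)w, w)`. -/
theorem IsMetricOn.riemann_self (hG : IsMetricOn G Ω) (hx : x ∈ Ω) (u v w : E3) :
    G x (riemann G x u v w) w = 0 := by
  have key : ∀ a b : E3, fderiv ℝ (fun y => fderiv ℝ (fun z => G z w w) y b) x a
      = 2 * (G x (christoffel G x a (christoffel G x b w)) w
        + G x (christoffel G x b w) (christoffel G x a w)
        + G x (fderiv ℝ (fun y => christoffel G y b w) x a) w) := by
    intro a b
    have h1 : (fun y => fderiv ℝ (fun z => G z w w) y b) =ᶠ[𝓝 x]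
        fun y => 2 * G y (christoffel G y b w) w := by
      filter_upwards [hG.eventually_mem hx] with y hy
      rw [hG.fderiv_apply hy, hG.compat hy, hG.symm y hy w]
      ring
    rw [h1.fderiv_eq]
    have h2 := (((hG.hasFDerivAt hx).clm_apply (hG.hasFDerivAt_christoffel hx b w)).clm_apply
      (hasFDerivAt_const w x)).const_mul 2
    rw [h2.fderiv]
    simp only [smul_apply, add_apply, ContinuousLinearMap.comp_apply,
      ContinuousLinearMap.flip_apply, zero_apply, map_zero, smul_eq_mul, zero_add]
    rw [hG.compat hx]
    ring
  have hsymm : IsSymmSndFDerivAt ℝ (fun z => G z w w) x := by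
    refine ContDiffAt.isSymmSndFDerivAt (n := 2) ?_ (by simp)
    exact (((hG.contDiffAt hx).clm_apply contDiffAt_const).clm_apply contDiffAt_const).of_le
      ENat.LEInfty.out
  have hdd : DifferentiableAt ℝ (fderiv ℝ fun z => G z w w) x := by
    have h : ContDiffAt ℝ ∞ (fun z => G z w w) x :=
      ((hG.contDiffAt hx).clm_apply contDiffAt_const).clm_apply contDiffAt_const
    exact (h.fderiv_right (m := 1) (by norm_num; exact ENat.LEInfty.out)).differentiableAt (by simp)
  have h2 : ∀ a b : E3, fderiv ℝ (fun y => fderiv ℝ (fun z => G z w w) y b) x a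
      = fderiv ℝ (fderiv ℝ fun z => G z w w) x a b := by
    intro a b
    rw [(hdd.hasFDerivAt.clm_apply (hasFDerivAt_const b x)).fderiv]
    simp
  have h3 := hsymm.eq u v
  rw [← h2, ← h2, key, key, hG.symm x hx (christoffel G x u w)] at h3
  simp only [riemann, map_sub, map_add, sub_apply, add_apply]
  linarith

/-- A metric of constant sectional curvature `-1` has
`R(u,v)w = g(u,w) v - g(v,w) u`. -/
theorem IsMetricOn.riemann_eq (hG : IsMetricOn G Ω) (hx : x ∈ Ω)
    (hK : ∀ u v, G x (riemann G x u v v) u = -1 * (G x u u * G x v v - G x u v ^ 2))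
    (u v w : E3) : riemann G x u v w = G x u w • v - G x v w • u := by
  refine hG.nondegenerate hx fun z => ?_
  -- The difference between the curvature and its constant curvature model is an algebraic curvature
  -- tensor with zero sectional curvature.
  have h := algebraic_curvature_eq_zero
    (B := fun u v w z => G x (riemann G x u v w) z + (G x v w * G x u z - G x u w * G x v z))
    (fun u u' v w z => by
      simp only [hG.riemann_add₁ hx, map_add, add_apply]; ring)
    (fun u v v' w z => by
      simp only [riemann_skew x u, hG.riemann_add₁ hx, map_add, map_neg, neg_apply, add_apply]
      ring)
    (fun u v w w' z => by
      simp only [hG.riemann_add₃ hx, map_add, add_apply]; ring)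
    (fun u v w z z' => by
      simp only [map_add]; ring)
    (fun u v w z => by
      simp only [riemann_skew x u v, map_neg, neg_apply]; ring)
    (fun u v w => by
      simp only [hG.riemann_self hx]; ring)
    (fun u v w z => by
      have hb := congrArg (fun X => G x X z) (hG.riemann_bianchi hx u v w)
      simp only [map_add, add_apply, map_zero, zero_apply] at hb
      linear_combination hb + G x u z * hG.symm x hx v w + G x v z * hG.symm x hx w u
        + G x w z * hG.symm x hx u v)
    (fun u v => by
      simp only [hK u v, hG.symm x hx v u]; ring) u v w z
  simp only [map_sub, map_smul, sub_apply, smul_apply, smul_eq_mul]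
  linarith

/-- The connection form of the flat connection on `ℝ ⊕ TM` attached to a metric of curvature `-1`:
parallel sections are the pairs `(f, Z)` with `df = g(Z,·)` and `∇_u Z = f u`. -/
def tractorForm (G : E3 → E3 →L[ℝ] E3 →L[ℝ] ℝ) (x : E3) : E3 →L[ℝ] (ℝ × E3) →L[ℝ] (ℝ × E3) :=
  (LinearMap.mk₂ ℝ (fun (u : E3) (F : ℝ × E3) => (G x F.2 u, F.1 • u - christoffel G x u F.2))
    (fun u u' F => by
      ext1
      · simp
      · simp only [christoffel_add_left, smul_add, Prod.snd_add]; abel)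
    (fun c u F => by
      ext1
      · simp
      · simp only [christoffel_smul_left, smul_sub, Prod.smul_snd, smul_comm c])
    (fun u F F' => by
      ext1
      · simp
      · simp only [christoffel_add_right, Prod.snd_add, Prod.fst_add, add_smul]; abel)
    (fun c u F => by
      ext1
      · simp
      · simp only [christoffel_smul_right, Prod.smul_snd, Prod.smul_fst, smul_sub, smul_assoc])
    ).toContinuousBilinearMap

theorem tractorForm_apply (x u : E3) (F : ℝ × E3) :
    tractorForm G x u F = (G x F.2 u, F.1 • u - christoffel G x u F.2) := rfl

theorem IsMetricOn.contDiffOn_tractorForm (hG : IsMetricOn G Ω) :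
    ContDiffOn ℝ ∞ (tractorForm G) Ω := by
  refine contDiffOn_clm_apply.2 fun u => contDiffOn_clm_apply.2 fun F => ?_
  simp only [tractorForm_apply]
  exact ((hG.contDiffOn.clm_apply contDiffOn_const).clm_apply contDiffOn_const).prodMk
    (contDiffOn_const.sub (hG.contDiffOn_christoffel _ _))

/-- The scalar component is flat because the connection is metric and torsion-free. The vector
component requires `R(u,v)Z = g(u,Z) v - g(v,Z) u`, which is exactly curvature `-1`. -/
theorem IsMetricOn.tractorForm_flat (hG : IsMetricOn G Ω) (hx : x ∈ Ω)
    (hK : ∀ u v, G x (riemann G x u v v) u = -1 * (G x u u * G x v v - G x u v ^ 2))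
    (u h : E3) (F : ℝ × E3) :
    fderiv ℝ (tractorForm G) x h u F + tractorForm G x u (tractorForm G x h F)
      = fderiv ℝ (tractorForm G) x u h F + tractorForm G x h (tractorForm G x u F) := by
  have hd : ∀ a b : E3, fderiv ℝ (tractorForm G) x a b F
      = (fderiv ℝ G x a F.2 b, -fderiv ℝ (fun y => christoffel G y b F.2) x a) := by
    intro a b
    have h1 : HasFDerivAt (tractorForm G) (fderiv ℝ (tractorForm G) x) x :=
      ((hG.contDiffOn_tractorForm.contDiffAt (hG.isOpen.mem_nhds hx)).differentiableAt
        (by simp)).hasFDerivAt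
    have h2 := (h1.clm_apply (hasFDerivAt_const b x)).clm_apply (hasFDerivAt_const F x)
    have h3 : HasFDerivAt (fun y => tractorForm G y b F) _ x :=
      (((hG.hasFDerivAt hx).clm_apply (hasFDerivAt_const F.2 x)).clm_apply
        (hasFDerivAt_const b x)).prodMk
        ((hG.hasFDerivAt_christoffel hx b F.2).const_sub (F.1 • b))
    have h4 := congrArg (fun L => L a) (h2.unique h3)
    simpa using h4
  rw [hd, hd]
  ext1
  · simp only [tractorForm_apply, Prod.fst_add, map_sub, map_smul, sub_apply, smul_apply]
    rw [hG.compat hx h, hG.compat hx u, hG.christoffel_symm hx h u, hG.symm x hx h u]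
    ring
  · simp only [tractorForm_apply, Prod.snd_add]
    have hR := hG.riemann_eq hx hK h u F.2
    simp only [riemann] at hR
    have e : ∀ a b : E3, christoffel G x a (F.1 • b - christoffel G x b F.2)
        = F.1 • christoffel G x a b - christoffel G x a (christoffel G x b F.2) := by
      intro a b
      have h5 := christoffel_add_right (G := G) x a (F.1 • b - christoffel G x b F.2)
        (christoffel G x b F.2)
      rw [sub_add_cancel, christoffel_smul_right] at h5
      rw [h5]; abel
    rw [e, e, hG.christoffel_symm hx u h, hG.symm x hx F.2 h, hG.symm x hx F.2 u]
    linear_combination (norm := module) (-1 : ℝ) • hR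

/-- A parallel pair `(f, Z)` has constant norm `g(Z,Z) - f²`. -/
theorem IsMetricOn.hasFDerivAt_tractorNorm (hG : IsMetricOn G Ω) (hx : x ∈ Ω) {F : E3 → ℝ × E3}
    (hF : HasFDerivAt F ((tractorForm G x).flip (F x)) x) :
    HasFDerivAt (fun y => G y (F y).2 (F y).2 - (F y).1 ^ 2) (0 : E3 →L[ℝ] ℝ) x := by
  have h1 : HasFDerivAt (fun y => (F y).1) _ x := hF.fst
  have h2 : HasFDerivAt (fun y => (F y).2) _ x := hF.snd
  have h3 := (((hG.hasFDerivAt hx).clm_apply h2).clm_apply h2).sub (h1.pow 2)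
  refine h3.congr_fderiv ?_
  ext u
  simp only [sub_apply, add_apply, ContinuousLinearMap.comp_apply, ContinuousLinearMap.flip_apply,
    smul_apply, ContinuousLinearMap.coe_fst', ContinuousLinearMap.coe_snd', tractorForm_apply,
    map_sub, map_smul, smul_eq_mul, zero_apply]
  -- The Christoffel terms cancel by compatibility; what remains is `2 f g(Z,u) - 2 f df(u)`, and
  -- `df = g(Z,·)`.
  rw [hG.compat hx, hG.symm x hx (christoffel G x u (F x).2), hG.symm x hx u]
  simp
  ring

end

end MetricOnE3

end

/-! ### Change of coordinates and the metric in charts -/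

noncomputable section

namespace MetricOnE3

variable {G G' : E3 → E3 →L[ℝ] E3 →L[ℝ] ℝ} {Ω Ω' : Set E3} {x y : E3} {χ ψ : E3 → E3}

/-- The transformation law of the Christoffel symbols under a local isometry `χ`. -/
theorem IsMetricOn.christoffel_transform (hG : IsMetricOn G Ω) (hG' : IsMetricOn G' Ω')
    (hx : x ∈ Ω) (hx' : χ x ∈ Ω') (hχ : ContDiffAt ℝ ∞ χ x)
    (hpull : ∀ᶠ y in 𝓝 x, ∀ u v, G y u v = G' (χ y) (fderiv ℝ χ y u) (fderiv ℝ χ y v))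
    (hsurj : Function.Surjective (fderiv ℝ χ x)) (u v : E3) :
    fderiv ℝ χ x (christoffel G x u v)
      = fderiv ℝ (fderiv ℝ χ) x u v
        + christoffel G' (χ x) (fderiv ℝ χ x u) (fderiv ℝ χ x v) := by
  have hχ1 : HasFDerivAt χ (fderiv ℝ χ x) x := (hχ.differentiableAt (by simp)).hasFDerivAt
  have hχ2 : HasFDerivAt (fderiv ℝ χ) (fderiv ℝ (fderiv ℝ χ) x) x :=
    ((hχ.fderiv_right (m := 1) (by norm_num; exact ENat.LEInfty.out)).differentiableAt
      (by simp)).hasFDerivAt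
  have hsymm : ∀ a b, fderiv ℝ (fderiv ℝ χ) x a b = fderiv ℝ (fderiv ℝ χ) x b a := by
    intro a b
    exact ((hχ.of_le (m := 2) ENat.LEInfty.out).isSymmSndFDerivAt (by simp)).eq a b
  have hD : ∀ a b c, fderiv ℝ G x a b c
      = fderiv ℝ G' (χ x) (fderiv ℝ χ x a) (fderiv ℝ χ x b) (fderiv ℝ χ x c)
        + G' (χ x) (fderiv ℝ (fderiv ℝ χ) x a b) (fderiv ℝ χ x c)
        + G' (χ x) (fderiv ℝ χ x b) (fderiv ℝ (fderiv ℝ χ) x a c) := by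
    intro a b c
    rw [← hG.fderiv_apply hx]
    have h1 : (fun y => G y b c) =ᶠ[𝓝 x]
        fun y => G' (χ y) (fderiv ℝ χ y b) (fderiv ℝ χ y c) := by
      filter_upwards [hpull] with y hy using hy b c
    rw [h1.fderiv_eq]
    have h2 := (((hG'.hasFDerivAt hx').comp x hχ1).clm_apply
      (hχ2.clm_apply (hasFDerivAt_const b x))).clm_apply (hχ2.clm_apply (hasFDerivAt_const c x))
    rw [HasFDerivAt.fderiv (f := fun y => G' (χ y) (fderiv ℝ χ y b) (fderiv ℝ χ y c)) h2]
    simp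
    ring
  have hx0 := hpull.self_of_nhds
  -- Test against `w' = Dχ w`. In the Koszul combination of the three expressions `hD`, the second
  -- derivatives of `χ` cancel in pairs by symmetry, except the one paired with `Dχ w`.
  refine hG'.nondegenerate hx' fun w' => ?_
  obtain ⟨w, rfl⟩ := hsurj w'
  rw [← hx0, hG.christoffel_apply hx, christoffelFirst_apply, map_add, add_apply,
    hG'.christoffel_apply hx', christoffelFirst_apply, hD, hD, hD, hsymm v u, hsymm w u,
    hsymm w v, hG'.symm _ hx' (fderiv ℝ (fderiv ℝ χ) x u w)]
  ring

/-- Parallel pairs `(f, Z)` are transported by local isometries. -/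
theorem IsMetricOn.tractor_transform (hG : IsMetricOn G Ω) (hG' : IsMetricOn G' Ω')
    (hx : ψ y ∈ Ω) (hy : y ∈ Ω') (hχψ : χ (ψ y) = y) (hχ : ContDiffAt ℝ ∞ χ (ψ y))
    (hψ : DifferentiableAt ℝ ψ y)
    (hpull : ∀ᶠ z in 𝓝 (ψ y), ∀ u v, G z u v = G' (χ z) (fderiv ℝ χ z u) (fderiv ℝ χ z v))
    (hinv : ∀ u, fderiv ℝ χ (ψ y) (fderiv ℝ ψ y u) = u) {F : E3 → ℝ × E3}
    (hF : HasFDerivAt F ((tractorForm G (ψ y)).flip (F (ψ y))) (ψ y)) :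
    HasFDerivAt (fun z => ((F (ψ z)).1, fderiv ℝ χ (ψ z) (F (ψ z)).2))
      ((tractorForm G' y).flip ((F (ψ y)).1, fderiv ℝ χ (ψ y) (F (ψ y)).2)) y := by
  have hχ2 : HasFDerivAt (fderiv ℝ χ) (fderiv ℝ (fderiv ℝ χ) (ψ y)) (ψ y) :=
    ((hχ.fderiv_right (m := 1) (by norm_num; exact ENat.LEInfty.out)).differentiableAt
      (by simp)).hasFDerivAt
  have h1 := hF.comp y hψ.hasFDerivAt
  have h2 := (hχ2.comp y hψ.hasFDerivAt).clm_apply h1.snd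
  have htr := hG.christoffel_transform hG' hx (by rwa [hχψ]) hχ hpull (fun u => ⟨_, hinv u⟩)
  have hpull0 := hpull.self_of_nhds
  refine (h1.fst.prodMk h2).congr_fderiv ?_
  ext1 u
  simp only [ContinuousLinearMap.prod_apply, ContinuousLinearMap.comp_apply,
    ContinuousLinearMap.flip_apply, ContinuousLinearMap.coe_fst', ContinuousLinearMap.coe_snd',
    add_apply, tractorForm_apply, map_sub, map_smul, Function.comp_apply, hinv, htr, hpull0, hχψ]
  ext1
  · rfl
  · simp only
    abel

end MetricOnE3

section Manifold

variable {M : Type*} [TopologicalSpace M] [ChartedSpace E3 M] [IsManifold (𝓡 3) ∞ M]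
  {e e' : OpenPartialHomeomorph M E3}

theorem contMDiffOn_atlas_symm (he : e ∈ atlas E3 M) :
    ContMDiffOn (𝓡 3) (𝓡 3) ∞ e.symm e.target :=
  contMDiffOn_symm_of_mem_maximalAtlas (IsManifold.subset_maximalAtlas he)

theorem contMDiffOn_atlas_chart (he : e ∈ atlas E3 M) :
    ContMDiffOn (𝓡 3) (𝓡 3) ∞ e e.source :=
  contMDiffOn_of_mem_maximalAtlas (IsManifold.subset_maximalAtlas he)

/-- The coordinate vector fields of a chart are smooth. -/
theorem contMDiffOn_coordField (he : e ∈ atlas E3 M) (u : E3) :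
    ContMDiffOn (𝓡 3) (𝓡 3).tangent ∞
      (fun y : E3 => (⟨e.symm y, mfderiv (𝓡 3) (𝓡 3) e.symm y u⟩ : TangentBundle (𝓡 3) M))
      e.target := by
  have h1 := (contMDiffOn_atlas_symm he).contMDiffOn_tangentMapWithin (m := ∞) (by simp)
    e.open_target.uniqueMDiffOn
  have h2 : ContMDiff (𝓡 3) (𝓡 3).tangent ∞
      (fun y : E3 => (⟨y, u⟩ : TangentBundle (𝓡 3) E3)) :=
    contMDiff_vectorSpace_iff_contDiff.2 contDiff_const
  have h3 := h1.comp (s := e.target) h2.contMDiffOn (fun y hy => hy)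
  refine h3.congr fun y hy => ?_
  simp only [Function.comp_apply, tangentMapWithin]
  rw [mfderivWithin_of_isOpen e.open_target hy]

end Manifold

namespace LorentzianMetric

variable {M : Type*} [TopologicalSpace M] [ChartedSpace E3 M] [IsManifold (𝓡 3) ∞ M]
  (g : LorentzianMetric M) {e e' : OpenPartialHomeomorph M E3}

theorem inChart_apply (e : OpenPartialHomeomorph M E3) (y u v : E3) :
    g.inChart e y u v = g.val (e.symm y) (mfderiv (𝓡 3) (𝓡 3) e.symm y u)
      (mfderiv (𝓡 3) (𝓡 3) e.symm y v) := rfl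

theorem val_apply_basis {x : M} {b : Module.Basis (Fin 3) ℝ (TangentSpace (𝓡 3) x)}
    (hb : ∀ i j, g.val x (b i) (b j) = Matrix.diagonal ![1, 1, -1] i j)
    (v w : TangentSpace (𝓡 3) x) :
    g.val x v w = b.repr v 0 * b.repr w 0 + b.repr v 1 * b.repr w 1
      - b.repr v 2 * b.repr w 2 := by
  conv_lhs => rw [← b.sum_repr v, ← b.sum_repr w]
  simp only [Fin.sum_univ_three, map_add, map_smul, add_apply, smul_apply, hb]
  simp [Matrix.diagonal]
  ring

theorem nondegenerate {x : M} {v : TangentSpace (𝓡 3) x} (h : ∀ w, g.val x v w = 0) : v = 0 := by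
  obtain ⟨b, hb⟩ := g.signature x
  have h' : ∀ i, b.repr v i = 0 := by
    intro i
    have := h (b i)
    rw [g.val_apply_basis hb] at this
    fin_cases i <;> simpa using this
  exact b.repr.map_eq_zero_iff.1 (Finsupp.ext h')

/-- Smoothness comes from evaluating the bundle section on smooth coordinate fields; invertibility
from nondegeneracy and equality of dimensions. -/
theorem isMetricOn_inChart (he : e ∈ atlas E3 M) :
    MetricOnE3.IsMetricOn (g.inChart e) e.target := by
  refine ⟨e.open_target, ?_, fun x _ u v => ?_, fun x hx => ?_⟩
  · refine contDiffOn_clm_apply.2 fun u => contDiffOn_clm_apply.2 fun v => ?_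
    rw [← contMDiffOn_iff_contDiffOn]
    intro y hy
    have hb : ContMDiffWithinAt (𝓡 3) (𝓡 3) ∞ e.symm e.target y := contMDiffOn_atlas_symm he y hy
    have : ContMDiffWithinAt (𝓡 3) ((𝓡 3).prod 𝓘(ℝ)) ∞
        (fun y : E3 => TotalSpace.mk' ℝ (E := Bundle.Trivial M ℝ) (e.symm y)
          (g.val (e.symm y) (mfderiv (𝓡 3) (𝓡 3) e.symm y u)
            (mfderiv (𝓡 3) (𝓡 3) e.symm y v))) e.target y := by
      apply ContMDiffWithinAt.clm_bundle_apply₂ (F₁ := E3) (F₂ := E3)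
      · exact ContMDiffAt.comp_contMDiffWithinAt y g.contMDiff.contMDiffAt hb
      · exact contMDiffOn_coordField he u y hy
      · exact contMDiffOn_coordField he v y hy
    simp only [contMDiffWithinAt_totalSpace] at this
    exact this.2
  · rw [inChart_apply, inChart_apply, g.symm]
  · have hmd := mdifferentiable_of_mem_atlas (I := 𝓡 3) he
    have hinj : Function.Injective (g.inChart e x) := by
      rw [injective_iff_map_eq_zero]
      intro u hu
      have h0 : mfderiv (𝓡 3) (𝓡 3) e.symm x u = 0 := by
        refine g.nondegenerate fun w => ?_
        obtain ⟨v, rfl⟩ := hmd.symm.mfderiv_surjective (x := x) hx w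
        exact congrArg (fun φ : E3 →L[ℝ] ℝ => φ v) hu
      exact hmd.symm.mfderiv_injective (x := x) hx (h0.trans (map_zero _).symm)
    have hfin : Module.finrank ℝ E3 = Module.finrank ℝ (E3 →L[ℝ] ℝ) := by
      rw [← (LinearMap.toContinuousLinearMap : (E3 →ₗ[ℝ] ℝ) ≃ₗ[ℝ] (E3 →L[ℝ] ℝ)).finrank_eq]
      simp
    let L := LinearEquiv.ofInjectiveOfFinrankEq (g.inChart e x : E3 →ₗ[ℝ] (E3 →L[ℝ] ℝ)) hinj hfin
    exact ⟨L.toContinuousLinearEquiv, by ext u v; rfl⟩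

end LorentzianMetric

end

/-! ### Local linear functions on a spacetime of curvature `-1` -/

noncomputable section

namespace LorentzianMetric

open MetricOnE3

variable {M : Type*} [TopologicalSpace M] [ChartedSpace E3 M] [IsManifold (𝓡 3) ∞ M]
  (g : LorentzianMetric M) {e e' : OpenPartialHomeomorph M E3}

/-- All tangent spaces are the type `E3` by definition, so vectors can be kept fixed while an
equality of base points is rewritten. -/
theorem val_congr {p q : M} (h : p = q) (a b : E3) :
    (g.val p : E3 →L[ℝ] E3 →L[ℝ] ℝ) a b = (g.val q : E3 →L[ℝ] E3 →L[ℝ] ℝ) a b := by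
  subst h; rfl

/-- The domain of the change of charts from `e` to `e'`, in the coordinates of `e`. -/
def overlap {M : Type*} [TopologicalSpace M] (e e' : OpenPartialHomeomorph M E3) : Set E3 :=
  e.target ∩ e.symm ⁻¹' e'.source

theorem isOpen_overlap {M : Type*} [TopologicalSpace M] (e e' : OpenPartialHomeomorph M E3) :
    IsOpen (overlap e e') :=
  e.isOpen_inter_preimage_symm e'.open_source

theorem contDiffOn_overlap (he : e ∈ atlas E3 M) (he' : e' ∈ atlas E3 M) :
    ContDiffOn ℝ ∞ (e' ∘ e.symm) (overlap e e') := by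
  rw [← contMDiffOn_iff_contDiffOn]
  exact (contMDiffOn_atlas_chart he').comp ((contMDiffOn_atlas_symm he).mono inter_subset_left)
    (fun y hy => hy.2)

theorem inChart_overlap (he : e ∈ atlas E3 M) (he' : e' ∈ atlas E3 M) {z : E3}
    (hz : z ∈ overlap e e') (u v : E3) :
    g.inChart e z u v = g.inChart e' ((e' ∘ e.symm) z) (fderiv ℝ (e' ∘ e.symm) z u)
      (fderiv ℝ (e' ∘ e.symm) z v) := by
  have h1 : (e'.symm ∘ (e' ∘ e.symm)) =ᶠ[𝓝 z] e.symm := by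
    filter_upwards [(isOpen_overlap e e').mem_nhds hz] with y hy using e'.left_inv hy.2
  have hmd := (mdifferentiable_of_mem_atlas (I := 𝓡 3) he').mdifferentiableAt_symm
    (x := (e' ∘ e.symm) z) (e'.map_source hz.2)
  have hχ : MDifferentiableAt (𝓡 3) (𝓡 3) (e' ∘ e.symm) z :=
    (((contDiffOn_overlap he he').contDiffAt ((isOpen_overlap e e').mem_nhds hz)).differentiableAt
      (by simp)).mdifferentiableAt
  have h2 := mfderiv_comp z hmd hχ
  rw [mfderiv_eq_fderiv] at h2
  have h3 : ∀ w : E3, (mfderiv (𝓡 3) (𝓡 3) e.symm z w : E3)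
      = mfderiv (𝓡 3) (𝓡 3) e'.symm ((e' ∘ e.symm) z) (fderiv ℝ (e' ∘ e.symm) z w) := by
    intro w
    have h4 := h1.mfderiv_eq (I := 𝓡 3) (I' := 𝓡 3)
    exact (congrArg (fun L : E3 →L[ℝ] E3 => L w) h4).symm.trans
      (congrArg (fun L : E3 →L[ℝ] E3 => L w) h2)
  have h5 := g.val_congr h1.self_of_nhds (mfderiv (𝓡 3) (𝓡 3) e.symm z u)
    (mfderiv (𝓡 3) (𝓡 3) e.symm z v)
  rw [inChart_apply, inChart_apply]
  refine h5.symm.trans ?_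
  rw [h3 u, h3 v]
  rfl

/-- In the chart `e`, near `m`, the function `f` satisfies `Hess f = f g`, and its gradient `Z`
has `g(Z, Z) = 1 + f²`. -/
def IsLinearIn (e : OpenPartialHomeomorph M E3) (f : M → ℝ) (m : M) : Prop :=
  m ∈ e.source ∧ ∃ Z : E3 → E3, ∀ᶠ y in 𝓝 (e m),
    HasFDerivAt (fun z => (f (e.symm z), Z z))
      ((tractorForm (g.inChart e) y).flip (f (e.symm y), Z y)) y
    ∧ g.inChart e y (Z y) (Z y) - f (e.symm y) ^ 2 = 1

variable {g} {f f' : M → ℝ} {m : M}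

/-- A transition map is a local isometry of the coordinate metrics, so it carries parallel pairs to
parallel pairs and preserves their norm. Hence the choice of chart does not matter. -/
theorem IsLinearIn.change_chart (he : e ∈ atlas E3 M) (he' : e' ∈ atlas E3 M)
    (h : g.IsLinearIn e f m) (hm : m ∈ e'.source) : g.IsLinearIn e' f m := by
  obtain ⟨hme, Z, hZ⟩ := h
  refine ⟨hm, fun z => fderiv ℝ (e' ∘ e.symm) ((e ∘ e'.symm) z) (Z ((e ∘ e'.symm) z)), ?_⟩
  have hm' : e' m ∈ overlap e' e := by
    refine ⟨e'.map_source hm, ?_⟩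
    rwa [mem_preimage, e'.left_inv hm]
  have hcont : ContinuousAt (e ∘ e'.symm) (e' m) :=
    (contDiffOn_overlap he' he).continuousOn.continuousAt ((isOpen_overlap e' e).mem_nhds hm')
  have hlim : Tendsto (e ∘ e'.symm) (𝓝 (e' m)) (𝓝 (e m)) := by
    have := hcont.tendsto
    rwa [Function.comp_apply, e'.left_inv hm] at this
  filter_upwards [hlim.eventually hZ, (isOpen_overlap e' e).mem_nhds hm'] with y hy hyo
  have hψo : (e ∘ e'.symm) y ∈ overlap e e' := by
    refine ⟨e.map_source hyo.2, ?_⟩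
    rw [mem_preimage, Function.comp_apply, e.left_inv hyo.2]
    exact e'.map_target hyo.1
  have hback : ∀ z ∈ overlap e' e, (e' ∘ e.symm) ((e ∘ e'.symm) z) = z := by
    intro z hz
    simp only [Function.comp_apply]
    rw [e.left_inv hz.2, e'.right_inv hz.1]
  have hpt : ∀ z ∈ overlap e' e, e.symm ((e ∘ e'.symm) z) = e'.symm z := fun z hz =>
    e.left_inv hz.2
  have hχ : ContDiffAt ℝ ∞ (e' ∘ e.symm) ((e ∘ e'.symm) y) :=
    (contDiffOn_overlap he he').contDiffAt ((isOpen_overlap e e').mem_nhds hψo)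
  have hψ : DifferentiableAt ℝ (e ∘ e'.symm) y :=
    ((contDiffOn_overlap he' he).contDiffAt ((isOpen_overlap e' e).mem_nhds hyo)).differentiableAt
      (by simp)
  have hpull : ∀ᶠ z in 𝓝 ((e ∘ e'.symm) y), ∀ u v, g.inChart e z u v
      = g.inChart e' ((e' ∘ e.symm) z) (fderiv ℝ (e' ∘ e.symm) z u)
        (fderiv ℝ (e' ∘ e.symm) z v) := by
    filter_upwards [(isOpen_overlap e e').mem_nhds hψo] with z hz u v using
      g.inChart_overlap he he' hz u v
  have hinv : ∀ u, fderiv ℝ (e' ∘ e.symm) ((e ∘ e'.symm) y) (fderiv ℝ (e ∘ e'.symm) y u) = u := by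
    intro u
    have h1 := (hχ.differentiableAt (by simp)).hasFDerivAt.comp y hψ.hasFDerivAt
    have h2 : HasFDerivAt ((e' ∘ e.symm) ∘ (e ∘ e'.symm)) (ContinuousLinearMap.id ℝ E3) y := by
      refine (hasFDerivAt_id y).congr_of_eventuallyEq ?_
      filter_upwards [(isOpen_overlap e' e).mem_nhds hyo] with z hz using hback z hz
    exact congrArg (fun L : E3 →L[ℝ] E3 => L u) (h1.unique h2)
  constructor
  · have h3 := (g.isMetricOn_inChart he).tractor_transform (g.isMetricOn_inChart he') hψo.1 hyo.1
      (hback y hyo) hχ hψ hpull hinv hy.1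
    rw [hpt y hyo] at h3
    refine h3.congr_of_eventuallyEq ?_
    filter_upwards [(isOpen_overlap e' e).mem_nhds hyo] with z hz
    simp only [hpt z hz]
  · have h4 := hpull.self_of_nhds (Z ((e ∘ e'.symm) y)) (Z ((e ∘ e'.symm) y))
    rw [hback y hyo] at h4
    rw [← h4, ← hpt y hyo]
    exact hy.2

theorem IsLinearIn.congr (h : g.IsLinearIn e f m) (hff' : f =ᶠ[𝓝 m] f') :
    g.IsLinearIn e f' m := by
  obtain ⟨hme, Z, hZ⟩ := h
  refine ⟨hme, Z, ?_⟩
  have hlim : Tendsto e.symm (𝓝 (e m)) (𝓝 m) := by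
    have := (e.continuousAt_symm (e.map_source hme)).tendsto
    rwa [e.left_inv hme] at this
  filter_upwards [hZ, (hlim.eventually hff').eventually_nhds] with y hy hyf
  rw [← hyf.self_of_nhds]
  refine ⟨hy.1.congr_of_eventuallyEq ?_, hy.2⟩
  filter_upwards [hyf] with z hz
  rw [hz]

variable (g) in
/-- Near `m`, the function `f` satisfies `Hess f = f g` and `|grad f|² = 1 + f²`; in
anti-de Sitter space these are the restrictions of the spacelike unit linear forms of `ℝ^{2,2}`. -/
def IsLinearAt (f : M → ℝ) (m : M) : Prop := ∃ e ∈ atlas E3 M, g.IsLinearIn e f m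

theorem IsLinearAt.isLinearIn (h : g.IsLinearAt f m) (he : e ∈ atlas E3 M) (hm : m ∈ e.source) :
    g.IsLinearIn e f m := by
  obtain ⟨e₀, he₀, h⟩ := h
  exact h.change_chart he₀ he hm

theorem IsLinearAt.congr (h : g.IsLinearAt f m) (hff' : f =ᶠ[𝓝 m] f') : g.IsLinearAt f' m := by
  obtain ⟨e, he, h⟩ := h
  exact ⟨e, he, h.congr hff'⟩

/-- The scalar part of the system reads `df = g(Z,·)`, so by nondegeneracy the germ of `f`
determines `Z`. This is why germs of functions suffice to encode parallel pairs. -/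
theorem tractor_eq_of_eventuallyEq (he : e ∈ atlas E3 M) {y : E3} (hy : y ∈ e.target)
    {φ φ' : E3 → ℝ} {Z Z' : E3 → E3}
    (hZ : HasFDerivAt (fun z => (φ z, Z z)) ((tractorForm (g.inChart e) y).flip (φ y, Z y)) y)
    (hZ' : HasFDerivAt (fun z => (φ' z, Z' z))
      ((tractorForm (g.inChart e) y).flip (φ' y, Z' y)) y)
    (h : φ =ᶠ[𝓝 y] φ') : (φ y, Z y) = (φ' y, Z' y) := by
  have h1 : HasFDerivAt φ _ y := hZ.fst
  have h2 : HasFDerivAt φ' _ y := hZ'.fst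
  have h3 := h1.unique (h2.congr_of_eventuallyEq h)
  refine Prod.ext h.self_of_nhds ?_
  refine (g.isMetricOn_inChart he).nondegenerate hy fun w => ?_
  simpa [tractorForm_apply] using congrArg (fun L : E3 →L[ℝ] ℝ => L w) h3

/-- The domain, in `M`, of the coordinate ball of radius `r` about `m`. -/
theorem coordBall_mem_nhds {M : Type*} [TopologicalSpace M] {e : OpenPartialHomeomorph M E3}
    {m : M} {r : ℝ} (hr : 0 < r) (hm : m ∈ e.source) :
    e.source ∩ e ⁻¹' Metric.ball (e m) r ∈ 𝓝 m :=
  inter_mem (e.open_source.mem_nhds hm) ((e.continuousAt hm) (Metric.ball_mem_nhds _ hr))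

theorem HasConstantSectionalCurvature.tractorForm_flat (hg : g.HasConstantSectionalCurvature (-1))
    (he : e ∈ atlas E3 M) {c : E3} (hc : c ∈ e.target) :
    ∃ R > 0, Metric.ball c R ⊆ e.target ∧ ∀ r ≤ R,
      (∀ x₁ ∈ Metric.ball c r, ∀ v : ℝ × E3, ∃ F : E3 → ℝ × E3, F x₁ = v ∧
        ∀ x ∈ Metric.ball c r, HasFDerivAt F ((tractorForm (g.inChart e) x).flip (F x)) x) ∧
      ∀ F F' : E3 → ℝ × E3,
        (∀ x ∈ Metric.ball c r, HasFDerivAt F ((tractorForm (g.inChart e) x).flip (F x)) x) →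
        (∀ x ∈ Metric.ball c r, HasFDerivAt F' ((tractorForm (g.inChart e) x).flip (F' x)) x) →
        ∀ x₁ ∈ Metric.ball c r, F x₁ = F' x₁ → ∀ x ∈ Metric.ball c r, F x = F' x :=
  flat_system_exists_unique e.open_target
    ((g.isMetricOn_inChart he).contDiffOn_tractorForm.of_le ENat.LEInfty.out)
    (fun x hx u h v => (g.isMetricOn_inChart he).tractorForm_flat hx (hg e he x hx) u h v) hc

/-- The norm of a parallel pair is constant on the ball, so the normalisation need only be checked
at `x₁`. -/
theorem isLinearIn_of_system (he : e ∈ atlas E3 M) {c : E3} {r : ℝ}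
    (hball : Metric.ball c r ⊆ e.target) {F : E3 → ℝ × E3}
    (hF : ∀ x ∈ Metric.ball c r, HasFDerivAt F ((tractorForm (g.inChart e) x).flip (F x)) x)
    {x₁ : E3} (hx₁ : x₁ ∈ Metric.ball c r)
    (hnorm : g.inChart e x₁ (F x₁).2 (F x₁).2 - (F x₁).1 ^ 2 = 1)
    (hm : m ∈ e.source) (hmb : e m ∈ Metric.ball c r) :
    g.IsLinearIn e (fun p => (F (e p)).1) m := by
  refine ⟨hm, fun z => (F z).2, ?_⟩
  have hQ : ∀ y ∈ Metric.ball c r, g.inChart e y (F y).2 (F y).2 - (F y).1 ^ 2 = 1 := by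
    intro y hy
    rw [← hnorm]
    have hder := fun z (hz : z ∈ Metric.ball c r) =>
      (g.isMetricOn_inChart he).hasFDerivAt_tractorNorm (hball hz) (hF z hz)
    exact Metric.isOpen_ball.is_const_of_fderiv_eq_zero (convex_ball c r).isPreconnected
      (fun z hz => (hder z hz).differentiableAt.differentiableWithinAt)
      (fun z hz => (hder z hz).fderiv) hy hx₁
  filter_upwards [Metric.isOpen_ball.mem_nhds hmb] with y hy
  rw [e.right_inv (hball hy)]
  refine ⟨(hF y hy).congr_of_eventuallyEq ?_, hQ y hy⟩
  filter_upwards [Metric.isOpen_ball.mem_nhds hy] with z hz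
  simp only [e.right_inv (hball hz)]

/-- Local uniqueness of linear functions. -/
theorem IsLinearAt.unique (hg : g.HasConstantSectionalCurvature (-1))
    (h : g.IsLinearAt f m) (h' : g.IsLinearAt f' m) :
    ∃ U ∈ 𝓝 m, ∀ m' ∈ U, f =ᶠ[𝓝 m'] f' → f =ᶠ[𝓝 m] f' := by
  have he := chart_mem_atlas E3 m
  set e := chartAt E3 m
  have hm : m ∈ e.source := mem_chart_source E3 m
  obtain ⟨-, Z, hZ⟩ := h.isLinearIn he hm
  obtain ⟨-, Z', hZ'⟩ := h'.isLinearIn he hm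
  obtain ⟨R, hR, hRt, hsys⟩ := hg.tractorForm_flat he (e.map_source hm)
  obtain ⟨ρ, hρ, hball⟩ := Metric.eventually_nhds_iff_ball.1 (hZ.and hZ')
  have hr : 0 < min ρ R := by positivity
  refine ⟨_, coordBall_mem_nhds hr hm, fun m' hm' hff' => ?_⟩
  have hbρ : Metric.ball (e m) (min ρ R) ⊆ Metric.ball (e m) ρ :=
    Metric.ball_subset_ball (min_le_left _ _)
  have hlim : Tendsto e.symm (𝓝 (e m')) (𝓝 m') := by
    have := (e.continuousAt_symm (e.map_source hm'.1)).tendsto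
    rwa [e.left_inv hm'.1] at this
  have heq := (hsys _ (min_le_right ρ R)).2 (fun z => (f (e.symm z), Z z))
    (fun z => (f' (e.symm z), Z' z)) (fun x hx => (hball x (hbρ hx)).1.1)
    (fun x hx => (hball x (hbρ hx)).2.1) (e m') hm'.2
    (tractor_eq_of_eventuallyEq he (e.map_source hm'.1) (φ := fun z => f (e.symm z))
      (φ' := fun z => f' (e.symm z)) (hball _ (hbρ hm'.2)).1.1
      (hball _ (hbρ hm'.2)).2.1 (hlim.eventually hff'))
  filter_upwards [coordBall_mem_nhds hr hm] with p hp
  have := congrArg Prod.fst (heq _ hp.2)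
  simpa only [e.left_inv hp.1] using this

/-- Local extension of linear functions. -/
theorem exists_extension_isLinearAt (hg : g.HasConstantSectionalCurvature (-1)) (m : M) :
    ∃ U ∈ 𝓝 m, ∀ m' ∈ U, ∀ f, g.IsLinearAt f m' →
      ∃ f', f' =ᶠ[𝓝 m'] f ∧ ∀ m'' ∈ U, g.IsLinearAt f' m'' := by
  have he := chart_mem_atlas E3 m
  set e := chartAt E3 m
  have hm : m ∈ e.source := mem_chart_source E3 m
  obtain ⟨R, hR, hRt, hsys⟩ := hg.tractorForm_flat he (e.map_source hm)
  refine ⟨_, coordBall_mem_nhds hR hm, fun m' hm' f hf => ?_⟩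
  obtain ⟨-, Z, hZ⟩ := hf.isLinearIn he hm'.1
  obtain ⟨F, hF1, hF⟩ := (hsys R le_rfl).1 (e m') hm'.2 (f (e.symm (e m')), Z (e m'))
  refine ⟨fun p => (F (e p)).1, ?_, fun m'' hm'' => ⟨e, he, isLinearIn_of_system he hRt hF hm'.2
    (by rw [hF1]; exact hZ.self_of_nhds.2) hm''.1 hm''.2⟩⟩
  -- The pair `(f, Z)` is parallel only near `m'`, so it is compared with `F` on a smaller ball
  -- centred there.
  obtain ⟨R', hR', -, hsys'⟩ := hg.tractorForm_flat he (e.map_source hm'.1)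
  obtain ⟨ρ, hρ, hball⟩ := Metric.eventually_nhds_iff_ball.1
    (hZ.and (Metric.isOpen_ball.eventually_mem hm'.2))
  have hr : 0 < min ρ R' := by positivity
  have hbρ : Metric.ball (e m') (min ρ R') ⊆ Metric.ball (e m') ρ :=
    Metric.ball_subset_ball (min_le_left _ _)
  have heq := (hsys' _ (min_le_right ρ R')).2 F (fun z => (f (e.symm z), Z z))
    (fun x hx => hF x (hball x (hbρ hx)).2) (fun x hx => (hball x (hbρ hx)).1.1) (e m')
    (Metric.mem_ball_self hr) hF1
  filter_upwards [coordBall_mem_nhds hr hm'.1] with p hp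
  simp only [heq _ hp.2, e.left_inv hp.1]

/-- Local existence of linear functions. -/
theorem exists_isLinearAt (hg : g.HasConstantSectionalCurvature (-1)) (m : M) :
    ∃ f, g.IsLinearAt f m := by
  have he := chart_mem_atlas E3 m
  set e := chartAt E3 m
  have hm : m ∈ e.source := mem_chart_source E3 m
  have het := e.map_source hm
  obtain ⟨R, hR, hRt, hsys⟩ := hg.tractorForm_flat he het
  obtain ⟨b, hb⟩ := g.signature (e.symm (e m))
  obtain ⟨u, hu⟩ := ((mdifferentiable_of_mem_atlas (I := 𝓡 3) he).symm.mfderiv_surjective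
    (x := e m) het) (b 0)
  -- Initial value zero for the function and a unit spacelike vector for the gradient: the norm is
  -- `1 - 0² = 1`.
  obtain ⟨F, hF1, hF⟩ := (hsys R le_rfl).1 (e m) (Metric.mem_ball_self hR) (0, u)
  refine ⟨fun p => (F (e p)).1, e, he, isLinearIn_of_system he hRt hF (Metric.mem_ball_self hR)
    ?_ hm (Metric.mem_ball_self hR)⟩
  rw [hF1, inChart_apply]
  have h : g.val (e.symm (e m)) (mfderiv (𝓡 3) (𝓡 3) e.symm (e m) u)
      (mfderiv (𝓡 3) (𝓡 3) e.symm (e m) u) = 1 := by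
    rw [hu, hb]; simp
  simpa using h

/-- A linear function is differentiable, with spacelike gradient. -/
theorem IsLinearAt.hasFDerivAt (h : g.IsLinearAt f m) (he : e ∈ atlas E3 M) (hm : m ∈ e.source) :
    ∃ Z : E3, HasFDerivAt (fun y => f (e.symm y)) (g.inChart e (e m) Z) (e m) ∧
      0 < g.inChart e (e m) Z Z := by
  obtain ⟨-, Z, hZ⟩ := h.isLinearIn he hm
  refine ⟨Z (e m), ?_, ?_⟩
  · have h1 : HasFDerivAt (fun y => f (e.symm y)) _ (e m) := hZ.self_of_nhds.1.fst
    exact h1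
  · nlinarith [hZ.self_of_nhds.2]

theorem IsLinearAt.continuousAt (h : g.IsLinearAt f m) : ContinuousAt f m := by
  have hm := mem_chart_source E3 m
  obtain ⟨Z, hZ, -⟩ := h.hasFDerivAt (chart_mem_atlas E3 m) hm
  have h1 : ContinuousAt (fun p => f ((chartAt E3 m).symm (chartAt E3 m p))) m :=
    ContinuousAt.comp (f := chartAt E3 m) (g := fun y => f ((chartAt E3 m).symm y))
      hZ.continuousAt ((chartAt E3 m).continuousAt hm)
  refine h1.congr ?_
  filter_upwards [(chartAt E3 m).open_source.mem_nhds hm] with p hp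
  rw [(chartAt E3 m).left_inv hp]

end LorentzianMetric

end

/-! ### Local systems of germs and their triviality on the sphere -/

noncomputable section

section Monodromy

variable {M P P' : Type*} [TopologicalSpace M] [TopologicalSpace P] [TopologicalSpace P']

/-- The germs `f` at `m` with `Sol f m` form a locally constant sheaf on `M`. -/
structure IsLocalSystem (Sol : (M → ℝ) → M → Prop) : Prop where
  congr : ∀ {f f' : M → ℝ} {m : M}, Sol f m → f =ᶠ[𝓝 m] f' → Sol f' m
  unique : ∀ {f f' : M → ℝ} {m : M}, Sol f m → Sol f' m →
    ∃ U ∈ 𝓝 m, ∀ m' ∈ U, f =ᶠ[𝓝 m'] f' → f =ᶠ[𝓝 m] f'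
  extend : ∀ m, ∃ U ∈ 𝓝 m, ∀ m' ∈ U, ∀ f, Sol f m' →
    ∃ f', f' =ᶠ[𝓝 m'] f ∧ ∀ m'' ∈ U, Sol f' m''

/-- `s` is a continuous section over `A` of the pull-back by `Φ` of the sheaf of germs `Sol`. -/
structure IsSheafSection (Sol : (M → ℝ) → M → Prop) (Φ : P → M) (A : Set P) (s : P → M → ℝ) :
    Prop where
  sol : ∀ w ∈ A, Sol (s w) (Φ w)
  compat : ∀ w ∈ A, ∀ᶠ w' in 𝓝[A] w, s w' =ᶠ[𝓝 (Φ w')] s w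

/-- Every germ at a point of `A` extends to a section over `A`. -/
def HasSections (Sol : (M → ℝ) → M → Prop) (Φ : P → M) (A : Set P) : Prop :=
  ∀ w ∈ A, ∀ f, Sol f (Φ w) → ∃ s, IsSheafSection Sol Φ A s ∧ s w =ᶠ[𝓝 (Φ w)] f

variable {Sol : (M → ℝ) → M → Prop} {Φ : P → M} {A B : Set P} {s s' : P → M → ℝ}

theorem IsSheafSection.mono (h : IsSheafSection Sol Φ A s) (hB : B ⊆ A) :
    IsSheafSection Sol Φ B s :=
  ⟨fun w hw => h.sol w (hB hw), fun w hw => nhdsWithin_mono _ hB (h.compat w (hB hw))⟩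

theorem IsSheafSection.comp (h : IsSheafSection Sol Φ A s) {ι : P' → P} (hι : Continuous ι)
    {A' : Set P'} (hA' : MapsTo ι A' A) : IsSheafSection Sol (Φ ∘ ι) A' (s ∘ ι) :=
  ⟨fun _ hw => h.sol _ (hA' hw), fun _ hw =>
    (hι.continuousWithinAt.tendsto_nhdsWithin hA').eventually (h.compat _ (hA' hw))⟩

theorem IsSheafSection.congr (hS : IsLocalSystem Sol) (hΦ : Continuous Φ)
    (h : IsSheafSection Sol Φ A s) (hs : ∀ w ∈ A, s w =ᶠ[𝓝 (Φ w)] s' w) :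
    IsSheafSection Sol Φ A s' := by
  refine ⟨fun w hw => hS.congr (h.sol w hw) (hs w hw), fun w hw => ?_⟩
  have h1 : ∀ᶠ w' in 𝓝[A] w, s w =ᶠ[𝓝 (Φ w')] s' w :=
    (hΦ.continuousWithinAt.tendsto).eventually (eventually_eventuallyEq_nhds.2 (hs w hw))
  filter_upwards [h.compat w hw, h1, self_mem_nhdsWithin] with w' h2 h3 h4
  exact (hs w' h4).symm.trans (h2.trans h3)

/-- At a point outside one of the closed pieces, the condition relative to that piece is vacuous. -/
theorem IsSheafSection.union (hA : IsClosed A) (hB : IsClosed B) (h : IsSheafSection Sol Φ A s)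
    (h' : IsSheafSection Sol Φ B s) : IsSheafSection Sol Φ (A ∪ B) s := by
  refine ⟨fun w hw => hw.elim (h.sol w) (h'.sol w), fun w _ => ?_⟩
  rw [nhdsWithin_union, eventually_sup]
  constructor
  · by_cases hw : w ∈ A
    · exact h.compat w hw
    · rw [notMem_closure_iff_nhdsWithin_eq_bot.1 (by rwa [hA.closure_eq])]
      exact eventually_bot
  · by_cases hw : w ∈ B
    · exact h'.compat w hw
    · rw [notMem_closure_iff_nhdsWithin_eq_bot.1 (by rwa [hB.closure_eq])]
      exact eventually_bot

/-- Two sections over a connected set that agree at a point agree everywhere. -/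
theorem IsSheafSection.eq_of_eq (hS : IsLocalSystem Sol) (hΦ : Continuous Φ)
    (hA : IsPreconnected A) (h : IsSheafSection Sol Φ A s) (h' : IsSheafSection Sol Φ A s')
    {w₀ : P} (hw₀ : w₀ ∈ A) (heq : s w₀ =ᶠ[𝓝 (Φ w₀)] s' w₀) :
    ∀ w ∈ A, s w =ᶠ[𝓝 (Φ w)] s' w := by
  classical
  intro w hw
  -- The agreement locus is open because equal germs stay equal nearby, and its complement is open
  -- by `unique`.
  have hcont : ContinuousOn (fun w => decide (s w =ᶠ[𝓝 (Φ w)] s' w)) A := by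
    intro w hw
    refine tendsto_nhds_of_eventually_eq ?_
    have hΦw : Tendsto Φ (𝓝[A] w) (𝓝 (Φ w)) := hΦ.continuousWithinAt.tendsto
    by_cases he : s w =ᶠ[𝓝 (Φ w)] s' w
    · filter_upwards [h.compat w hw, h'.compat w hw,
        hΦw.eventually (eventually_eventuallyEq_nhds.2 he)] with w' h1 h2 h3
      simp only [he, decide_true, decide_eq_true_eq]
      exact h1.trans (h3.trans h2.symm)
    · obtain ⟨U, hU, hun⟩ := hS.unique (h.sol w hw) (h'.sol w hw)
      filter_upwards [h.compat w hw, h'.compat w hw, hΦw.eventually_mem hU] with w' h1 h2 h3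
      simp only [he, decide_false, decide_eq_false_iff_not]
      exact fun h4 => he (hun _ h3 (h1.symm.trans (h4.trans h2)))
  have := hA.constant hcont hw hw₀
  simpa [heq] using this

theorem hasSections_of_subset {U : Set M}
    (hU : ∀ m' ∈ U, ∀ f, Sol f m' → ∃ f', f' =ᶠ[𝓝 m'] f ∧ ∀ m'' ∈ U, Sol f' m'')
    (hA : A ⊆ Φ ⁻¹' U) : HasSections Sol Φ A := by
  intro w hw f hf
  obtain ⟨f', hf', hsol⟩ := hU _ (hA hw) f hf
  exact ⟨fun _ => f', ⟨fun w' hw' => hsol _ (hA hw'), fun w' _ => Eventually.of_forall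
    fun _ => EventuallyEq.rfl⟩, hf'⟩

/-- Continue the section through the common point `y` into the other piece. Connectedness of `A ∩ B`
makes the two sections agree on the whole overlap, so they glue. -/
theorem HasSections.union (hS : IsLocalSystem Sol) (hΦ : Continuous Φ) (hA : IsClosed A)
    (hB : IsClosed B) (hAB : IsPreconnected (A ∩ B)) (hne : (A ∩ B).Nonempty)
    (h : HasSections Sol Φ A) (h' : HasSections Sol Φ B) : HasSections Sol Φ (A ∪ B) := by
  classical
  obtain ⟨y, hyA, hyB⟩ := hne
  have glue : ∀ sA sB, IsSheafSection Sol Φ A sA → IsSheafSection Sol Φ B sB →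
      sA y =ᶠ[𝓝 (Φ y)] sB y → ∃ s, IsSheafSection Sol Φ (A ∪ B) s ∧
        (∀ w ∈ A, sA w =ᶠ[𝓝 (Φ w)] s w) ∧ ∀ w ∈ B, sB w =ᶠ[𝓝 (Φ w)] s w := by
    intro sA sB hsA hsB hy
    have heq := (hsA.mono inter_subset_left).eq_of_eq hS hΦ hAB (hsB.mono inter_subset_right)
      ⟨hyA, hyB⟩ hy
    have h1 : ∀ w ∈ A, sA w =ᶠ[𝓝 (Φ w)] (if w ∈ A then sA w else sB w) := by
      intro w hw
      rw [if_pos hw]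
    have h2 : ∀ w ∈ B, sB w =ᶠ[𝓝 (Φ w)] (if w ∈ A then sA w else sB w) := by
      intro w hw
      split_ifs with hwA
      · exact (heq w ⟨hwA, hw⟩).symm
      · exact EventuallyEq.rfl
    exact ⟨fun w => if w ∈ A then sA w else sB w,
      (hsA.congr hS hΦ h1).union hA hB (hsB.congr hS hΦ h2), h1, h2⟩
  rintro w (hw | hw) f hf
  · obtain ⟨sA, hsA, hA0⟩ := h w hw f hf
    obtain ⟨sB, hsB, hB0⟩ := h' y hyB (sA y) (hsA.sol y hyA)
    obtain ⟨s, hs, h1, -⟩ := glue sA sB hsA hsB hB0.symm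
    exact ⟨s, hs, (h1 w hw).symm.trans hA0⟩
  · obtain ⟨sB, hsB, hB0⟩ := h' w hw f hf
    obtain ⟨sA, hsA, hA0⟩ := h y hyA (sB y) (hsB.sol y hyB)
    obtain ⟨s, hs, -, h2⟩ := glue sA sB hsA hsB hA0
    exact ⟨s, hs, (h2 w hw).symm.trans hB0⟩

/-- A property of compact intervals that is local and stable by concatenation holds for all
intervals. -/
theorem interval_induction {p : ℝ → ℝ → Prop}
    (hloc : ∀ x, ∃ ε > 0, ∀ u v, u ≤ v → x - ε < u → v < x + ε → p u v)
    (hadd : ∀ u v w, u ≤ v → v ≤ w → p u v → p v w → p u w) {a b : ℝ} (hab : a ≤ b) : p a b := by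
  choose ε hε hp using hloc
  obtain ⟨t, ht0, htm, ⟨m, hm⟩, ht⟩ := exists_monotone_Icc_subset_open_cover_Icc hab
    (c := fun x : ℝ => {y : Icc a b | (y : ℝ) ∈ Ioo (x - ε x) (x + ε x)})
    (fun x => isOpen_Ioo.preimage continuous_subtype_val)
    (fun y _ => mem_iUnion.2 ⟨(y : ℝ), by
      simp only [mem_ofPred_eq, mem_Ioo]; constructor <;> linarith [hε y]⟩)
  have hstep : ∀ n, p (t n) (t (n + 1)) := by
    intro n
    obtain ⟨x, hx⟩ := ht n
    have hle : t n ≤ t (n + 1) := htm n.le_succ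
    exact hp x _ _ hle (hx ⟨le_rfl, hle⟩).1 (hx ⟨hle, le_rfl⟩).2
  have hall : ∀ n, p (t 0) (t (n + 1)) := by
    intro n
    induction n with
    | zero => exact hstep 0
    | succ k ih => exact hadd _ _ _ (htm (Nat.zero_le _)) (htm (Nat.le_succ _)) ih (hstep (k + 1))
  have := hall m
  rwa [ht0, hm (m + 1) (Nat.le_succ m)] at this

/-- A local system pulled back to a rectangle has sections. -/
theorem hasSections_rectangle (hS : IsLocalSystem Sol) {Φ : ℝ × ℝ → M} (hΦ : Continuous Φ)
    {a b c d : ℝ} (hab : a ≤ b) (hcd : c ≤ d) : HasSections Sol Φ (Icc a b ×ˢ Icc c d) := by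
  have hclosed : ∀ a b c d : ℝ, IsClosed (Icc a b ×ˢ Icc c d) := fun a b c d =>
    isClosed_Icc.prod isClosed_Icc
  -- First concatenate small rectangles horizontally. Keeping the height `ε` inside the inductive
  -- property lets it shrink at each concatenation.
  have hstrip : ∀ t : ℝ, ∃ ε > 0, ∀ u v, u ≤ v → t - ε < u → v < t + ε →
      HasSections Sol Φ (Icc a b ×ˢ Icc u v) := by
    intro t
    refine interval_induction (p := fun x y => ∃ ε > 0, ∀ u v, u ≤ v → t - ε < u → v < t + ε →
      HasSections Sol Φ (Icc x y ×ˢ Icc u v)) (fun x => ?_) ?_ hab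
    · obtain ⟨U, hU, hext⟩ := hS.extend (Φ (x, t))
      obtain ⟨ε, hε, hball⟩ := Metric.mem_nhds_iff.1 (hΦ.continuousAt.preimage_mem_nhds hU)
      refine ⟨ε, hε, fun x₁ x₂ _ hx₁ hx₂ => ⟨ε, hε, fun u v _ hu hv =>
        hasSections_of_subset hext fun w hw => hball ?_⟩⟩
      rw [Metric.mem_ball, Prod.dist_eq, max_lt_iff, Real.dist_eq, Real.dist_eq, abs_lt, abs_lt]
      obtain ⟨⟨h1, h2⟩, h3, h4⟩ := hw
      refine ⟨⟨?_, ?_⟩, ?_, ?_⟩ <;> simp only <;> linarith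
    · rintro x y z hxy hyz ⟨ε, hε, h⟩ ⟨ε', hε', h'⟩
      refine ⟨min ε ε', by positivity, fun u v huv hu hv => ?_⟩
      have h1 := h u v huv (by linarith [min_le_left ε ε']) (by linarith [min_le_left ε ε'])
      have h2 := h' u v huv (by linarith [min_le_right ε ε']) (by linarith [min_le_right ε ε'])
      have hint : Icc x y ×ˢ Icc u v ∩ Icc y z ×ˢ Icc u v = {y} ×ˢ Icc u v := by
        rw [← inter_prod, Icc_inter_Icc_eq_singleton hxy hyz]
      have h3 := h1.union hS hΦ (hclosed _ _ _ _) (hclosed _ _ _ _)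
        (by rw [hint]; exact isPreconnected_singleton.prod isPreconnected_Icc)
        (by rw [hint]; exact ⟨(y, u), rfl, le_rfl, huv⟩) h2
      rwa [← union_prod, Icc_union_Icc_eq_Icc hxy hyz] at h3
  refine interval_induction (p := fun u v => HasSections Sol Φ (Icc a b ×ˢ Icc u v)) hstrip ?_ hcd
  intro u v w huv hvw h1 h2
  have hint : Icc a b ×ˢ Icc u v ∩ Icc a b ×ˢ Icc v w = Icc a b ×ˢ {v} := by
    rw [← prod_inter, Icc_inter_Icc_eq_singleton huv hvw]
  have h3 := h1.union hS hΦ (hclosed _ _ _ _) (hclosed _ _ _ _)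
    (by rw [hint]; exact isPreconnected_Icc.prod isPreconnected_singleton)
    (by rw [hint]; exact ⟨(a, v), ⟨le_rfl, hab⟩, rfl⟩) h2
  rwa [← prod_union, Icc_union_Icc_eq_Icc huv hvw] at h3

/-- Otherwise bad points over points tending to `x` would accumulate, by compactness, at a point of
`K` over `x`. This descends local properties along a map from a compact set without a continuous
lift. -/
theorem IsCompact.eventually_fiber {X : Type*} [TopologicalSpace X] [T2Space X] {K : Set P}
    (hK : IsCompact K) {q : P → X} (hq : Continuous q) {p : P → Prop} {x : X}
    (h : ∀ w ∈ K, q w = x → ∀ᶠ w' in 𝓝[K] w, p w') :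
    ∀ᶠ x' in 𝓝 x, ∀ w ∈ K, q w = x' → p w := by
  by_contra hcon
  rw [not_eventually] at hcon
  have hne : NeBot (comap q (𝓝 x) ⊓ 𝓟 {w | w ∈ K ∧ ¬ p w}) := by
    rw [inf_principal_neBot_iff]
    intro U hU
    obtain ⟨V, hV, hVU⟩ := mem_comap.1 hU
    obtain ⟨x', hx', hx'V⟩ := (hcon.and_eventually hV).exists
    push Not at hx'
    obtain ⟨w, hw, rfl, hpw⟩ := hx'
    exact ⟨w, hVU hx'V, hw, hpw⟩
  obtain ⟨w, hw, hcl⟩ := hK (f := comap q (𝓝 x) ⊓ 𝓟 {w | w ∈ K ∧ ¬ p w})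
    (inf_le_right.trans (principal_mono.2 fun w hw => hw.1))
  have hqw : q w = x := by
    have h1 : NeBot (𝓝 w ⊓ comap q (𝓝 x)) := hcl.neBot.mono (inf_le_inf_left _ inf_le_left)
    have h2 : NeBot (𝓝 (q w) ⊓ 𝓝 x) := by
      refine (h1.map q).mono (le_inf ?_ ?_)
      · exact (map_mono inf_le_left).trans hq.continuousAt
      · exact (map_mono inf_le_right).trans map_comap_le
    exact eq_of_nhds_neBot h2
  have h3 := eventually_nhdsWithin_iff.1 (h w hw hqw)
  have h4 : ∃ᶠ w' in 𝓝 w, w' ∈ K ∧ ¬ p w' := by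
    rw [frequently_iff_neBot]
    exact hcl.neBot.mono (inf_le_inf_left _ inf_le_right)
  obtain ⟨w', ⟨h5, h6⟩, h7⟩ := (h4.and_eventually h3).exists
  exact h6 (h7 h5)

/-- Spherical coordinates. -/
def sphericalCoord (w : ℝ × ℝ) : Metric.sphere (0 : EuclideanSpace ℝ (Fin 3)) 1 :=
  ⟨!₂[Real.sin w.1 * Real.cos w.2, Real.sin w.1 * Real.sin w.2, Real.cos w.1], by
    rw [mem_sphere_zero_iff_norm, EuclideanSpace.norm_eq, Real.sqrt_eq_one, Fin.sum_univ_three]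
    simp only [Real.norm_eq_abs, sq_abs]
    simp
    nlinarith [Real.sin_sq_add_cos_sq w.1, Real.sin_sq_add_cos_sq w.2]⟩

theorem continuous_sphericalCoord : Continuous sphericalCoord := by
  refine Continuous.subtype_mk ?_ _
  refine (PiLp.continuous_toLp 2 _).comp (continuous_pi fun i => ?_)
  fin_cases i <;> simp <;> fun_prop

theorem sphericalCoord_eq_iff {w w' : ℝ × ℝ} : sphericalCoord w = sphericalCoord w' ↔
    Real.sin w.1 * Real.cos w.2 = Real.sin w'.1 * Real.cos w'.2 ∧
    Real.sin w.1 * Real.sin w.2 = Real.sin w'.1 * Real.sin w'.2 ∧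
    Real.cos w.1 = Real.cos w'.1 := by
  rw [sphericalCoord, sphericalCoord, Subtype.mk.injEq]
  constructor
  · intro h
    have h' := fun i => congrArg (fun v : EuclideanSpace ℝ (Fin 3) => v i) h
    exact ⟨by simpa using h' 0, by simpa using h' 1, by simpa using h' 2⟩
  · rintro ⟨h1, h2, h3⟩
    rw [h1, h2, h3]

theorem exists_sphericalCoord (x : Metric.sphere (0 : EuclideanSpace ℝ (Fin 3)) 1) :
    ∃ w ∈ Icc 0 Real.pi ×ˢ Icc 0 (2 * Real.pi), sphericalCoord w = x := by
  obtain ⟨x, hx⟩ := x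
  have hsq : x 0 ^ 2 + x 1 ^ 2 + x 2 ^ 2 = 1 := by
    rw [mem_sphere_zero_iff_norm, EuclideanSpace.norm_eq, Real.sqrt_eq_one,
      Fin.sum_univ_three] at hx
    simpa only [Real.norm_eq_abs, sq_abs] using hx
  have hz1 : -1 ≤ x 2 := by nlinarith [sq_nonneg (x 0), sq_nonneg (x 1)]
  have hz2 : x 2 ≤ 1 := by nlinarith [sq_nonneg (x 0), sq_nonneg (x 1)]
  -- The longitude is the argument of the horizontal part, shifted into `[0, 2π]`; its modulus is
  -- the sine of the polar angle.
  set ζ : ℂ := ⟨x 0, x 1⟩ with hζ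
  have hn : ‖ζ‖ = Real.sin (Real.arccos (x 2)) := by
    rw [Real.sin_arccos, Complex.norm_def, Complex.normSq_apply]
    congr 1
    simp only [hζ]
    linarith
  have hre : ‖ζ‖ * Real.cos ζ.arg = x 0 := Complex.norm_mul_cos_arg ζ
  have him : ‖ζ‖ * Real.sin ζ.arg = x 1 := Complex.norm_mul_sin_arg ζ
  obtain ⟨θ, hθ, hc, hs⟩ : ∃ θ ∈ Icc 0 (2 * Real.pi), Real.cos θ = Real.cos ζ.arg ∧
      Real.sin θ = Real.sin ζ.arg := by
    have h1 := Complex.neg_pi_lt_arg ζ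
    have h2 := Complex.arg_le_pi ζ
    rcases le_or_gt 0 ζ.arg with h | h
    · exact ⟨ζ.arg, ⟨h, by linarith [Real.pi_pos]⟩, rfl, rfl⟩
    · exact ⟨ζ.arg + 2 * Real.pi, ⟨by linarith, by linarith⟩, Real.cos_add_two_pi _,
        Real.sin_add_two_pi _⟩
  refine ⟨(Real.arccos (x 2), θ), ⟨⟨Real.arccos_nonneg _, Real.arccos_le_pi _⟩, hθ⟩, ?_⟩
  rw [sphericalCoord, Subtype.mk.injEq]
  ext i
  fin_cases i
  · simp [hc, ← hn, hre]
  · simp [hs, ← hn, him]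
  · simp [Real.cos_arccos hz1 hz2]

/-- A local system pulled back to the sphere is trivial. -/
theorem IsLocalSystem.exists_section_sphere (hS : IsLocalSystem Sol)
    {φ : Metric.sphere (0 : EuclideanSpace ℝ (Fin 3)) 1 → M} (hφ : Continuous φ)
    (hne : ∀ m, ∃ f, Sol f m) :
    ∃ s : Metric.sphere (0 : EuclideanSpace ℝ (Fin 3)) 1 → M → ℝ,
      IsSheafSection Sol φ univ s := by
  have hpi := Real.pi_pos
  set A : Set (ℝ × ℝ) := Icc 0 Real.pi ×ˢ Icc 0 (2 * Real.pi) with hA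
  have hΦ : Continuous (φ ∘ sphericalCoord) := hφ.comp continuous_sphericalCoord
  obtain ⟨f₀, hf₀⟩ := hne (φ (sphericalCoord (0, 0)))
  obtain ⟨s, hs, -⟩ := hasSections_rectangle hS hΦ (a := 0) (b := Real.pi) (c := 0)
    (d := 2 * Real.pi) hpi.le (by linarith) (0, 0) ⟨⟨le_rfl, hpi.le⟩, ⟨le_rfl, by simp; linarith⟩⟩
    f₀ hf₀
  -- A pole edge of the rectangle is collapsed to a point, so the constant germ is also a section
  -- along it.
  have hpole : ∀ z ∈ Icc 0 Real.pi, Real.sin z = 0 → ∀ θ ∈ Icc 0 (2 * Real.pi),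
      ∀ θ' ∈ Icc 0 (2 * Real.pi),
      s (z, θ) =ᶠ[𝓝 (φ (sphericalCoord (z, θ)))] s (z, θ') := by
    intro z hz hsin θ hθ θ' hθ'
    have hq : ∀ t, sphericalCoord (z, t) = sphericalCoord (z, θ') := fun t => by
      rw [sphericalCoord_eq_iff]; simp [hsin]
    have h1 := hs.comp (ι := fun t : ℝ => (z, t)) (by fun_prop)
      (A' := Icc 0 (2 * Real.pi)) (fun t ht => ⟨hz, ht⟩)
    have h2 : IsSheafSection Sol ((φ ∘ sphericalCoord) ∘ fun t : ℝ => (z, t))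
        (Icc 0 (2 * Real.pi)) (fun _ => s (z, θ')) := by
      refine ⟨fun t _ => ?_, fun t _ => Eventually.of_forall fun _ => EventuallyEq.rfl⟩
      have := hs.sol (z, θ') ⟨hz, hθ'⟩
      simpa only [Function.comp_apply, hq t] using this
    exact h1.eq_of_eq hS (hΦ.comp (by fun_prop)) isPreconnected_Icc h2 hθ' EventuallyEq.rfl θ hθ
  -- The edges `θ = 0` and `θ = 2π` have the same image, and the sections along them agree at the
  -- pole `z = 0`.
  have hseam : ∀ z ∈ Icc 0 Real.pi,
      s (z, 0) =ᶠ[𝓝 (φ (sphericalCoord (z, 0)))] s (z, 2 * Real.pi) := by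
    have h0 : (0 : ℝ) ∈ Icc 0 (2 * Real.pi) := ⟨le_rfl, by linarith⟩
    have h2 : 2 * Real.pi ∈ Icc 0 (2 * Real.pi) := ⟨by linarith, le_rfl⟩
    have hs1 := hs.comp (ι := fun z : ℝ => (z, (0 : ℝ))) (by fun_prop)
      (A' := Icc 0 Real.pi) (fun t ht => ⟨ht, h0⟩)
    have hs2 := hs.comp (ι := fun z : ℝ => (z, 2 * Real.pi)) (by fun_prop)
      (A' := Icc 0 Real.pi) (fun t ht => ⟨ht, h2⟩)
    have hq : (φ ∘ sphericalCoord) ∘ (fun z : ℝ => (z, 2 * Real.pi))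
        = (φ ∘ sphericalCoord) ∘ (fun z : ℝ => (z, (0 : ℝ))) := by
      funext z
      simp only [Function.comp_apply]
      congr 1
      rw [sphericalCoord_eq_iff]
      simp
    rw [hq] at hs2
    exact hs1.eq_of_eq hS (hΦ.comp (by fun_prop)) isPreconnected_Icc hs2 (w₀ := 0)
      ⟨le_rfl, hpi.le⟩ (hpole 0 ⟨le_rfl, hpi.le⟩ Real.sin_zero 0 h0 _ h2)
  have hfib : ∀ w ∈ A, ∀ w' ∈ A, sphericalCoord w = sphericalCoord w' →
      s w =ᶠ[𝓝 (φ (sphericalCoord w))] s w' := by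
    rintro ⟨z, θ⟩ ⟨hz, hθ⟩ ⟨z', θ'⟩ ⟨hz', hθ'⟩ heq
    have heq' := sphericalCoord_eq_iff.1 heq
    simp only at hz hθ hz' hθ' heq'
    obtain ⟨h1, h2, h3⟩ := heq'
    have hzz : z = z' := Real.injOn_cos hz hz' h3
    subst hzz
    by_cases hsin : Real.sin z = 0
    · exact hpole z hz hsin θ hθ θ' hθ'
    have hc : Real.cos θ = Real.cos θ' := mul_left_cancel₀ hsin h1
    have hs' : Real.sin θ = Real.sin θ' := mul_left_cancel₀ hsin h2
    have hang : (θ : Real.Angle) = θ' := Real.Angle.cos_sin_inj hc hs'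
    obtain ⟨k, hk⟩ := Real.Angle.angle_eq_iff_two_pi_dvd_sub.1 hang
    have hk1 : (k : ℝ) < 2 := by
      by_contra hcon; push Not at hcon; nlinarith [hθ.2, hθ'.1]
    have hk2 : (-2 : ℝ) < k := by
      by_contra hcon; push Not at hcon; nlinarith [hθ.1, hθ'.2]
    have hk1' : k < 2 := by exact_mod_cast hk1
    have hk2' : -2 < k := by exact_mod_cast hk2
    have hk3 : k = -1 ∨ k = 0 ∨ k = 1 := by omega
    rcases hk3 with rfl | rfl | rfl
    · have e1 : θ = 0 := by push_cast at hk; linarith [hθ.1, hθ'.2]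
      have e2 : θ' = 2 * Real.pi := by push_cast at hk; linarith [hθ.1, hθ'.2]
      rw [e1, e2]
      exact hseam z hz
    · have e1 : θ = θ' := by push_cast at hk; linarith
      rw [e1]
    · have e1 : θ' = 0 := by push_cast at hk; linarith [hθ.2, hθ'.1]
      have e2 : θ = 2 * Real.pi := by push_cast at hk; linarith [hθ.2, hθ'.1]
      rw [heq, e1, e2]
      exact (hseam z hz).symm
  -- The lift need not be continuous: germs agree on fibres by `hfib`, and
  -- `IsCompact.eventually_fiber` gives the local compatibility.
  choose lift hlift hql using exists_sphericalCoord
  refine ⟨fun x => s (lift x), fun x _ => ?_, fun x _ => ?_⟩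
  · have := hs.sol (lift x) (hlift x)
    rwa [Function.comp_apply, hql] at this
  · rw [nhdsWithin_univ]
    have hAc : IsCompact A := isCompact_Icc.prod isCompact_Icc
    have h := hAc.eventually_fiber continuous_sphericalCoord (x := x)
      (p := fun w => s w =ᶠ[𝓝 (φ (sphericalCoord w))] s (lift x)) (by
        intro w hw hqw
        have h1 := hfib w hw (lift x) (hlift x) (by rw [hqw, hql])
        have h2 : Tendsto (φ ∘ sphericalCoord) (𝓝[A] w) (𝓝 (φ (sphericalCoord w))) :=
          hΦ.continuousWithinAt.tendsto
        filter_upwards [hs.compat w hw,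
          h2.eventually (eventually_eventuallyEq_nhds.2 h1)] with w' h3 h4
        exact h3.trans h4)
    filter_upwards [h] with x' hx'
    have := hx' (lift x') (hlift x') (hql x')
    rwa [hql] at this

end Monodromy

end

/-! ### Time cones and smooth timelike fields -/

noncomputable section

namespace LorentzianMetric

variable {M : Type*} [TopologicalSpace M] [ChartedSpace E3 M] [IsManifold (𝓡 3) ∞ M]
  (g : LorentzianMetric M)

/-- Timelike vectors in the same time cone as `T` have negative scalar products. -/
theorem val_neg_of_timelike {x : M} {T v w : TangentSpace (𝓡 3) x} (hT : g.val x T T < 0)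
    (hv : g.val x v v < 0) (hvT : g.val x v T < 0) (hw : g.val x w w < 0)
    (hwT : g.val x w T < 0) : g.val x v w < 0 := by
  obtain ⟨b, hb⟩ := g.signature x
  rw [g.val_apply_basis hb] at *
  set t0 := b.repr T 0
  set t1 := b.repr T 1
  set t2 := b.repr T 2
  set v0 := b.repr v 0
  set v1 := b.repr v 1
  set v2 := b.repr v 2
  set w0 := b.repr w 0
  set w1 := b.repr w 1
  set w2 := b.repr w 2
  -- For timelike vectors the product of time components dominates that of the spatial parts, and so
  -- decides the sign of the scalar product.
  have cs : ∀ a0 a1 a2 c0 c1 c2 : ℝ, a0 * a0 + a1 * a1 - a2 * a2 < 0 →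
      c0 * c0 + c1 * c1 - c2 * c2 < 0 → |a0 * c0 + a1 * c1| < |a2 * c2| := by
    intro a0 a1 a2 c0 c1 c2 ha hc
    rw [← sq_lt_sq]
    have h1 : (a0 * c0 + a1 * c1) ^ 2 ≤ (a0 * a0 + a1 * a1) * (c0 * c0 + c1 * c1) := by
      nlinarith [sq_nonneg (a0 * c1 - a1 * c0)]
    have h2 : (a0 * a0 + a1 * a1) * (c0 * c0 + c1 * c1) < (a2 * a2) * (c2 * c2) :=
      mul_lt_mul'' (by linarith) (by linarith)
        (add_nonneg (mul_self_nonneg _) (mul_self_nonneg _))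
        (add_nonneg (mul_self_nonneg _) (mul_self_nonneg _))
    nlinarith
  have pos : ∀ a0 a1 a2 c0 c1 c2 : ℝ, a0 * a0 + a1 * a1 - a2 * a2 < 0 →
      c0 * c0 + c1 * c1 - c2 * c2 < 0 → a0 * c0 + a1 * c1 - a2 * c2 < 0 → 0 < a2 * c2 := by
    intro a0 a1 a2 c0 c1 c2 ha hc hac
    have h := cs a0 a1 a2 c0 c1 c2 ha hc
    by_contra hneg
    push Not at hneg
    rw [abs_of_nonpos hneg] at h
    linarith [neg_abs_le (a0 * c0 + a1 * c1)]
  have h1 := pos _ _ _ _ _ _ hv hT hvT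
  have h2 := pos _ _ _ _ _ _ hw hT hwT
  have h3 : 0 < v2 * w2 := by
    have h4 : 0 < (v2 * w2) * (t2 * t2) := by nlinarith [mul_pos h1 h2]
    exact pos_of_mul_pos_left h4 (mul_self_nonneg _)
  have h5 := cs _ _ _ _ _ _ hv hw
  rw [abs_of_pos h3] at h5
  linarith [le_abs_self (v0 * w0 + v1 * w1)]

/-- The cross term `2ab g(v,w)` is nonpositive for two vectors in the same cone. Convexity allows
gluing by a partition of unity. -/
theorem convex_timeCone {x : M} {T : TangentSpace (𝓡 3) x} (hT : g.val x T T < 0) :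
    Convex ℝ {v : TangentSpace (𝓡 3) x | g.val x v v < 0 ∧ g.val x v T < 0} := by
  rintro v ⟨hv, hvT⟩ w ⟨hw, hwT⟩ a b ha hb hab
  have hvw := g.val_neg_of_timelike hT hv hvT hw hwT
  have hwv : g.val x w v = g.val x v w := g.symm x w v
  simp only [mem_ofPred_eq, map_add, map_smul, add_apply, smul_apply, smul_eq_mul, hwv]
  rcases eq_or_lt_of_le ha with rfl | ha
  · have : b = 1 := by linarith
    subst this
    constructor <;> nlinarith
  · constructor
    · nlinarith [mul_pos ha ha, mul_neg_of_pos_of_neg (mul_pos ha ha) hv, mul_nonneg ha.le hb,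
        mul_nonneg hb hb, mul_nonneg (mul_nonneg ha.le hb) (neg_nonneg.2 hvw.le),
        mul_nonneg (mul_nonneg hb hb) (neg_nonneg.2 hw.le)]
    · nlinarith [mul_neg_of_pos_of_neg ha hvT, mul_nonneg hb (neg_nonneg.2 hwT.le)]

/-- The vector field on the domain of the chart `e` with constant coordinates `u`. -/
def coordField (e : OpenPartialHomeomorph M E3) (u : E3) (m : M) : TangentSpace (𝓡 3) m :=
  (mfderiv (𝓡 3) (𝓡 3) e.symm (e m) u : E3)

theorem contMDiffOn_coordField' {e : OpenPartialHomeomorph M E3} (he : e ∈ atlas E3 M) (u : E3) :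
    ContMDiffOn (𝓡 3) (𝓡 3).tangent ∞
      (fun m => (⟨m, coordField e u m⟩ : TangentBundle (𝓡 3) M)) e.source := by
  refine ((contMDiffOn_coordField he u).comp (contMDiffOn_atlas_chart he)
    (fun m hm => e.map_source hm)).congr fun m hm => ?_
  simp only [Function.comp_apply, coordField]
  have : ∀ p, p = m → (⟨m, (mfderiv (𝓡 3) (𝓡 3) e.symm (e m) u : E3)⟩ : TangentBundle (𝓡 3) M)
      = ⟨p, (mfderiv (𝓡 3) (𝓡 3) e.symm (e m) u : E3)⟩ := by
    rintro p rfl; rfl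
  exact this _ (e.left_inv hm)

theorem exists_coordField_eq {e : OpenPartialHomeomorph M E3} (he : e ∈ atlas E3 M) {m : M}
    (hm : m ∈ e.source) (v : TangentSpace (𝓡 3) m) : ∃ u, coordField e u m = v :=
  (mdifferentiable_of_mem_atlas (I := 𝓡 3) he).symm.mfderiv_surjective
    (x := e m) (e.map_source hm) (v : E3)

theorem continuousWithinAt_val {T S : ∀ x : M, TangentSpace (𝓡 3) x} {s : Set M} {x : M}
    (hT : ContinuousWithinAt (fun x => (⟨x, T x⟩ : TangentBundle (𝓡 3) M)) s x)
    (hS : ContinuousWithinAt (fun x => (⟨x, S x⟩ : TangentBundle (𝓡 3) M)) s x) :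
    ContinuousWithinAt (fun x => g.val x (T x) (S x)) s x := by
  have : ContinuousWithinAt (fun x => TotalSpace.mk' ℝ (E := Bundle.Trivial M ℝ) x
      (g.val x (T x) (S x))) s x := by
    apply ContinuousWithinAt.clm_bundle_apply₂ (F₁ := E3) (F₂ := E3)
    · exact g.contMDiff.continuous.continuousWithinAt
    · exact hT
    · exact hS
  exact ((Bundle.Trivial.homeomorphProd M ℝ).continuous.snd.continuousAt).comp_continuousWithinAt
    this

/-- On a time-orientable Lorentzian manifold there is a smooth timelike vector field, orthogonal
at `p` to a given spacelike vector. -/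
theorem exists_smooth_timelike_field [T2Space M] [SecondCountableTopology M]
    (ho : g.IsTimeOrientable) (p : M) {Z : E3}
    (hZ : 0 < (g.val p : E3 →L[ℝ] E3 →L[ℝ] ℝ) Z Z) :
    ∃ T : ∀ x : M, TangentSpace (𝓡 3) x,
      ContMDiff (𝓡 3) (𝓡 3).tangent ∞ (fun x => (⟨x, T x⟩ : TangentBundle (𝓡 3) M)) ∧
      (∀ x, g.IsTimelike (T x)) ∧ (g.val p : E3 →L[ℝ] E3 →L[ℝ] ℝ) (T p) Z = 0 := by
  obtain ⟨T₀, hT₀c, hT₀⟩ := ho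
  have : LocallyCompactSpace M := ChartedSpace.locallyCompactSpace E3 M
  obtain ⟨S, hS⟩ := exists_contMDiffSection_forall_mem_convex_of_local (𝓡 3) (n := ⊤)
    (F_fiber := E3) (fun x : M => TangentSpace (𝓡 3) x)
    (fun x => {v | g.val x v v < 0 ∧ g.val x v (T₀ x) < 0} ∩
      {v | x = p → (g.val x : E3 →L[ℝ] E3 →L[ℝ] ℝ) v Z = 0})
    (fun x => (g.convex_timeCone (hT₀ x)).inter (by
      rintro v hv w hw a b - - - hx
      have h1 : ∀ (B : E3 →L[ℝ] E3 →L[ℝ] ℝ) (v w : E3), B v Z = 0 → B w Z = 0 →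
          B (a • v + b • w) Z = 0 := by
        intro B v w hv hw
        simp only [map_add, map_smul, add_apply, smul_apply, smul_eq_mul, hv, hw]
        ring
      exact h1 (g.val x) v w (hv hx) (hw hx)))
    (fun x₀ => by
      have hv : ∃ v : TangentSpace (𝓡 3) x₀, (g.val x₀ v v < 0 ∧ g.val x₀ v (T₀ x₀) < 0) ∧
          (x₀ = p → (g.val x₀ : E3 →L[ℝ] E3 →L[ℝ] ℝ) v Z = 0) := by
        by_cases hx : x₀ = p
        · subst hx
          let Z' : TangentSpace (𝓡 3) x₀ := Z
          have hZ' : 0 < g.val x₀ Z' Z' := hZ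
          have hTT : g.val x₀ (T₀ x₀) (T₀ x₀) < 0 := hT₀ x₀
          have hs : g.val x₀ Z' (T₀ x₀) = g.val x₀ (T₀ x₀) Z' := g.symm _ _ _
          -- Removing the component of `T₀` along the spacelike `Z'` can only lower its square and
          -- its product with `T₀`.
          refine ⟨T₀ x₀ - (g.val x₀ (T₀ x₀) Z' / g.val x₀ Z' Z') • Z', ?_, fun _ => ?_⟩
          · simp only [map_sub, map_smul, sub_apply, smul_apply, smul_eq_mul, hs]
            have h1 : 0 ≤ g.val x₀ (T₀ x₀) Z' / g.val x₀ Z' Z' * g.val x₀ (T₀ x₀) Z' := by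
              rw [div_mul_eq_mul_div]
              exact div_nonneg (mul_self_nonneg _) hZ'.le
            have h2 : g.val x₀ (T₀ x₀) Z' / g.val x₀ Z' Z' * g.val x₀ Z' Z'
                = g.val x₀ (T₀ x₀) Z' := div_mul_cancel₀ _ hZ'.ne'
            rw [h2]
            constructor <;> linarith
          · change g.val x₀ (T₀ x₀ - (g.val x₀ (T₀ x₀) Z' / g.val x₀ Z' Z') • Z') Z' = 0
            simp only [map_sub, map_smul, sub_apply, smul_apply, smul_eq_mul]
            rw [div_mul_cancel₀ _ hZ'.ne', sub_self]
        · exact ⟨T₀ x₀, ⟨hT₀ x₀, hT₀ x₀⟩, fun h => absurd h hx⟩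
      obtain ⟨v, ⟨hv1, hv2⟩, hv3⟩ := hv
      have he := chart_mem_atlas E3 x₀
      set e := chartAt E3 x₀
      have hx₀ : x₀ ∈ e.source := mem_chart_source E3 x₀
      obtain ⟨u, hu⟩ := exists_coordField_eq he hx₀ v
      have hsm := contMDiffOn_coordField' he u
      have hnhds : 𝓝[e.source] x₀ = 𝓝 x₀ := e.open_source.nhdsWithin_eq hx₀
      have hc1 := g.continuousWithinAt_val (hsm.continuousOn x₀ hx₀) (hsm.continuousOn x₀ hx₀)
      have hc2 := g.continuousWithinAt_val (hsm.continuousOn x₀ hx₀) hT₀c.continuousWithinAt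
      have h1 : ∀ᶠ y in 𝓝[e.source] x₀, g.val y (coordField e u y) (coordField e u y) < 0 :=
        hc1.eventually (gt_mem_nhds (by simpa only [hu] using hv1))
      have h2 : ∀ᶠ y in 𝓝[e.source] x₀, g.val y (coordField e u y) (T₀ y) < 0 :=
        hc2.eventually (gt_mem_nhds (by simpa only [hu] using hv2))
      have h3 : ∀ᶠ y in 𝓝[e.source] x₀,
          y = p → (g.val y : E3 →L[ℝ] E3 →L[ℝ] ℝ) (coordField e u y) Z = 0 := by
        by_cases hx : x₀ = p
        · refine Eventually.of_forall fun y hy => ?_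
          have hyx : y = x₀ := hy.trans hx.symm
          subst hyx
          rw [hu]; exact hv3 hx
        -- Away from `p` the orthogonality constraint is vacuous on a neighbourhood that avoids `p`.
        · rw [hnhds]
          filter_upwards [isOpen_ne.mem_nhds hx] with y hy h using absurd h hy
      rw [hnhds] at h1 h2 h3
      refine ⟨_, inter_mem (e.open_source.mem_nhds hx₀) (h1.and (h2.and h3)),
        fun m => coordField e u m, hsm.mono inter_subset_left, fun y hy => ⟨⟨hy.2.1, hy.2.2.1⟩,
          hy.2.2.2⟩⟩)
  exact ⟨fun x => S x, S.contMDiff, fun x => (hS x).1.1, (hS p).2 rfl⟩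

end LorentzianMetric

end

/-! ### Maximal integral curves and their ends -/

noncomputable section

section IntegralCurves

variable {M : Type*} [TopologicalSpace M] [ChartedSpace E3 M] [IsManifold (𝓡 3) ∞ M]
  {e : OpenPartialHomeomorph M E3} {T : ∀ x : M, TangentSpace (𝓡 3) x} {γ : ℝ → M} {t : ℝ}

/-- The components of the vector field `T` in the chart `e`. -/
def chartComponents (e : OpenPartialHomeomorph M E3) (T : ∀ x : M, TangentSpace (𝓡 3) x) (m : M) :
    E3 :=
  mfderiv (𝓡 3) (𝓡 3) e m (T m)

theorem continuousOn_chartComponents (he : e ∈ atlas E3 M)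
    (hT : Continuous (fun x => (⟨x, T x⟩ : TangentBundle (𝓡 3) M))) :
    ContinuousOn (chartComponents e T) e.source := by
  have h1 := (contMDiffOn_atlas_chart he).continuousOn_tangentMapWithin (by simp)
    e.open_source.uniqueMDiffOn
  have h2 := h1.comp (s := e.source) hT.continuousOn (fun m hm => hm)
  have h3 := (contMDiff_snd_tangentBundle_modelSpace (I := 𝓡 3) (n := 0) (E := E3)
    (H := E3)).continuous.comp_continuousOn h2
  refine h3.congr fun m hm => ?_
  exact congrArg (fun L : E3 →L[ℝ] E3 => L (T m))
    (mfderivWithin_of_isOpen (I := 𝓡 3) (I' := 𝓡 3) (f := e) e.open_source hm).symm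

theorem mfderiv_symm_chartComponents (he : e ∈ atlas E3 M) {m : M} (hm : m ∈ e.source) :
    (mfderiv (𝓡 3) (𝓡 3) e.symm (e m) (chartComponents e T m) : E3) = T m :=
  congrArg (fun L : E3 →L[ℝ] E3 => L (T m))
    ((mdifferentiable_of_mem_atlas (I := 𝓡 3) he).symm_comp_deriv hm)

theorem chartComponents_ne_zero (he : e ∈ atlas E3 M) {m : M} (hm : m ∈ e.source)
    (hT : T m ≠ 0) : chartComponents e T m ≠ 0 := by
  intro h
  apply hT
  have h1 := mfderiv_symm_chartComponents (T := T) he hm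
  rw [h] at h1
  exact h1.symm.trans (map_zero (mfderiv (𝓡 3) (𝓡 3) e.symm (e m)))

theorem hasDerivAt_chart_comp (he : e ∈ atlas E3 M)
    (hγ : HasMFDerivAt 𝓘(ℝ, ℝ) (𝓡 3) γ t ((1 : ℝ →L[ℝ] ℝ).smulRight (T (γ t))))
    (hm : γ t ∈ e.source) : HasDerivAt (e ∘ γ) (chartComponents e T (γ t)) t := by
  have h1 := ((mdifferentiable_of_mem_atlas (I := 𝓡 3) he).mdifferentiableAt hm).hasMFDerivAt.comp t
    hγ
  let L : ℝ →L[ℝ] E3 := (mfderiv (𝓡 3) (𝓡 3) e (γ t) : E3 →L[ℝ] E3).comp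
    ((1 : ℝ →L[ℝ] ℝ).smulRight (T (γ t) : E3))
  have h2 : HasFDerivAt (e ∘ γ) L t := hasMFDerivAt_iff_hasFDerivAt.1 h1
  have h3 : L 1 = chartComponents e T (γ t) :=
    congrArg (mfderiv (𝓡 3) (𝓡 3) e (γ t) : E3 →L[ℝ] E3) (one_smul ℝ (T (γ t) : E3))
  exact h3 ▸ h2.hasDerivAt

theorem hasMFDerivAt_of_chart_comp (he : e ∈ atlas E3 M) (hc : ContinuousAt γ t)
    (hm : γ t ∈ e.source) (h : HasDerivAt (e ∘ γ) (chartComponents e T (γ t)) t) :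
    HasMFDerivAt 𝓘(ℝ, ℝ) (𝓡 3) γ t ((1 : ℝ →L[ℝ] ℝ).smulRight (T (γ t))) := by
  have h1 := ((mdifferentiable_of_mem_atlas (I := 𝓡 3) he).mdifferentiableAt_symm
    (e.map_source hm)).hasMFDerivAt
  have h2 : HasMFDerivAt 𝓘(ℝ, ℝ) (𝓡 3) (e ∘ γ) t _ :=
    hasMFDerivAt_iff_hasFDerivAt.2 h.hasFDerivAt
  have h3 := (h1.comp t h2).congr_of_eventuallyEq (f₁ := γ) (by
    filter_upwards [hc.eventually (e.open_source.mem_nhds hm)] with s hs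
    simp only [Function.comp_apply, e.left_inv hs])
  have hL : ((mfderiv (𝓡 3) (𝓡 3) e.symm (e (γ t)) : E3 →L[ℝ] E3).comp
      (ContinuousLinearMap.toSpanSingleton ℝ (chartComponents e T (γ t))) : ℝ →L[ℝ] E3)
      = (1 : ℝ →L[ℝ] ℝ).smulRight (T (γ t) : E3) := by
    have aux : ∀ (A : E3 →L[ℝ] E3) (v w : E3), A v = w →
        A.comp (ContinuousLinearMap.toSpanSingleton ℝ v) = (1 : ℝ →L[ℝ] ℝ).smulRight w := by
      rintro A v _ rfl
      ext1
      simp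
    exact aux _ _ _ (mfderiv_symm_chartComponents he hm)
  exact h3.congr_mfderiv hL

theorem IsMIntegralCurveOn.curveVelocity_eq {M : Type*} [TopologicalSpace M] [ChartedSpace E3 M]
    {T : ∀ x : M, TangentSpace (𝓡 3) x} {γ : ℝ → M} {t : ℝ} {J : Set ℝ}
    (hγ : IsMIntegralCurveOn γ T J) (hJ : IsOpen J) (ht : t ∈ J) : curveVelocity γ t = T (γ t) := by
  have h := (hγ t ht).hasMFDerivAt (hJ.mem_nhds ht)
  rw [curveVelocity, h.mfderiv]
  exact one_smul ℝ (T (γ t))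

theorem contMDiffAt_of_chart_comp (he : e ∈ atlas E3 M) (hc : ContinuousAt γ t)
    (hm : γ t ∈ e.source) (h : ContDiffAt ℝ 1 (e ∘ γ) t) :
    ContMDiffAt 𝓘(ℝ, ℝ) (𝓡 3) 1 γ t := by
  have h1 : ContMDiffAt (𝓡 3) (𝓡 3) 1 e.symm ((e ∘ γ) t) :=
    ((contMDiffOn_atlas_symm he).contMDiffAt (e.open_target.mem_nhds (e.map_source hm))).of_le
      ENat.LEInfty.out
  refine (h1.comp t h.contMDiffAt).congr_of_eventuallyEq ?_
  filter_upwards [hc.eventually (e.open_source.mem_nhds hm)] with s hs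
  simp only [Function.comp_apply, e.left_inv hs]

theorem IsMIntegralCurveOn.contMDiffOn {J : Set ℝ} (hγ : IsMIntegralCurveOn γ T J)
    (hJ : IsOpen J) (hT : Continuous (fun x => (⟨x, T x⟩ : TangentBundle (𝓡 3) M))) :
    ContMDiffOn 𝓘(ℝ, ℝ) (𝓡 3) 1 γ J := by
  intro t ht
  have hd : ∀ s ∈ J, HasMFDerivAt 𝓘(ℝ, ℝ) (𝓡 3) γ s ((1 : ℝ →L[ℝ] ℝ).smulRight (T (γ s))) :=
    fun s hs => (hγ s hs).hasMFDerivAt (hJ.mem_nhds hs)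
  have he := chart_mem_atlas E3 (γ t)
  set e := chartAt E3 (γ t)
  have hm : γ t ∈ e.source := mem_chart_source E3 (γ t)
  have hc := (hd t ht).continuousAt
  refine (contMDiffAt_of_chart_comp he hc hm ?_).contMDiffWithinAt
  rw [contDiffAt_one_iff]
  refine ⟨fun s => (1 : ℝ →L[ℝ] ℝ).smulRight (chartComponents e T (γ s)), J ∩ γ ⁻¹' e.source,
    inter_mem (hJ.mem_nhds ht) (hc.preimage_mem_nhds (e.open_source.mem_nhds hm)), ?_, ?_⟩
  · have h1 : ContinuousOn (fun s => chartComponents e T (γ s)) (J ∩ γ ⁻¹' e.source) :=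
      (continuousOn_chartComponents he hT).comp
        (fun s hs => (hd s hs.1).continuousAt.continuousWithinAt) (fun s hs => hs.2)
    exact ContinuousOn.clm_apply (f := fun _ => ContinuousLinearMap.smulRightL ℝ ℝ E3 1)
      continuousOn_const h1
  · intro s hs
    exact (hasDerivAt_chart_comp he (hd s hs.1) hs.2).hasFDerivAt

/-- `γ` is the maximal integral curve of `T` with its value at time `0`, and `J` is its domain. -/
structure IsMaximalIntegralCurve (γ : ℝ → M) (T : ∀ x : M, TangentSpace (𝓡 3) x) (J : Set ℝ) :
    Prop where
  zero_mem : (0 : ℝ) ∈ J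
  isOpen : IsOpen J
  ordConnected : J.OrdConnected
  isMIntegralCurveOn : IsMIntegralCurveOn γ T J
  maximal : ∀ a b : ℝ, a < 0 → 0 < b → ∀ η : ℝ → M, η 0 = γ 0 →
    IsMIntegralCurveOn η T (Ioo a b) → Ioo a b ⊆ J

theorem exists_isMaximalIntegralCurve [T2Space M]
    (hT : ContMDiff (𝓡 3) (𝓡 3).tangent 1 (fun x => (⟨x, T x⟩ : TangentBundle (𝓡 3) M))) (q : M) :
    ∃ (γ : ℝ → M) (J : Set ℝ), γ 0 = q ∧ IsMaximalIntegralCurve γ T J := by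
  let P : ℝ × ℝ → (ℝ → M) → Prop := fun I η => I.1 < 0 ∧ 0 < I.2 ∧ η 0 = q ∧
    IsMIntegralCurveOn η T (Ioo I.1 I.2)
  let J : Set ℝ := {t | ∃ I η, P I η ∧ t ∈ Ioo I.1 I.2}
  -- For each time choose any integral curve reaching it. By uniqueness the diagonal `η t t` does
  -- not depend on the choices.
  have hchoice : ∀ t : ℝ, ∃ η : ℝ → M, t ∈ J → ∃ I, P I η ∧ t ∈ Ioo I.1 I.2 := by
    intro t
    by_cases ht : t ∈ J
    · obtain ⟨I, η, h1, h2⟩ := ht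
      exact ⟨η, fun _ => ⟨I, h1, h2⟩⟩
    · exact ⟨fun _ => q, fun h => absurd h ht⟩
  choose η hη using hchoice
  have hagree : ∀ I I' ζ ζ', P I ζ → P I' ζ' → ∀ t ∈ Ioo I.1 I.2, t ∈ Ioo I'.1 I'.2 →
      ζ t = ζ' t := by
    rintro I I' ζ ζ' ⟨h1, h2, h3, h4⟩ ⟨h1', h2', h3', h4'⟩ t ht ht'
    have hsub : ∀ x, x ∈ Ioo (max I.1 I'.1) (min I.2 I'.2) ↔
        x ∈ Ioo I.1 I.2 ∧ x ∈ Ioo I'.1 I'.2 := by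
      intro x; simp only [mem_Ioo, max_lt_iff, lt_min_iff]; tauto
    exact isMIntegralCurveOn_Ioo_eqOn_of_contMDiff_boundaryless (I := 𝓡 3) (t₀ := 0)
      ((hsub 0).2 ⟨⟨h1, h2⟩, h1', h2'⟩) hT (h4.mono fun x hx => ((hsub x).1 hx).1)
      (h4'.mono fun x hx => ((hsub x).1 hx).2) (h3.trans h3'.symm) ((hsub t).2 ⟨ht, ht'⟩)
  have hJsub : ∀ I ζ, P I ζ → Ioo I.1 I.2 ⊆ J := fun I ζ h t ht => ⟨I, ζ, h, ht⟩
  have hval : ∀ I ζ, P I ζ → ∀ t ∈ Ioo I.1 I.2, η t t = ζ t := by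
    intro I ζ h t ht
    obtain ⟨I', h1, h2⟩ := hη t (hJsub I ζ h ht)
    exact hagree _ _ _ _ h1 h t h2 ht
  have hJ0 : (0 : ℝ) ∈ J := by
    obtain ⟨ζ, hζ0, hζ⟩ := exists_isMIntegralCurveAt_of_contMDiffAt_boundaryless (I := 𝓡 3) 0
      (hT.contMDiffAt (x := q))
    obtain ⟨ε, hε, h⟩ := isMIntegralCurveAt_iff'.1 hζ
    rw [Real.ball_eq_Ioo] at h
    exact ⟨(0 - ε, 0 + ε), ζ, ⟨by simpa, by simpa, hζ0, h⟩,
      by constructor <;> simp only <;> linarith⟩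
  have hη0 : η 0 0 = q := by
    obtain ⟨I', h1, -⟩ := hη 0 hJ0
    exact h1.2.2.1
  refine ⟨fun t => η t t, J, hη0, hJ0, ?_, ?_, ?_, ?_⟩
  · rw [isOpen_iff_mem_nhds]
    rintro t ⟨I, ζ, h, ht⟩
    exact mem_of_superset (Ioo_mem_nhds ht.1 ht.2) (hJsub I ζ h)
  · refine ordConnected_of_Ioo fun s hs t ht hst x hx => ?_
    obtain ⟨I, ζ, h, hsI⟩ := hs
    obtain ⟨I', ζ', h', htI⟩ := ht
    rcases le_or_gt x 0 with h0 | h0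
    · exact hJsub I ζ h ⟨hsI.1.trans hx.1, h0.trans_lt h.2.1⟩
    · exact hJsub I' ζ' h' ⟨h'.1.trans h0, hx.2.trans htI.2⟩
  · rintro t ⟨I, ζ, h, ht⟩
    have h1 := (h.2.2.2 t ht).hasMFDerivAt (Ioo_mem_nhds ht.1 ht.2)
    have h2 : (fun t => η t t) =ᶠ[𝓝 t] ζ := by
      filter_upwards [Ioo_mem_nhds ht.1 ht.2] with s hs using hval I ζ h s hs
    have h3 := h1.congr_of_eventuallyEq h2
    rw [← hval I ζ h t ht] at h3
    exact h3.hasMFDerivWithinAt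
  · intro a b ha hb ζ hζ0 hζ
    exact hJsub (a, b) ζ ⟨ha, hb, hζ0.trans hη0, hζ⟩

/-- Time reversal reduces the lower end of a curve to the upper end. -/
theorem IsMaximalIntegralCurve.reverse {M : Type*} [TopologicalSpace M] [ChartedSpace E3 M]
    {T : ∀ x : M, TangentSpace (𝓡 3) x} {γ : ℝ → M} {J : Set ℝ} (h : IsMaximalIntegralCurve γ T J) :
    IsMaximalIntegralCurve (fun t => γ (-t)) (fun x => -T x) (Neg.neg ⁻¹' J) := by
  have key : ∀ (ζ : ℝ → M) (S : ∀ x : M, TangentSpace (𝓡 3) x) (K : Set ℝ),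
      IsMIntegralCurveOn ζ S K →
      IsMIntegralCurveOn (fun t => ζ (-t)) (fun x => -S x) (Neg.neg ⁻¹' K) := by
    intro ζ S K hζ
    have := hζ.comp_mul (-1)
    simp only [mul_neg, mul_one, neg_smul, one_smul, Function.comp_def] at this
    exact this
  refine ⟨by simpa using h.zero_mem, h.isOpen.preimage continuous_neg, ?_, key _ _ _
    h.isMIntegralCurveOn, ?_⟩
  · refine ⟨fun x hx y hy z hz => ?_⟩
    exact h.ordConnected.out hy hx ⟨neg_le_neg hz.2, neg_le_neg hz.1⟩
  · intro a b ha hb ζ hζ0 hζ t ht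
    have h1 := key _ _ _ hζ
    simp only [neg_neg] at h1
    refine h.maximal (-b) (-a) (by linarith) (by linarith) (fun t => ζ (-t)) (by simpa using hζ0)
      (h1.mono fun s hs => ?_) ⟨by linarith [ht.2], by linarith [ht.1]⟩
    exact ⟨by linarith [hs.2], by linarith [hs.1]⟩

/-- A maximal integral curve of a non-vanishing field has no limit at its upper end. -/
theorem IsMaximalIntegralCurve.not_tendsto_top {J : Set ℝ} (h : IsMaximalIntegralCurve γ T J)
    (hT : ContMDiff (𝓡 3) (𝓡 3).tangent 1 (fun x => (⟨x, T x⟩ : TangentBundle (𝓡 3) M)))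
    (hT0 : ∀ x, T x ≠ 0) (x : M) : ¬ ∀ U ∈ 𝓝 x, ∃ t₀ ∈ J, ∀ t ∈ J, t₀ ≤ t → γ t ∈ U := by
  intro hlim
  have hd : ∀ s ∈ J, HasMFDerivAt 𝓘(ℝ, ℝ) (𝓡 3) γ s ((1 : ℝ →L[ℝ] ℝ).smulRight (T (γ s))) :=
    fun s hs => (h.isMIntegralCurveOn s hs).hasMFDerivAt (h.isOpen.mem_nhds hs)
  have he := chart_mem_atlas E3 x
  set e := chartAt E3 x
  have hx : x ∈ e.source := mem_chart_source E3 x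
  have hsrc : e.source ∈ 𝓝 x := e.open_source.mem_nhds hx
  set ν := chartComponents e T x
  have hν : ν ≠ 0 := chartComponents_ne_zero he hx (hT0 x)
  have hVc : ContinuousAt (chartComponents e T) x :=
    (continuousOn_chartComponents he hT.continuous).continuousAt hsrc
  by_cases hb : BddAbove J
  · set b := sSup J with hbdef
    have hbJ : b ∉ J := by
      intro hbJ
      obtain ⟨ε, hε, hball⟩ := Metric.isOpen_iff.1 h.isOpen b hbJ
      have := le_csSup hb (hball (show b + ε / 2 ∈ Metric.ball b ε by
        rw [Metric.mem_ball, Real.dist_eq, add_sub_cancel_left, abs_of_pos (by linarith)]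
        linarith))
      linarith
    have hlt : ∀ t ∈ J, t < b := fun t ht => lt_of_le_of_ne (le_csSup hb ht) fun h => hbJ (h ▸ ht)
    have hIco : ∀ t ∈ J, ∀ s, t ≤ s → s < b → s ∈ J := by
      intro t ht s hts hsb
      obtain ⟨r, hr, hsr⟩ := exists_lt_of_lt_csSup ⟨t, ht⟩ hsb
      exact h.ordConnected.out ht hr ⟨hts, hsr.le⟩
    have hlimb : Tendsto γ (𝓝[<] b) (𝓝 x) := by
      intro U hU
      obtain ⟨t₀, ht₀, h1⟩ := hlim U hU
      rw [mem_map]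
      filter_upwards [Ioo_mem_nhdsLT (hlt t₀ ht₀)] with s hs
      exact h1 s (hIco t₀ ht₀ s hs.1.le hs.2) hs.1.le
    have hJb : ∀ᶠ s in 𝓝[<] b, s ∈ J := by
      filter_upwards [Ioo_mem_nhdsLT (hlt 0 h.zero_mem)] with s hs
      exact hIco 0 h.zero_mem s hs.1.le hs.2
    obtain ⟨η, hηb, hη⟩ := exists_isMIntegralCurveAt_of_contMDiffAt_boundaryless (I := 𝓡 3) b
      (hT.contMDiffAt (x := x))
    obtain ⟨ε, hε, hη⟩ := isMIntegralCurveAt_iff'.1 hη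
    have hηd : ∀ s ∈ Metric.ball b ε,
        HasMFDerivAt 𝓘(ℝ, ℝ) (𝓡 3) η s ((1 : ℝ →L[ℝ] ℝ).smulRight (T (η s))) :=
      fun s hs => (hη s hs).hasMFDerivAt (Metric.isOpen_ball.mem_nhds hs)
    have hηb' := hηd b (Metric.mem_ball_self hε)
    -- If the domain ends at a finite `b`, the limit point lets `γ` be continued by the integral
    -- curve through `x`, against maximality.
    let ζ : ℝ → M := fun t => if t < b then γ t else η t
    have hζb : ζ b = x := by simp [ζ, hηb]
    have hζlt : ∀ t < b, ζ t = γ t := fun t ht => if_pos ht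
    have hζge : ∀ t, b ≤ t → ζ t = η t := fun t ht => if_neg (not_lt.2 ht)
    have hζγ : ζ =ᶠ[𝓝[<] b] γ := by
      filter_upwards [self_mem_nhdsWithin] with s hs using hζlt s hs
    have hζcl : Tendsto ζ (𝓝[<] b) (𝓝 (ζ b)) := by
      rw [hζb]; exact hlimb.congr' hζγ.symm
    have hζcr : Tendsto ζ (𝓝[≥] b) (𝓝 (ζ b)) := by
      rw [hζb, ← hηb]
      refine (hηb'.continuousAt.tendsto.mono_left nhdsWithin_le_nhds).congr' ?_
      filter_upwards [self_mem_nhdsWithin] with s hs using (hζge s hs).symm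
    have hζc : ContinuousAt ζ b := by
      rw [ContinuousAt, ← nhdsLT_sup_nhdsGE]
      exact hζcl.sup hζcr
    have hder : HasDerivAt (e ∘ ζ) ν b := by
      have hsrcb : ∀ᶠ s in 𝓝[<] b, γ s ∈ e.source := hlimb.eventually hsrc
      have hleft : HasDerivWithinAt (e ∘ ζ) ν (Iic b) b := by
        obtain ⟨a, hab, ha⟩ := (mem_nhdsLT_iff_exists_Ioo_subset).1 (hJb.and hsrcb)
        have hloc : ∀ s ∈ Ioo a b, HasDerivAt (e ∘ ζ) (chartComponents e T (γ s)) s := by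
          intro s hs
          refine (hasDerivAt_chart_comp he (hd s (ha hs).1) (ha hs).2).congr_of_eventuallyEq ?_
          filter_upwards [Iio_mem_nhds hs.2] with r hr
          simp only [Function.comp_apply, hζlt r hr]
        -- At the junction the left derivative exists because the derivatives from the left converge
        -- to `ν`.
        refine hasDerivWithinAt_Iic_of_tendsto_deriv (s := Ioo a b)
          (fun s hs => (hloc s hs).differentiableAt.differentiableWithinAt) ?_
          (Ioo_mem_nhdsLT hab) ?_
        · refine ContinuousAt.continuousWithinAt ?_
          exact (e.continuousAt (by rwa [hζb])).comp hζc
        · refine (hVc.tendsto.comp hlimb).congr' ?_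
          filter_upwards [Ioo_mem_nhdsLT hab] with s hs
          rw [(hloc s hs).deriv, Function.comp_apply]
      have hright : HasDerivWithinAt (e ∘ ζ) ν (Ici b) b := by
        have h1 := hasDerivAt_chart_comp he hηb' (by rwa [hηb])
        rw [hηb] at h1
        refine h1.hasDerivWithinAt.congr (fun s hs => ?_) ?_
        · simp only [Function.comp_apply, hζge s hs]
        · simp only [Function.comp_apply, hζge b le_rfl]
      have := hleft.union hright
      rwa [Iic_union_Ici, hasDerivWithinAt_univ] at this
    obtain ⟨a, ha0, haJ⟩ : ∃ a < 0, a ∈ J := by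
      obtain ⟨ε', hε', hball⟩ := Metric.isOpen_iff.1 h.isOpen 0 h.zero_mem
      exact ⟨-(ε' / 2), by linarith, hball (by
        rw [Metric.mem_ball, Real.dist_eq, sub_zero, abs_neg, abs_of_pos (by linarith)]
        linarith)⟩
    have hζint : IsMIntegralCurveOn ζ T (Ioo a (b + ε)) := by
      intro t ht
      refine HasMFDerivAt.hasMFDerivWithinAt ?_
      rcases lt_trichotomy t b with htb | rfl | htb
      · have h1 := (hd t (hIco a haJ t ht.1.le htb)).congr_of_eventuallyEq (f₁ := ζ) (by
          filter_upwards [Iio_mem_nhds htb] with r hr using hζlt r hr)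
        rwa [← hζlt t htb] at h1
      · refine hasMFDerivAt_of_chart_comp he hζc (by rwa [hζb]) ?_
        rw [hζb]; exact hder
      · have h1 := (hηd t (by
          rw [Metric.mem_ball, Real.dist_eq, abs_of_pos (by linarith)]
          linarith [ht.2])).congr_of_eventuallyEq (f₁ := ζ) (by
          filter_upwards [Ioi_mem_nhds htb] with r hr using hζge r (le_of_lt hr))
        rwa [← hζge t htb.le] at h1
    have h0b := hlt 0 h.zero_mem
    have := h.maximal a (b + ε) ha0 (by linarith) ζ (hζlt 0 h0b) hζint
      (show b + ε / 2 ∈ Ioo a (b + ε) from ⟨by linarith, by linarith⟩)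
    linarith [hlt _ this]
  -- With unbounded domain, the chart velocity is eventually within `‖ν‖/2` of `ν ≠ 0`, so the curve
  -- moves at least `‖ν‖/2` in unit time. Yet both endpoints are within `‖ν‖/4` of the limit,
  -- strictly.
  · have hIci : ∀ t ∈ J, ∀ s, t ≤ s → s ∈ J := by
      intro t ht s hts
      rw [not_bddAbove_iff] at hb
      obtain ⟨r, hr, hsr⟩ := hb s
      exact h.ordConnected.out ht hr ⟨hts, hsr.le⟩
    have hν' : 0 < ‖ν‖ := norm_pos_iff.2 hν
    have hU : ∀ᶠ m in 𝓝 x, m ∈ e.source ∧ ‖chartComponents e T m - ν‖ < ‖ν‖ / 2 ∧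
        ‖e m - e x‖ < ‖ν‖ / 4 := by
      refine (eventually_mem_set.2 hsrc).and (Eventually.and ?_ ?_)
      · have := hVc.eventually (Metric.ball_mem_nhds _ (half_pos hν'))
        simpa [dist_eq_norm] using this
      · have := (e.continuousAt hx).eventually
          (Metric.ball_mem_nhds _ (by positivity : 0 < ‖ν‖ / 4))
        simpa [dist_eq_norm] using this
    obtain ⟨t₀, ht₀, hγU⟩ := hlim _ hU
    have hJt : ∀ s, t₀ ≤ s → s ∈ J := hIci t₀ ht₀
    have hmv := norm_image_sub_le_of_norm_deriv_le_segment' (a := t₀) (b := t₀ + 1)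
      (f := fun t => (e ∘ γ) t - t • ν) (f' := fun t => chartComponents e T (γ t) - (1 : ℝ) • ν)
      (C := ‖ν‖ / 2)
      (fun s hs => ((hasDerivAt_chart_comp he (hd s (hJt s hs.1)) (hγU s (hJt s hs.1) hs.1).1).sub
        ((hasDerivAt_id s).smul_const ν)).hasDerivWithinAt)
      (fun s hs => by rw [one_smul]; exact (hγU s (hJt s hs.1) hs.1).2.1.le) (t₀ + 1)
      ⟨by linarith, le_rfl⟩
    have h1 := (hγU t₀ ht₀ le_rfl).2.2
    have h2 := (hγU (t₀ + 1) (hJt _ (by linarith)) (by linarith)).2.2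
    have h3 : ν = (e (γ (t₀ + 1)) - e x) - (e (γ t₀) - e x)
        - (((e ∘ γ) (t₀ + 1) - (t₀ + 1) • ν) - ((e ∘ γ) t₀ - t₀ • ν)) := by
      simp only [Function.comp_apply]; module
    have h4 := norm_sub_le ((e (γ (t₀ + 1)) - e x) - (e (γ t₀) - e x))
      (((e ∘ γ) (t₀ + 1) - (t₀ + 1) • ν) - ((e ∘ γ) t₀ - t₀ • ν))
    rw [← h3] at h4
    have h5 := norm_sub_le (e (γ (t₀ + 1)) - e x) (e (γ t₀) - e x)
    linarith

end IntegralCurves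

end

/-! ### Confinement of curves in a chart and perturbation of timelike curves -/

noncomputable section

section Confinement

/-- A curve whose velocity in the chart `e` is bounded by `B` stays in a coordinate ball. -/
theorem chart_confinement_of_nonneg {M : Type*} [TopologicalSpace M] [T2Space M]
    {e : OpenPartialHomeomorph M E3} {γ : ℝ → M} {V : ℝ → E3} {y₀ : E3} {ρ r₀ B t₁ : ℝ}
    (ht₁ : 0 ≤ t₁) (hB : 0 ≤ B) (hγ : ContinuousOn γ (Icc 0 t₁))
    (hρ : Metric.ball y₀ ρ ⊆ e.target) (h0 : γ 0 ∈ e.source) (hr₀ : ‖e (γ 0) - y₀‖ ≤ r₀)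
    (hlt : r₀ + B * t₁ < ρ)
    (hV : ∀ t ∈ Icc 0 t₁, γ t ∈ e.source → ‖e (γ t) - y₀‖ < ρ →
      HasDerivAt (e ∘ γ) (V t) t ∧ ‖V t‖ ≤ B) :
    ∀ t ∈ Icc 0 t₁, γ t ∈ e.source ∧ ‖e (γ t) - y₀‖ ≤ r₀ + B * t := by
  set R := r₀ + B * t₁
  have hsub : Metric.closedBall y₀ R ⊆ e.target :=
    (Metric.closedBall_subset_ball hlt).trans hρ
  -- A compact coordinate ball is closed in the Hausdorff space `M`, so the curve cannot leave the
  -- chart domain in the limit; this makes continuous induction on `[0, t₁]` work.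
  have hK : IsClosed (e.symm '' Metric.closedBall y₀ R) :=
    ((isCompact_closedBall y₀ R).image_of_continuousOn
      (e.continuousOn_symm.mono hsub)).isClosed
  set A := Icc 0 t₁ ∩ γ ⁻¹' (e.symm '' Metric.closedBall y₀ R)
  have hA : IsClosed A := hγ.preimage_isClosed_of_isClosed isClosed_Icc hK
  have hAsrc : ∀ t ∈ A, γ t ∈ e.source := by
    rintro t ⟨-, y, hy, hyt⟩
    rw [← hyt]; exact e.map_target (hsub hy)
  have hc : ContinuousOn (fun t => ‖e (γ t) - y₀‖ - B * t) A := by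
    refine ContinuousOn.sub (ContinuousOn.norm (ContinuousOn.sub ?_ continuousOn_const))
      (by fun_prop)
    exact e.continuousOn.comp (hγ.mono inter_subset_left) hAsrc
  have hS : IsClosed (A ∩ (fun t => ‖e (γ t) - y₀‖ - B * t) ⁻¹' Iic r₀) :=
    hc.preimage_isClosed_of_isClosed hA isClosed_Iic
  have hmem : ∀ t ∈ Icc 0 t₁, γ t ∈ e.source → ‖e (γ t) - y₀‖ ≤ r₀ + B * t →
      t ∈ A ∩ (fun t => ‖e (γ t) - y₀‖ - B * t) ⁻¹' Iic r₀ := by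
    intro t ht hs hn
    refine ⟨⟨ht, e (γ t), ?_, e.left_inv hs⟩, ?_⟩
    · rw [Metric.mem_closedBall, dist_eq_norm]
      exact hn.trans (add_le_add_right (mul_le_mul_of_nonneg_left ht.2 hB) _)
    · simp only [mem_preimage, mem_Iic]; linarith
  have hsub : Icc 0 t₁ ⊆ A ∩ (fun t => ‖e (γ t) - y₀‖ - B * t) ⁻¹' Iic r₀ := by
    refine IsClosed.Icc_subset_of_forall_exists_gt ?_
      (hmem 0 ⟨le_rfl, ht₁⟩ h0 (by simpa using hr₀)) ?_
    · refine hS.inter isClosed_Icc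
    · rintro x ⟨⟨hxA, hxn⟩, hx⟩ y hy
      have hxI : x ∈ Icc 0 t₁ := ⟨hx.1, hx.2.le⟩
      have hxs := hAsrc x hxA
      simp only [mem_preimage, mem_Iic] at hxn
      have hxρ : ‖e (γ x) - y₀‖ < ρ := by
        have : B * x ≤ B * t₁ := by gcongr; exact hx.2.le
        linarith
      have hcx : ContinuousWithinAt γ (Icc 0 t₁) x := hγ x hxI
      have h1 : ∀ᶠ s in 𝓝[Icc 0 t₁] x, γ s ∈ e.source :=
        hcx.eventually (e.open_source.mem_nhds hxs)
      have h2 : ∀ᶠ s in 𝓝[Icc 0 t₁] x, ‖e (γ s) - y₀‖ < ρ := by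
        have : ContinuousWithinAt (fun s => ‖e (γ s) - y₀‖) (Icc 0 t₁) x :=
          (((e.continuousAt hxs).comp_continuousWithinAt hcx).sub
            continuousWithinAt_const).norm
        exact this.eventually (gt_mem_nhds hxρ)
      have h3 : 𝓝[≥] x ≤ 𝓝[Icc 0 t₁] x := by
        rw [← nhdsWithin_Icc_eq_nhdsGE hx.2]
        exact nhdsWithin_mono _ (Icc_subset_Icc_left hx.1)
      obtain ⟨u, hu, hus⟩ := (mem_nhdsGE_iff_exists_Icc_subset).1
        (h3 ((h1.and h2).and self_mem_nhdsWithin))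
      set z := min u y
      have hxz : x < z := lt_min hu hy
      have hzu : ∀ s ∈ Icc x z, (γ s ∈ e.source ∧ ‖e (γ s) - y₀‖ < ρ) ∧ s ∈ Icc 0 t₁ :=
        fun s hs => hus ⟨hs.1, hs.2.trans (min_le_left _ _)⟩
      have hmv := norm_image_sub_le_of_norm_deriv_le_segment' (a := x) (b := z)
        (f := e ∘ γ) (f' := V) (C := B)
        (fun s hs => ((hV s (hzu s hs).2 (hzu s hs).1.1 (hzu s hs).1.2).1).hasDerivWithinAt)
        (fun s hs => (hV s (hzu s ⟨hs.1, hs.2.le⟩).2 (hzu s ⟨hs.1, hs.2.le⟩).1.1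
          (hzu s ⟨hs.1, hs.2.le⟩).1.2).2) z ⟨hxz.le, le_rfl⟩
      have hz := hzu z ⟨hxz.le, le_rfl⟩
      refine ⟨z, hmem z hz.2 hz.1.1 ?_, hxz, min_le_right _ _⟩
      have h4 : e (γ z) - y₀ = ((e ∘ γ) z - (e ∘ γ) x) + (e (γ x) - y₀) := by
        simp only [Function.comp_apply]; abel
      rw [h4]
      refine (norm_add_le _ _).trans ?_
      linarith
  intro t ht
  have := hsub ht
  refine ⟨hAsrc t this.1, ?_⟩
  have h := this.2
  simp only [mem_preimage, mem_Iic] at h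
  linarith

/-- Once confined, in both time directions, the curve has velocity within `κ` of `V₀`; the mean
value inequality then compares it with a straight line. -/
theorem chart_confinement {M : Type*} [TopologicalSpace M] [T2Space M]
    {e : OpenPartialHomeomorph M E3} {γ : ℝ → M} {J : Set ℝ} {V : ℝ → E3} {y₀ V₀ : E3}
    {ρ r₀ κ τ : ℝ} (hJ : J.OrdConnected) (h0J : (0 : ℝ) ∈ J) (hκ : 0 ≤ κ)
    (hγ : ∀ t ∈ J, ContinuousAt γ t)
    (hρ : Metric.ball y₀ ρ ⊆ e.target) (h0 : γ 0 ∈ e.source) (hr₀ : ‖e (γ 0) - y₀‖ ≤ r₀)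
    (hlt : r₀ + (‖V₀‖ + κ) * τ < ρ)
    (hV : ∀ t ∈ J, γ t ∈ e.source → ‖e (γ t) - y₀‖ < ρ →
      HasDerivAt (e ∘ γ) (V t) t ∧ ‖V t - V₀‖ ≤ κ) :
    ∀ t ∈ J, |t| ≤ τ → γ t ∈ e.source ∧ ‖e (γ t) - y₀‖ ≤ r₀ + (‖V₀‖ + κ) * τ ∧
      ‖e (γ t) - e (γ 0) - t • V₀‖ ≤ κ * |t| := by
  have hB : 0 ≤ ‖V₀‖ + κ := by positivity
  have hVB : ∀ t, ‖V t - V₀‖ ≤ κ → ‖V t‖ ≤ ‖V₀‖ + κ := fun t h => by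
    linarith [norm_le_norm_add_norm_sub' (V t) V₀]
  have hmain : ∀ t ∈ J, |t| ≤ τ → γ t ∈ e.source ∧ ‖e (γ t) - y₀‖ ≤ r₀ + (‖V₀‖ + κ) * τ := by
    intro t ht htτ
    have hB' : (‖V₀‖ + κ) * |t| ≤ (‖V₀‖ + κ) * τ := by gcongr
    rcases le_total 0 t with h | h
    · rw [abs_of_nonneg h] at hB'
      have hsub : Icc 0 t ⊆ J := hJ.out h0J ht
      have := chart_confinement_of_nonneg (V := V) h hB
        (fun s hs => (hγ s (hsub hs)).continuousWithinAt) hρ h0 hr₀ (by linarith)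
        (fun s hs h1 h2 => ⟨(hV s (hsub hs) h1 h2).1, hVB s (hV s (hsub hs) h1 h2).2⟩) t
        ⟨h, le_rfl⟩
      exact ⟨this.1, by linarith [this.2]⟩
    · rw [abs_of_nonpos h] at hB'
      have hsub : ∀ s ∈ Icc 0 (-t), -s ∈ J := fun s hs =>
        hJ.out ht h0J ⟨by linarith [hs.2], by linarith [hs.1]⟩
      have := chart_confinement_of_nonneg (e := e) (γ := fun s => γ (-s)) (V := fun s => -V (-s))
        (y₀ := y₀) (ρ := ρ) (r₀ := r₀) (neg_nonneg.2 h) hB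
        (fun s hs => ((hγ (-s) (hsub s hs)).comp
          (f := fun s => -s) continuous_neg.continuousAt).continuousWithinAt) hρ
        (by simpa using h0) (by simpa using hr₀) (by linarith)
        (fun s hs h1 h2 => ⟨?_, by
          rw [norm_neg]; exact hVB _ (hV (-s) (hsub s hs) h1 h2).2⟩) (-t)
        ⟨neg_nonneg.2 h, le_rfl⟩
      · simp only [neg_neg] at this
        exact ⟨this.1, by linarith [this.2]⟩
      · have := (hV (-s) (hsub s hs) h1 h2).1.scomp s (hasDerivAt_neg s)
        simpa [Function.comp_def] using this
  intro t ht htτ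
  refine ⟨(hmain t ht htτ).1, (hmain t ht htτ).2, ?_⟩
  have hseg : ∀ s ∈ uIcc 0 t, s ∈ J ∧ |s| ≤ τ := by
    intro s hs
    refine ⟨hJ.uIcc_subset h0J ht hs, le_trans ?_ htτ⟩
    have := abs_sub_left_of_mem_uIcc hs
    simpa using this
  have hmv := (convex_uIcc 0 t).norm_image_sub_le_of_norm_hasDerivWithin_le
    (f := fun s => (e ∘ γ) s - s • V₀) (f' := fun s => V s - (1 : ℝ) • V₀) (C := κ)
    (x := 0) (y := t)
    (fun s hs => by
      have h1 := hseg s hs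
      have h2 := hmain s h1.1 h1.2
      exact ((hV s h1.1 h2.1 (h2.2.trans_lt hlt)).1.sub
        ((hasDerivAt_id s).smul_const V₀)).hasDerivWithinAt)
    (fun s hs => by
      have h1 := hseg s hs
      have h2 := hmain s h1.1 h1.2
      rw [one_smul]
      exact (hV s h1.1 h2.1 (h2.2.trans_lt hlt)).2) left_mem_uIcc right_mem_uIcc
  have h3 : e (γ t) - e (γ 0) - t • V₀
      = ((e ∘ γ) t - t • V₀) - ((e ∘ γ) 0 - (0 : ℝ) • V₀) := by
    simp only [Function.comp_apply, zero_smul]; abel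
  rw [h3]
  simpa using hmv

/-- A `C¹` cut-off function on the line, with its derivative bounded. -/
theorem exists_cutoff : ∃ (χ : ℝ → ℝ) (D : ℝ), ContDiff ℝ 1 χ ∧ χ 0 = 1 ∧
    (∀ s, 1 / 2 ≤ |s| → χ s = 0) ∧ (∀ s, |χ s| ≤ 1) ∧ 0 ≤ D ∧ ∀ s, |deriv χ s| ≤ D := by
  let χ : ContDiffBump (0 : ℝ) := ⟨1 / 4, 1 / 2, by norm_num, by norm_num⟩
  have hχ : ContDiff ℝ 1 χ := χ.contDiff
  obtain ⟨D, hD⟩ := χ.hasCompactSupport.deriv.exists_bound_of_continuous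
    (hχ.continuous_deriv le_rfl)
  refine ⟨χ, D, hχ, χ.one_of_mem_closedBall (by simp [χ]), ?_, ?_, (norm_nonneg _).trans (hD 0),
    fun s => hD s⟩
  · intro s hs
    exact χ.zero_of_le_dist (by simpa [χ, Real.dist_eq] using hs)
  · intro s
    rw [abs_of_nonneg χ.nonneg]
    exact χ.le_one

end Confinement

namespace LorentzianMetric

variable {M : Type*} [TopologicalSpace M] [ChartedSpace E3 M] [IsManifold (𝓡 3) ∞ M]
  {g : LorentzianMetric M} {e : OpenPartialHomeomorph M E3} {T : ∀ x : M, TangentSpace (𝓡 3) x}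
  {γ β : ℝ → M} {J : Set ℝ} {t : ℝ}

theorem IsTimelike.isCausal {x : M} {v : TangentSpace (𝓡 3) x} (h : g.IsTimelike v) :
    g.IsCausal v := by
  refine ⟨?_, le_of_lt h⟩
  rintro rfl
  have h' : g.val x 0 0 < 0 := h
  simp at h'

theorem IsMaximalIntegralCurve.isTimelikeCurveOn (h : IsMaximalIntegralCurve γ T J)
    (hT : ContMDiff (𝓡 3) (𝓡 3).tangent 1 (fun x => (⟨x, T x⟩ : TangentBundle (𝓡 3) M)))
    (hT0 : ∀ x, g.IsTimelike (T x)) : g.IsTimelikeCurveOn γ J := by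
  refine ⟨⟨⟨0, h.zero_mem⟩, h.isOpen, h.ordConnected,
    h.isMIntegralCurveOn.contMDiffOn h.isOpen hT.continuous⟩, fun t ht => ?_⟩
  rw [h.isMIntegralCurveOn.curveVelocity_eq h.isOpen ht]
  exact hT0 _

theorem contMDiff_neg_field
    (hT : ContMDiff (𝓡 3) (𝓡 3).tangent 1 (fun x => (⟨x, T x⟩ : TangentBundle (𝓡 3) M))) :
    ContMDiff (𝓡 3) (𝓡 3).tangent 1 (fun x => (⟨x, -T x⟩ : TangentBundle (𝓡 3) M)) := by
  have : IsManifold (𝓡 3) (1 + 1) M :=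
    IsManifold.of_le (n := ∞) (by norm_num; exact ENat.LEInfty.out)
  exact ContMDiff.neg_section hT

theorem IsMaximalIntegralCurve.isInextensibleCausalCurveOn (h : IsMaximalIntegralCurve γ T J)
    (hT : ContMDiff (𝓡 3) (𝓡 3).tangent 1 (fun x => (⟨x, T x⟩ : TangentBundle (𝓡 3) M)))
    (hT0 : ∀ x, g.IsTimelike (T x)) : g.IsInextensibleCausalCurveOn γ J := by
  have htl := IsMaximalIntegralCurve.isTimelikeCurveOn h hT hT0
  have : Nonempty J := ⟨⟨0, h.zero_mem⟩⟩
  have hne : ∀ x, T x ≠ 0 := fun x => (hT0 x).isCausal.1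
  refine ⟨⟨htl.1, fun t ht => (htl.2 t ht).isCausal⟩, ?_, ?_⟩
  · rintro ⟨p, hp⟩
    refine h.not_tendsto_top hT hne p fun U hU => ?_
    obtain ⟨t₀, ht₀⟩ := (mem_atTop_sets.1 (hp hU))
    exact ⟨t₀, t₀.2, fun t ht htt => ht₀ ⟨t, ht⟩ htt⟩
  · rintro ⟨p, hp⟩
    refine h.reverse.not_tendsto_top (contMDiff_neg_field hT) (fun x => neg_ne_zero.2 (hne x)) p
      fun U hU => ?_
    obtain ⟨t₀, ht₀⟩ := (mem_atBot_sets.1 (hp hU))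
    refine ⟨-t₀, by simp, fun t ht htt => ht₀ ⟨-t, ht⟩ ?_⟩
    change -t ≤ (t₀ : ℝ)
    linarith

theorem val_curveVelocity_congr (h : β =ᶠ[𝓝 t] γ) :
    g.val (β t) (curveVelocity β t) (curveVelocity β t)
      = g.val (γ t) (curveVelocity γ t) (curveVelocity γ t) := by
  have h1 : (curveVelocity β t : E3) = (curveVelocity γ t : E3) :=
    congrArg (fun L : ℝ →L[ℝ] E3 => L 1) (h.mfderiv_eq (I := 𝓘(ℝ, ℝ)) (I' := 𝓡 3))
  have h2 := g.val_congr h.self_of_nhds (curveVelocity β t : E3) (curveVelocity β t : E3)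
  refine h2.trans ?_
  exact congrArg (fun w : E3 => (g.val (γ t) : E3 →L[ℝ] E3 →L[ℝ] ℝ) w w) h1

theorem val_curveVelocity_symm (he : e ∈ atlas E3 M) {c : ℝ → E3} {v : E3}
    (hc : HasDerivAt c v t) (ht : c t ∈ e.target) :
    g.val ((e.symm ∘ c) t) (curveVelocity (e.symm ∘ c) t) (curveVelocity (e.symm ∘ c) t)
      = g.inChart e (c t) v v := by
  have h1 := ((mdifferentiable_of_mem_atlas (I := 𝓡 3) he).mdifferentiableAt_symm
    ht).hasMFDerivAt
  have h2 : HasMFDerivAt 𝓘(ℝ, ℝ) (𝓡 3) c t _ := hasMFDerivAt_iff_hasFDerivAt.2 hc.hasFDerivAt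
  have h3 := (h1.comp t h2).mfderiv
  have h4 : (curveVelocity (e.symm ∘ c) t : E3) = mfderiv (𝓡 3) (𝓡 3) e.symm (c t) v := by
    refine (congrArg (fun L : ℝ →L[ℝ] E3 => L 1) h3).trans ?_
    exact congrArg (mfderiv (𝓡 3) (𝓡 3) e.symm (c t) : E3 →L[ℝ] E3) (one_smul ℝ v)
  rw [inChart_apply]
  exact congrArg (fun w : E3 => (g.val (e.symm (c t)) : E3 →L[ℝ] E3 →L[ℝ] ℝ) w w) h4

/-- A small `C¹` perturbation, in a chart, of a compact part of a timelike curve. -/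
theorem IsTimelikeCurveOn.exists_perturbation (h : g.IsTimelikeCurveOn γ J)
    (he : e ∈ atlas E3 M) {δ : ℝ → E3} {τ : ℝ} (hτ : 0 < τ) (hδ : ContDiff ℝ 1 δ)
    (hδ0 : ∀ t, τ / 2 ≤ |t| → δ t = 0)
    (hsrc : ∀ t ∈ J, |t| ≤ τ → γ t ∈ e.source ∧ e (γ t) - δ t ∈ e.target)
    (hneg : ∀ t ∈ J, |t| < τ → g.inChart e (e (γ t) - δ t) (deriv (e ∘ γ) t - deriv δ t)
      (deriv (e ∘ γ) t - deriv δ t) < 0) :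
    ∃ β : ℝ → M, g.IsTimelikeCurveOn β J ∧ β 0 = e.symm (e (γ 0) - δ 0) ∧
      ∀ t, τ ≤ |t| → β t = γ t := by
  let c : ℝ → E3 := fun t => e (γ t) - δ t
  let β : ℝ → M := fun t => if |t| < τ then (e.symm ∘ c) t else γ t
  have hcd : ∀ t ∈ J, |t| ≤ τ → ContDiffAt ℝ 1 (e ∘ γ) t := by
    intro t ht htτ
    have h1 : ContMDiffAt (𝓡 3) (𝓡 3) 1 e (γ t) :=
      ((contMDiffOn_atlas_chart he).contMDiffAt (e.open_source.mem_nhds (hsrc t ht htτ).1)).of_le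
        ENat.LEInfty.out
    exact (h1.comp t (h.1.contMDiffOn.contMDiffAt (h.1.isOpen.mem_nhds ht))).contDiffAt
  have hin : ∀ t, |t| < τ → β =ᶠ[𝓝 t] e.symm ∘ c := by
    intro t ht
    filter_upwards [(isOpen_lt continuous_abs continuous_const).mem_nhds ht] with s hs
    exact if_pos hs
  -- Since `δ` already vanishes from `τ / 2` on, the two definitions agree on a whole neighbourhood
  -- even at `|t| = τ`.
  have hout : ∀ t ∈ J, τ ≤ |t| → β =ᶠ[𝓝 t] γ := by
    intro t ht htτ
    filter_upwards [(isOpen_lt continuous_const continuous_abs).mem_nhds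
      (show τ / 2 < |t| by linarith), h.1.isOpen.mem_nhds ht] with s hs hsJ
    by_cases hsτ : |s| < τ
    · simp only [β, if_pos hsτ, Function.comp_apply, c, hδ0 s hs.le, sub_zero]
      exact e.left_inv (hsrc s hsJ hsτ.le).1
    · exact if_neg hsτ
  refine ⟨β, ⟨⟨h.1.nonempty, h.1.isOpen, h.1.ordConnected, fun t ht => ?_⟩, fun t ht => ?_⟩,
    ?_, fun t ht => if_neg (not_lt.2 ht)⟩
  · refine ContMDiffAt.contMDiffWithinAt ?_
    rcases lt_or_ge |t| τ with htτ | htτ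
    · have h1 : ContMDiffAt (𝓡 3) (𝓡 3) 1 e.symm (c t) :=
        ((contMDiffOn_atlas_symm he).contMDiffAt
          (e.open_target.mem_nhds (hsrc t ht htτ.le).2)).of_le ENat.LEInfty.out
      have h2 : ContDiffAt ℝ 1 c t := (hcd t ht htτ.le).sub hδ.contDiffAt
      exact (h1.comp t h2.contMDiffAt).congr_of_eventuallyEq (hin t htτ)
    · exact (h.1.contMDiffOn.contMDiffAt (h.1.isOpen.mem_nhds ht)).congr_of_eventuallyEq
        (hout t ht htτ)
  · rcases lt_or_ge |t| τ with htτ | htτ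
    · have h2 : HasDerivAt c (deriv (e ∘ γ) t - deriv δ t) t :=
        ((hcd t ht htτ.le).differentiableAt (by simp)).hasDerivAt.sub
          (hδ.differentiable (by simp) t).hasDerivAt
      refine lt_of_eq_of_lt ((val_curveVelocity_congr (hin t htτ)).trans ?_) (hneg t ht htτ)
      exact val_curveVelocity_symm he h2 (hsrc t ht htτ.le).2
    · exact lt_of_eq_of_lt (val_curveVelocity_congr (hout t ht htτ)) (h.2 t ht)
  · exact if_pos (by simpa using hτ)

end LorentzianMetric

end

/-! ### No local maximum with spacelike gradient on a Cauchy surface -/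

noncomputable section

namespace LorentzianMetric

variable {M : Type*} [TopologicalSpace M] [ChartedSpace E3 M] [IsManifold (𝓡 3) ∞ M]
  {g : LorentzianMetric M} {e : OpenPartialHomeomorph M E3}

theorem inChart_apply_chart {m : M} (hm : m ∈ e.source) (u v : E3) :
    g.inChart e (e m) u v = (g.val m : E3 →L[ℝ] E3 →L[ℝ] ℝ)
      (mfderiv (𝓡 3) (𝓡 3) e.symm (e m) u : E3) (mfderiv (𝓡 3) (𝓡 3) e.symm (e m) v : E3) :=
  g.val_congr (e.left_inv hm) _ _

/-- Being timelike is an open condition. The velocity is allowed `2 * r` to absorb two errors of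
size `r`: the variation of the field and the derivative of the perturbation. -/
theorem exists_timelike_ball {G : E3 → E3 →L[ℝ] E3 →L[ℝ] ℝ} {y₀ V₀ : E3}
    (hG : ContinuousAt G y₀) (h : G y₀ V₀ V₀ < 0) :
    ∃ r > 0, ∀ y v, ‖y - y₀‖ < r → ‖v - V₀‖ < 2 * r → G y v v < 0 := by
  have hc : ContinuousAt (fun q : E3 × E3 => G q.1 q.2 q.2) (y₀, V₀) := by
    have h1 : ContinuousAt (fun q : E3 × E3 => G q.1) (y₀, V₀) :=
      ContinuousAt.comp (f := Prod.fst) (x := (y₀, V₀)) hG continuousAt_fst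
    exact (h1.clm_apply continuousAt_snd).clm_apply continuousAt_snd
  obtain ⟨s, hs, hs'⟩ := Metric.eventually_nhds_iff.1 (hc.eventually (gt_mem_nhds h))
  refine ⟨s / 2, by linarith, fun y v hy hv => @hs' (y, v) ?_⟩
  rw [Prod.dist_eq, dist_eq_norm, dist_eq_norm]
  exact max_lt (by linarith) (by linarith)

/-- A function whose gradient at a point of a Cauchy surface is spacelike has no local maximum
there on the Cauchy surface. -/
theorem IsCauchySurface.not_isLocalMaxOn [T2Space M] [SecondCountableTopology M] {X : Set M}
    (hX : g.IsCauchySurface X) (ho : g.IsTimeOrientable) {p : M} (hp : p ∈ X)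
    (he : e ∈ atlas E3 M) (hpe : p ∈ e.source) {f : M → ℝ} {W : E3}
    (hf : HasFDerivAt (fun y => f (e.symm y)) (g.inChart e (e p) W) (e p))
    (hW : 0 < g.inChart e (e p) W W) : ¬ IsLocalMaxOn f X p := by
  intro hmax
  have hpp : e.symm (e p) = p := e.left_inv hpe
  set y₀ := e p
  have hy₀t : y₀ ∈ e.target := e.map_source hpe
  set G := g.inChart e
  have hGm := g.isMetricOn_inChart he
  obtain ⟨T, hTs, hT0, hTZ⟩ : ∃ T : ∀ x : M, TangentSpace (𝓡 3) x,
      ContMDiff (𝓡 3) (𝓡 3).tangent ∞ (fun x => (⟨x, T x⟩ : TangentBundle (𝓡 3) M)) ∧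
      (∀ x, g.IsTimelike (T x)) ∧ G y₀ W (chartComponents e T p) = 0 := by
    obtain ⟨T, h1, h2, h3⟩ := g.exists_smooth_timelike_field ho p
      (Z := (mfderiv (𝓡 3) (𝓡 3) e.symm y₀ W : E3))
      (lt_of_lt_of_eq hW (inChart_apply_chart hpe W W))
    refine ⟨T, h1, h2, ?_⟩
    refine ((hGm.symm y₀ hy₀t _ _).trans (inChart_apply_chart hpe _ W)).trans (Eq.trans ?_ h3)
    exact congrArg (fun w : E3 => (g.val p : E3 →L[ℝ] E3 →L[ℝ] ℝ) w
      (mfderiv (𝓡 3) (𝓡 3) e.symm y₀ W : E3)) (mfderiv_symm_chartComponents he hpe)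
  have hT1 : ContMDiff (𝓡 3) (𝓡 3).tangent 1
      (fun x => (⟨x, T x⟩ : TangentBundle (𝓡 3) M)) := hTs.of_le ENat.LEInfty.out
  set V₀ := chartComponents e T p
  have hV₀neg : G y₀ V₀ V₀ < 0 := by
    refine lt_of_eq_of_lt ((inChart_apply_chart hpe _ _).trans ?_) (hT0 p)
    exact congrArg (fun w : E3 => (g.val p : E3 →L[ℝ] E3 →L[ℝ] ℝ) w w)
      (mfderiv_symm_chartComponents he hpe)
  set ℓ := G y₀ W
  obtain ⟨κ₁, hκ₁, htime⟩ := exists_timelike_ball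
    (hGm.contDiffOn.continuousOn.continuousAt (e.open_target.mem_nhds hy₀t)) hV₀neg
  obtain ⟨χ, D, hχ, hχ0, hχs, hχ1, hD, hχD⟩ := exists_cutoff
  -- `C` is the ratio of the duration `τ` of the perturbation to its size `ε`, large enough that its
  -- derivative, at most `D * ‖W‖ / C`, is below `κ₁`.
  set C := D * ‖W‖ / κ₁ + 1
  have hC : 0 < C := by positivity
  have hCκ : D * ‖W‖ < κ₁ * C := by
    have : κ₁ * C = D * ‖W‖ + κ₁ := by simp only [C]; field_simp
    linarith
  -- `κ` bounds the variation of the field and `η` below the Taylor error of `f`. Each costs less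
  -- than half of the gain `ε * ℓ W`; `ε` is fixed last, so that everything stays in the ball of
  -- radius `ρ`.
  set κ := min κ₁ (ℓ W / 3 / (‖ℓ‖ * C + 1))
  have hκ : 0 < κ := lt_min hκ₁ (by positivity)
  have hκC : ‖ℓ‖ * (κ * C) < ℓ W / 2 := by
    have h1 : κ * (‖ℓ‖ * C + 1) ≤ ℓ W / 3 :=
      (le_div_iff₀ (by positivity)).1 (min_le_right _ _)
    nlinarith
  set B := ‖V₀‖ + κ
  have hB : 0 < B := by positivity
  set η := ℓ W / 3 / (‖W‖ + B * C)
  have hη : 0 < η := by positivity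
  have hηB : η * (‖W‖ + B * C) < ℓ W / 2 := by
    have : η * (‖W‖ + B * C) = ℓ W / 3 := div_mul_cancel₀ _ (by positivity)
    linarith
  obtain ⟨ρ, hρ, hloc⟩ : ∃ ρ > 0, ∀ y, ‖y - y₀‖ < ρ → y ∈ e.target ∧ ‖y - y₀‖ < κ₁ ∧
      ‖chartComponents e T (e.symm y) - V₀‖ ≤ κ ∧
      |f (e.symm y) - f p - ℓ (y - y₀)| ≤ η * ‖y - y₀‖ ∧ (e.symm y ∈ X → f (e.symm y) ≤ f p) := by
    have h1 : ∀ᶠ y in 𝓝 y₀, y ∈ e.target := e.open_target.mem_nhds hy₀t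
    have h2 : ∀ᶠ y in 𝓝 y₀, ‖y - y₀‖ < κ₁ := by
      filter_upwards [Metric.ball_mem_nhds y₀ hκ₁] with y hy
      rwa [Metric.mem_ball, dist_eq_norm] at hy
    have hsymm : Tendsto e.symm (𝓝 y₀) (𝓝 p) := by
      have := (e.continuousAt_symm hy₀t).tendsto
      rwa [hpp] at this
    have h3 : ∀ᶠ y in 𝓝 y₀, ‖chartComponents e T (e.symm y) - V₀‖ ≤ κ := by
      have hVc : ContinuousAt (chartComponents e T) p :=
        (continuousOn_chartComponents he hTs.continuous).continuousAt
          (e.open_source.mem_nhds hpe)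
      filter_upwards [(hVc.tendsto.comp hsymm).eventually (Metric.ball_mem_nhds _ hκ)] with y hy
      exact (mem_ball_iff_norm.1 hy).le
    have h4 : ∀ᶠ y in 𝓝 y₀, |f (e.symm y) - f p - ℓ (y - y₀)| ≤ η * ‖y - y₀‖ := by
      have := hf.isLittleO.def hη
      simpa only [hpp, Real.norm_eq_abs] using this
    have h5 : ∀ᶠ y in 𝓝 y₀, e.symm y ∈ X → f (e.symm y) ≤ f p :=
      hsymm.eventually (eventually_nhdsWithin_iff.1 hmax)
    obtain ⟨ρ, hρ, h⟩ := Metric.eventually_nhds_iff.1 (h1.and (h2.and (h3.and (h4.and h5))))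
    exact ⟨ρ, hρ, fun y hy => h (by rwa [dist_eq_norm])⟩
  obtain ⟨ε, hε, hερ⟩ : ∃ ε > 0, ε * (2 * ‖W‖ + B * C + 1) < ρ :=
    ⟨ρ / 2 / (2 * ‖W‖ + B * C + 1), by positivity, by
      rw [div_mul_cancel₀ _ (by positivity)]; linarith⟩
  set τ := C * ε
  have hτ : 0 < τ := by positivity
  have hBτ : ε * ‖W‖ + B * τ + ε * ‖W‖ < ρ := by
    have : ε * ‖W‖ + B * τ + ε * ‖W‖ + ε = ε * (2 * ‖W‖ + B * C + 1) := by
      simp only [τ]; ring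
    linarith
  have hεW : 0 ≤ ε * ‖W‖ := by positivity
  have hq : ‖y₀ + ε • W - y₀‖ < ρ := by
    rw [add_sub_cancel_left, norm_smul, Real.norm_of_nonneg hε.le]
    have : 0 ≤ B * τ := by positivity
    linarith
  obtain ⟨γ, J, hγ0, hγ⟩ := exists_isMaximalIntegralCurve hT1 (e.symm (y₀ + ε • W))
  have hqt := (hloc _ hq).1
  have hγs : γ 0 ∈ e.source := by rw [hγ0]; exact e.map_target hqt
  have heγ : e (γ 0) = y₀ + ε • W := by rw [hγ0]; exact e.right_inv hqt
  have hd : ∀ s ∈ J, HasMFDerivAt 𝓘(ℝ, ℝ) (𝓡 3) γ s ((1 : ℝ →L[ℝ] ℝ).smulRight (T (γ s))) :=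
    fun s hs => (hγ.isMIntegralCurveOn s hs).hasMFDerivAt (hγ.isOpen.mem_nhds hs)
  have hV : ∀ t ∈ J, γ t ∈ e.source → ‖e (γ t) - y₀‖ < ρ →
      HasDerivAt (e ∘ γ) (chartComponents e T (γ t)) t ∧
        ‖chartComponents e T (γ t) - V₀‖ ≤ κ := by
    intro t ht hs hn
    refine ⟨hasDerivAt_chart_comp he (hd t ht) hs, ?_⟩
    have := (hloc _ hn).2.2.1
    rwa [e.left_inv hs] at this
  have hconf := chart_confinement (e := e) (γ := γ) (V := fun t => chartComponents e T (γ t))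
    (y₀ := y₀) (V₀ := V₀) (ρ := ρ) (r₀ := ε * ‖W‖) (κ := κ) (τ := τ)
    hγ.ordConnected hγ.zero_mem hκ.le (fun t ht => (hd t ht).continuousAt)
    (fun y hy => (hloc y (by rwa [Metric.mem_ball, dist_eq_norm] at hy)).1) hγs
    (by rw [heγ, add_sub_cancel_left, norm_smul, Real.norm_of_nonneg hε.le])
    (by linarith) hV
  have htl := IsMaximalIntegralCurve.isTimelikeCurveOn hγ hT1 hT0
  obtain ⟨t₀, ht₀, ht₀X⟩ : ∃ t ∈ J, γ t ∈ X := by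
    have : γ 0 ∈ g.domainOfDependence X := by rw [hX.2]; exact mem_univ _
    exact this γ J (IsMaximalIntegralCurve.isInextensibleCausalCurveOn hγ hT1 hT0)
      ⟨0, hγ.zero_mem, rfl⟩
  rcases lt_or_ge |t₀| τ with h | h
  -- Early meeting with `X`: as `ℓ V₀ = 0`, the gain `ε * ℓ W` survives up to the two errors, so `f`
  -- exceeds `f p` at a nearby point of `X`.
  · obtain ⟨hs, hn, hlin⟩ := hconf t₀ ht₀ h.le
    have hnρ : ‖e (γ t₀) - y₀‖ < ρ := by linarith
    obtain ⟨-, -, -, hfa, hfm⟩ := hloc _ hnρ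
    rw [e.left_inv hs] at hfa hfm
    have hfm := hfm ht₀X
    rw [heγ] at hlin
    set r := e (γ t₀) - (y₀ + ε • W) - t₀ • V₀
    have hℓ : ℓ (e (γ t₀) - y₀) = ε * ℓ W + ℓ r := by
      have : e (γ t₀) - y₀ = ε • W + t₀ • V₀ + r := by simp only [r]; abel
      rw [this]
      simp only [map_add, map_smul, smul_eq_mul, hTZ]
      ring
    have hr : |ℓ r| ≤ ε * (‖ℓ‖ * (κ * C)) := by
      refine (ℓ.le_opNorm r).trans ?_
      have : ‖r‖ ≤ κ * τ := hlin.trans (mul_le_mul_of_nonneg_left h.le hκ.le)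
      calc ‖ℓ‖ * ‖r‖ ≤ ‖ℓ‖ * (κ * τ) := by gcongr
        _ = _ := by simp only [τ]; ring
    have hn' : η * ‖e (γ t₀) - y₀‖ ≤ ε * (η * (‖W‖ + B * C)) := by
      calc η * ‖e (γ t₀) - y₀‖ ≤ η * (ε * ‖W‖ + B * τ) := by gcongr
        _ = _ := by simp only [τ]; ring
    have h1 := (abs_le.1 hfa).1
    have h2 := (abs_le.1 hr).1
    have h3 := mul_lt_mul_of_pos_left hκC hε
    have h4 := mul_lt_mul_of_pos_left hηB hε
    linarith
  -- Late meeting: subtracting `δ` undoes the displacement `ε • W` at time 0, so the new curve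
  -- passes through `p` and still meets `X` at the unperturbed time `t₀`.
  · let δ : ℝ → E3 := fun t => χ (t / τ) • (ε • W)
    have hδ : ContDiff ℝ 1 δ := (hχ.comp (contDiff_id.div_const τ)).smul contDiff_const
    have hδn : ∀ t, ‖δ t‖ ≤ ε * ‖W‖ := by
      intro t
      simp only [δ, norm_smul, Real.norm_eq_abs, abs_of_pos hε]
      exact mul_le_of_le_one_left hεW (hχ1 _)
    have hδd : ∀ t, ‖deriv δ t‖ < κ₁ := by
      intro t
      have h1 : HasDerivAt δ ((deriv χ (t / τ) * (1 / τ)) • (ε • W)) t :=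
        (((hχ.differentiable (by simp) (t / τ)).hasDerivAt.comp t
          ((hasDerivAt_id t).div_const τ))).smul_const _
      rw [h1.deriv]
      simp only [norm_smul, Real.norm_eq_abs, abs_mul, abs_of_pos hε, abs_of_pos hτ, abs_div,
        abs_one]
      have h2 : |deriv χ (t / τ)| * (1 / τ) * (ε * ‖W‖) = |deriv χ (t / τ)| * ‖W‖ / C := by
        simp only [τ]; field_simp
      rw [h2, div_lt_iff₀ hC]
      exact lt_of_le_of_lt (by gcongr; exact hχD _) hCκ
    have hyδ : ∀ t ∈ J, |t| ≤ τ → ‖e (γ t) - δ t - y₀‖ < ρ := by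
      intro t ht htτ
      have h1 := (hconf t ht htτ).2.1
      have h2 : e (γ t) - δ t - y₀ = (e (γ t) - y₀) - δ t := by abel
      rw [h2]
      linarith [norm_sub_le (e (γ t) - y₀) (δ t), hδn t]
    obtain ⟨β, hβ, hβ0, hβt⟩ := htl.exists_perturbation he hτ hδ
      (fun t ht => by
        have : χ (t / τ) = 0 := hχs _ (by
          rw [abs_div, abs_of_pos hτ, le_div_iff₀ hτ]; linarith)
        simp only [δ, this, zero_smul])
      (fun t ht htτ => ⟨(hconf t ht htτ).1, (hloc _ (hyδ t ht htτ)).1⟩)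
      (fun t ht htτ => by
        obtain ⟨hs, hn, -⟩ := hconf t ht htτ.le
        have hVt := hV t ht hs (by linarith)
        refine htime _ _ (hloc _ (hyδ t ht htτ.le)).2.1 ?_
        rw [hVt.1.deriv]
        have h2 : chartComponents e T (γ t) - deriv δ t - V₀
            = (chartComponents e T (γ t) - V₀) - deriv δ t := by abel
        rw [h2]
        have h3 : κ ≤ κ₁ := min_le_left _ _
        linarith [norm_sub_le (chartComponents e T (γ t) - V₀) (deriv δ t), hδd t, hVt.2])
    have hβp : β 0 ∈ X := by
      have : e (γ 0) - δ 0 = y₀ := by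
        simp only [heγ, δ, zero_div, hχ0, one_smul, add_sub_cancel_right]
      rw [hβ0, this, hpp]; exact hp
    have hβX : β t₀ ∈ X := by rw [hβt t₀ h]; exact ht₀X
    have ht₀0 : t₀ ≠ 0 := by
      rintro rfl
      rw [abs_zero] at h
      linarith
    refine hX.1 ⟨β, J, hβ, ?_⟩
    rcases lt_or_gt_of_ne ht₀0 with h0 | h0
    · exact ⟨t₀, ht₀, 0, hγ.zero_mem, h0, hβX, hβp⟩
    · exact ⟨0, hγ.zero_mem, t₀, ht₀, h0, hβp, hβX⟩

theorem isLocalSystem_isLinearAt (hg : g.HasConstantSectionalCurvature (-1)) :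
    IsLocalSystem g.IsLinearAt where
  congr := fun h hff' => h.congr hff'
  unique := fun h h' => IsLinearAt.unique hg h h'
  extend := fun m => exists_extension_isLinearAt hg m

end LorentzianMetric

end

/-! ### Conclusion: the maximum of the global section -/

theorem mainTheorem6 {M : Type*} [TopologicalSpace M] [T2Space M] [SecondCountableTopology M]
    [ConnectedSpace M] [ChartedSpace E3 M] [IsManifold (𝓡 3) ∞ M]
    (g : LorentzianMetric M) (hg : g.IsAntiDeSitter) :
    ¬ ∃ X : Set M, g.IsCauchySurface X ∧
      Nonempty (X ≃ₜ Metric.sphere (0 : EuclideanSpace ℝ (Fin 3)) 1) := by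
  rintro ⟨X, hX, ⟨Ψ⟩⟩
  let φ : Metric.sphere (0 : EuclideanSpace ℝ (Fin 3)) 1 → M := fun x => Ψ.symm x
  have hφ : Continuous φ := continuous_subtype_val.comp Ψ.symm.continuous
  obtain ⟨s, hs⟩ := (LorentzianMetric.isLocalSystem_isLinearAt hg.2).exists_section_sphere hφ
    (LorentzianMetric.exists_isLinearAt hg.2)
  have hcompat : ∀ x, ∀ᶠ x' in 𝓝 x, s x' (φ x') = s x (φ x') := by
    intro x
    have := hs.compat x (mem_univ x)
    rw [nhdsWithin_univ] at this
    filter_upwards [this] with x' hx' using hx'.self_of_nhds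
  have hcont : Continuous fun x => s x (φ x) := by
    refine continuous_iff_continuousAt.2 fun x => ?_
    exact ((hs.sol x (mem_univ x)).continuousAt.comp hφ.continuousAt).congr
      ((hcompat x).mono fun x' h => h.symm)
  have hne : (univ : Set (Metric.sphere (0 : EuclideanSpace ℝ (Fin 3)) 1)).Nonempty := by
    have := (NormedSpace.sphere_nonempty (E := EuclideanSpace ℝ (Fin 3)) (x := 0)
      (r := 1)).2 zero_le_one
    exact ⟨⟨_, this.some_mem⟩, mem_univ _⟩
  obtain ⟨x₀, -, hx₀⟩ := isCompact_univ.exists_isMaxOn hne hcont.continuousOn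
  have hpX : φ x₀ ∈ X := (Ψ.symm x₀).2
  obtain ⟨W, hW, hWW⟩ := (hs.sol x₀ (mem_univ x₀)).hasFDerivAt (chart_mem_atlas E3 (φ x₀))
    (mem_chart_source E3 (φ x₀))
  refine hX.not_isLocalMaxOn hg.1 hpX (chart_mem_atlas E3 (φ x₀)) (mem_chart_source E3 (φ x₀))
    hW hWW ?_
  -- Near `x₀` the varying germs are all germs of the single function `s x₀`, so the global maximum
  -- is a local maximum of that function on `X`.
  have h1 : ∀ᶠ x' in 𝓝 x₀, s x₀ (φ x') ≤ s x₀ (φ x₀) := by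
    filter_upwards [hcompat x₀] with x' hx'
    rw [← hx']
    exact hx₀ (mem_univ x')
  have h2 : ∀ᶠ m : X in 𝓝 (Ψ.symm x₀), s x₀ (m : M) ≤ s x₀ (φ x₀) := by
    have := Ψ.continuous.continuousAt (x := Ψ.symm x₀)
    rw [ContinuousAt, Ψ.apply_symm_apply] at this
    filter_upwards [this.eventually h1] with m hm
    simpa [φ] using hm
  have h3 : 𝓝[X] (φ x₀) = map Subtype.val (𝓝 (Ψ.symm x₀)) := nhdsWithin_eq_map_subtype_coe hpX
  rw [IsLocalMaxOn, IsMaxFilter, h3]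
  exact h2
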